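/- Let $X$ be a smooth compact complex toric surface, that is, the toric surface $X$ associated with a smooth complete fan in the lattice $N=\mathbb{Z}^2$ (a finite fan whose cones cover $N\otimes\mathbb{R}$ and whose maximal cones are each generated by a basis of $N$), regarded as a complex manifold. Let $D=D_1+\cdots+D_r$ be the toric boundary, i.e. the reduced divisor which is the sum of all torus invariant prime divisors $D_1,\dots,D_r$ of $X$. Let $\Theta$ be the sheaf of germs of holomorphic vector fields on $X$, and let $\Theta(-\log D)\subset\Theta$ be the subsheaf of germs of holomorphic vector fields with logarithmic zeros along $D$, i.e. of those that map the ideal sheaf of $D$ into itself. Then $$H^2(X,\Theta(-\log D))=0 \qquad\text{and}\qquad H^2(X,\Theta)=0 ,$$ where $H^2$ denotes sheaf cohomology in the classical topology. In other words, the space $H^2(X,\Theta)$ in which the obstructions to deformations of $X$ lie is zero. -/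

import Mathlib

open scoped Manifold ContDiff Topology
open CategoryTheory TopologicalSpace Opposite

noncomputable section

/-! ## Subsheaves of abelian groups of a sheaf of dependent functions -/

/-- The sheaf of abelian groups of all dependent functions `(x : U) → T x` which satisfy a local
predicate that cuts out a subgroup over every open set. -/
def subgroupSheaf {X : TopCat.{0}} {T : X → Type} [∀ x, AddCommGroup (T x)]
    (P : TopCat.LocalPredicate T)
    (hzero : ∀ U : Opens X, P.pred (fun x : U => (0 : T x)))
    (hadd : ∀ (U : Opens X) (f g : (x : U) → T x), P.pred f → P.pred g →
      P.pred (fun x => f x + g x))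
    (hneg : ∀ (U : Opens X) (f : (x : U) → T x), P.pred f → P.pred (fun x => -f x)) :
    TopCat.Sheaf AddCommGrpCat.{0} X where
  obj :=
    { obj := fun U => AddCommGrpCat.of
        ({ carrier := {f | P.pred f}
           zero_mem' := hzero U.unop
           add_mem' := fun {f g} hf hg => hadd U.unop f g hf hg
           neg_mem' := fun {f} hf => hneg U.unop f hf } : AddSubgroup ((x : U.unop) → T x))
      map := fun i => AddCommGrpCat.ofHom
        { toFun := fun f => ⟨fun x => f.1 (i.unop x), P.res i.unop f.1 f.2⟩
          map_zero' := rfl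
          map_add' := fun _ _ => rfl } }
  property := by
    refine (TopCat.Presheaf.isSheaf_iff_isSheaf_comp (forget AddCommGrpCat) _).mpr ?_
    exact TopCat.subpresheafToTypes.isSheaf P

/-! ## Holomorphic vector fields on complex manifolds -/

section VectorFields

variable {E : Type} [NormedAddCommGroup E] [NormedSpace ℂ E]
  {M : Type} [TopologicalSpace M] [ChartedSpace E M] [IsManifold 𝓘(ℂ, E) ω M]

/-- A vector field `V` on an open subset `U` of a complex manifold `M` is holomorphic if it is
holomorphic as a map from `U` to the tangent bundle. -/
def IsHolomorphicVectorField {U : Opens M} (V : (x : U) → TangentSpace 𝓘(ℂ, E) (x : M)) : Prop :=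
  ContMDiff 𝓘(ℂ, E) 𝓘(ℂ, E).tangent ω
    (fun x : U => (⟨(x : M), V x⟩ : TangentBundle 𝓘(ℂ, E) M))

/-- A vector field `V` on `U` is tangent to the reduced closed analytic subset `D` if it maps the
ideal sheaf of `D` to itself: for every open `W ⊆ U` and every holomorphic function `f` on `W`
which vanishes on `D`, the derivative of `f` along `V` vanishes on `D`. -/
def PreservesIdeal (D : Set M) {U : Opens M}
    (V : (x : U) → TangentSpace 𝓘(ℂ, E) (x : M)) : Prop :=
  ∀ W : Opens M, W ≤ U → ∀ f : M → ℂ, ContMDiffOn 𝓘(ℂ, E) 𝓘(ℂ, ℂ) ω f W →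
    (∀ x ∈ W, x ∈ D → f x = 0) →
    ∀ x : U, (x : M) ∈ W → (x : M) ∈ D → mfderiv 𝓘(ℂ, E) 𝓘(ℂ, ℂ) f (x : M) (V x) = 0

theorem isHolomorphicVectorField_iff {U : Opens M}
    (V : (x : U) → TangentSpace 𝓘(ℂ, E) (x : M)) :
    IsHolomorphicVectorField V ↔ ∀ x₀ : U, ContMDiffAt 𝓘(ℂ, E) 𝓘(ℂ, E) ω
      (fun x : U => (trivializationAt E (TangentSpace 𝓘(ℂ, E)) (x₀ : M)
        ⟨(x : M), V x⟩).2) x₀ := by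
  refine forall_congr' fun x₀ => ?_
  rw [Bundle.contMDiffAt_totalSpace]
  exact and_iff_right (contMDiff_subtype_val x₀)

theorem IsHolomorphicVectorField.zero (U : Opens M) :
    IsHolomorphicVectorField (fun x : U => (0 : TangentSpace 𝓘(ℂ, E) (x : M))) := by
  rw [isHolomorphicVectorField_iff]
  intro x₀
  set e := trivializationAt E (TangentSpace 𝓘(ℂ, E)) (x₀ : M)
  have h : ∀ᶠ x : U in 𝓝 x₀, (x : M) ∈ e.baseSet :=
    continuous_subtype_val.continuousAt.eventually
      (e.open_baseSet.mem_nhds (FiberBundle.mem_baseSet_trivializationAt' _))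
  refine (contMDiffAt_const (c := (0 : E))).congr_of_eventuallyEq ?_
  filter_upwards [h] with x hx
  exact (e.linear ℂ hx).map_zero

theorem IsHolomorphicVectorField.add (U : Opens M)
    (V V' : (x : U) → TangentSpace 𝓘(ℂ, E) (x : M))
    (hV : IsHolomorphicVectorField V) (hV' : IsHolomorphicVectorField V') :
    IsHolomorphicVectorField (fun x => V x + V' x) := by
  rw [isHolomorphicVectorField_iff] at *
  intro x₀
  set e := trivializationAt E (TangentSpace 𝓘(ℂ, E)) (x₀ : M)
  have h : ∀ᶠ x : U in 𝓝 x₀, (x : M) ∈ e.baseSet :=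
    continuous_subtype_val.continuousAt.eventually
      (e.open_baseSet.mem_nhds (FiberBundle.mem_baseSet_trivializationAt' _))
  refine ((hV x₀).add (hV' x₀)).congr_of_eventuallyEq ?_
  filter_upwards [h] with x hx
  exact (e.linear ℂ hx).map_add _ _

theorem IsHolomorphicVectorField.neg (U : Opens M)
    (V : (x : U) → TangentSpace 𝓘(ℂ, E) (x : M)) (hV : IsHolomorphicVectorField V) :
    IsHolomorphicVectorField (fun x => -V x) := by
  rw [isHolomorphicVectorField_iff] at *
  intro x₀
  set e := trivializationAt E (TangentSpace 𝓘(ℂ, E)) (x₀ : M)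
  have h : ∀ᶠ x : U in 𝓝 x₀, (x : M) ∈ e.baseSet :=
    continuous_subtype_val.continuousAt.eventually
      (e.open_baseSet.mem_nhds (FiberBundle.mem_baseSet_trivializationAt' _))
  refine ((hV x₀).neg).congr_of_eventuallyEq ?_
  filter_upwards [h] with x hx
  exact (e.linear ℂ hx).map_neg _

variable (E M)

/-- Being a holomorphic vector field, as a local predicate. -/
def holomorphicPredicate :
    TopCat.LocalPredicate (X := TopCat.of M) (fun x => TangentSpace 𝓘(ℂ, E) (x : M)) where
  pred {U} V := IsHolomorphicVectorField (E := E) (M := M) (U := U) V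
  res {_ _} i V hV :=
    ((contDiffWithinAt_localInvariantProp (I := 𝓘(ℂ, E)) (I' := 𝓘(ℂ, E).tangent)
      ω).localPredicate M (TangentBundle 𝓘(ℂ, E) M)).res i (fun x => ⟨x.1, V x⟩) hV
  locality {_} V hV :=
    ((contDiffWithinAt_localInvariantProp (I := 𝓘(ℂ, E)) (I' := 𝓘(ℂ, E).tangent)
      ω).localPredicate M (TangentBundle 𝓘(ℂ, E) M)).locality (fun x => ⟨x.1, V x⟩) hV

/-- Being a holomorphic vector field that preserves the ideal of `D`, as a local predicate. -/
def logPredicate (D : Set M) :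
    TopCat.LocalPredicate (X := TopCat.of M) (fun x => TangentSpace 𝓘(ℂ, E) (x : M)) where
  pred {U} V := IsHolomorphicVectorField (E := E) (M := M) (U := U) V ∧
    PreservesIdeal (E := E) (M := M) (U := U) D V
  res {_ _} i V hV := ⟨(holomorphicPredicate E M).res i V hV.1,
    fun W hW f hf h0 x hx hD => hV.2 W (hW.trans i.le) f hf h0 ⟨x.1, i.le x.2⟩ hx hD⟩
  locality {U} V hV := by
    refine ⟨(holomorphicPredicate E M).locality V fun x => ?_, ?_⟩
    · obtain ⟨U', hx, i, h⟩ := hV x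
      exact ⟨U', hx, i, h.1⟩
    · intro W hW f hf h0 x hx hD
      obtain ⟨U', hx', i, h⟩ := hV x
      exact h.2 (W ⊓ U') inf_le_right f (hf.mono inf_le_left) (fun y hy => h0 y hy.1)
        ⟨x.1, hx'⟩ ⟨hx, hx'⟩ hD

/-- The sheaf `Θ` of germs of holomorphic vector fields on the complex manifold `M`. -/
def vectorFieldSheaf : TopCat.Sheaf AddCommGrpCat.{0} (TopCat.of M) :=
  subgroupSheaf (X := TopCat.of M) (T := fun x => TangentSpace 𝓘(ℂ, E) (x : M))
    (holomorphicPredicate E M)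
    (fun U => IsHolomorphicVectorField.zero (E := E) (M := M) U)
    (fun U V V' => IsHolomorphicVectorField.add (E := E) (M := M) U V V')
    (fun U V => IsHolomorphicVectorField.neg (E := E) (M := M) U V)

/-- The sheaf `Θ(-log D)` of germs of holomorphic vector fields with logarithmic zeros along the
reduced divisor `D`: the vector fields that map the ideal sheaf of `D` to itself. -/
def logVectorFieldSheaf (D : Set M) : TopCat.Sheaf AddCommGrpCat.{0} (TopCat.of M) :=
  subgroupSheaf (X := TopCat.of M) (T := fun x => TangentSpace 𝓘(ℂ, E) (x : M))
    (logPredicate E M D)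
    (fun U => ⟨IsHolomorphicVectorField.zero (E := E) (M := M) U,
      fun _ _ _ _ _ _ _ _ => map_zero _⟩)
    (fun U V V' hV hV' => ⟨IsHolomorphicVectorField.add (E := E) (M := M) U V V' hV.1 hV'.1,
      fun W hW f hf h0 x hx hD => by
        rw [map_add, hV.2 W hW f hf h0 x hx hD, hV'.2 W hW f hf h0 x hx hD, add_zero]⟩)
    (fun U V hV => ⟨IsHolomorphicVectorField.neg (E := E) (M := M) U V hV.1,
      fun W hW f hf h0 x hx hD => by
        rw [map_neg, hV.2 W hW f hf h0 x hx hD, neg_zero]⟩)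

end VectorFields

/-! ## Smooth complete fans in `ℤ²` -/

/-- The determinant of a pair of vectors of the lattice `N = ℤ²`. -/
def latticeDet (u v : ℤ × ℤ) : ℤ := u.1 * v.2 - u.2 * v.1

/-- The cone in `N ⊗ ℝ = ℝ²` spanned by a set of lattice vectors. -/
def latticeCone (S : Set (ℤ × ℤ)) : PointedCone ℝ (ℝ × ℝ) :=
  PointedCone.hull ℝ ((fun u : ℤ × ℤ => ((u.1 : ℝ), (u.2 : ℝ))) '' S)

/-- A smooth complete fan in the lattice `N = ℤ²`, given by its finite set of maximal cones. All of
them are two-dimensional, and each is recorded as the pair of its primitive generators, which form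
a basis of `N`, listed in counterclockwise order. Any two cones meet in their common face, and the
cones cover `N ⊗ ℝ`. -/
structure SmoothCompleteFan where
  /-- the maximal cones -/
  cones : Finset ((ℤ × ℤ) × (ℤ × ℤ))
  det_eq_one : ∀ c ∈ cones, latticeDet c.1 c.2 = 1
  inter_eq : ∀ c ∈ cones, ∀ c' ∈ cones,
    (latticeCone {c.1, c.2} : Set (ℝ × ℝ)) ∩ latticeCone {c'.1, c'.2} =
      latticeCone ({c.1, c.2} ∩ {c'.1, c'.2})
  complete : ∀ p : ℝ × ℝ, ∃ c ∈ cones, p ∈ latticeCone {c.1, c.2}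

namespace SmoothCompleteFan

variable (F : SmoothCompleteFan)

/-- The primitive generators of the one-dimensional cones. -/
def rays : Finset (ℤ × ℤ) := F.cones.image Prod.fst ∪ F.cones.image Prod.snd

/-! ## The toric surface of a fan -/

/-- The set of the vectors of homogeneous coordinates of points of the toric surface: the
coordinates that vanish belong to generators of a common cone of the fan. -/
def HomogCoord : Type :=
  {x : F.rays → ℂ // ∃ c ∈ F.cones, ∀ u : F.rays, x u = 0 → u.1 = c.1 ∨ u.1 = c.2}

instance : TopologicalSpace F.HomogCoord :=
  inferInstanceAs (TopologicalSpace {x : F.rays → ℂ //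
    ∃ c ∈ F.cones, ∀ u : F.rays, x u = 0 → u.1 = c.1 ∨ u.1 = c.2})

theorem continuous_coord (u : F.rays) : Continuous fun x : F.HomogCoord => x.1 u :=
  (continuous_apply u).comp continuous_subtype_val

/-- The group by which the homogeneous coordinates are divided: the tuples `t` in `(ℂˣ)^rays` with
`∏ u, t u ^ ⟨m, u⟩ = 1` for every `m` in the dual lattice of `N`. -/
def coordGroup : Subgroup (F.rays → ℂˣ) where
  carrier := {t | ∀ m : ℤ × ℤ, ∏ u : F.rays, t u ^ (m.1 * u.1.1 + m.2 * u.1.2) = 1}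
  one_mem' := by simp
  mul_mem' := by
    intro s t hs ht m
    simp only [Pi.mul_apply, mul_zpow, Finset.prod_mul_distrib, hs m, ht m, mul_one]
  inv_mem' := by
    intro t ht m
    simp only [Pi.inv_apply, inv_zpow, Finset.prod_inv_distrib, ht m, inv_one]

/-- The action by coordinatewise multiplication. -/
instance : MulAction F.coordGroup F.HomogCoord where
  smul t x := ⟨fun u => (t.1 u : ℂ) * x.1 u, by
    obtain ⟨c, hc, h⟩ := x.2
    exact ⟨c, hc, fun u hu => h u (by simpa using hu)⟩⟩
  one_smul x := Subtype.ext (funext fun u => by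
    change ((1 : ℂˣ) : ℂ) * x.1 u = x.1 u
    simp)
  mul_smul s t x := Subtype.ext (funext fun u => by
    change ((s.1 u * t.1 u : ℂˣ) : ℂ) * x.1 u = (s.1 u : ℂ) * ((t.1 u : ℂ) * x.1 u)
    push_cast
    ring)

theorem smul_val (t : F.coordGroup) (x : F.HomogCoord) (u : F.rays) :
    (t • x).1 u = (t.1 u : ℂ) * x.1 u := rfl

instance : ContinuousConstSMul F.coordGroup F.HomogCoord where
  continuous_const_smul t := by
    have h : Continuous fun (x : F.HomogCoord) (u : F.rays) => (t.1 u : ℂ) * x.1 u :=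
      continuous_pi fun u => continuous_const.mul (F.continuous_coord u)
    exact Continuous.subtype_mk h _

/-- The smooth compact toric surface of the fan `F`, with its classical topology, as the quotient
of the space of homogeneous coordinates. -/
def ToricSurface : Type := MulAction.orbitRel.Quotient F.coordGroup F.HomogCoord

instance : TopologicalSpace F.ToricSurface :=
  inferInstanceAs (TopologicalSpace (MulAction.orbitRel.Quotient F.coordGroup F.HomogCoord))

variable {F} in
/-- The point with given homogeneous coordinates. -/
def HomogCoord.toPoint (x : F.HomogCoord) : F.ToricSurface :=
  Quotient.mk (MulAction.orbitRel F.coordGroup F.HomogCoord) x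

/-- The torus invariant prime divisor `D_u` of a ray of the fan. -/
def rayDivisor (u : F.rays) : Set F.ToricSurface :=
  {p | ∃ x : F.HomogCoord, x.toPoint = p ∧ x.1 u = 0}

/-- The toric boundary `D`: the sum (as a reduced divisor) of all torus invariant prime divisors. -/
def toricBoundary : Set F.ToricSurface := ⋃ u : F.rays, F.rayDivisor u

theorem continuous_toPoint : Continuous (HomogCoord.toPoint (F := F)) := continuous_quot_mk

theorem isOpenMap_toPoint : IsOpenMap (HomogCoord.toPoint (F := F)) :=
  isOpenMap_quotient_mk'_mul (Γ := F.coordGroup) (T := F.HomogCoord)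

theorem toPoint_eq_iff (x y : F.HomogCoord) :
    x.toPoint = y.toPoint ↔ ∃ t : F.coordGroup, t • y = x :=
  Quotient.eq (r := MulAction.orbitRel F.coordGroup F.HomogCoord)

/-! ### The affine charts

For a cone with generators `v`, `w` the dual basis consists of `u ↦ det (u, w)` and
`u ↦ det (v, u)`, so the two monomials below are the coordinates on the affine chart `ℂ²`. -/

theorem mem_rays_left {c : (ℤ × ℤ) × (ℤ × ℤ)} (hc : c ∈ F.cones) : c.1 ∈ F.rays :=
  Finset.mem_union_left _ (Finset.mem_image_of_mem _ hc)

theorem mem_rays_right {c : (ℤ × ℤ) × (ℤ × ℤ)} (hc : c ∈ F.cones) : c.2 ∈ F.rays :=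
  Finset.mem_union_right _ (Finset.mem_image_of_mem _ hc)

/-- The toric coordinates `(∏ u, x u ^ det (u, w), ∏ u, x u ^ det (v, u))` of the cone spanned by
`v` and `w`. -/
def monomials (c : (ℤ × ℤ) × (ℤ × ℤ)) (x : F.rays → ℂ) : ℂ × ℂ :=
  (∏ u : F.rays, x u ^ latticeDet u.1 c.2, ∏ u : F.rays, x u ^ latticeDet c.1 u.1)

/-- The vector with entries `a` and `b` at the generators of a cone and `1` elsewhere. -/
def coordVec (c : (ℤ × ℤ) × (ℤ × ℤ)) (z : ℂ × ℂ) (u : F.rays) : ℂ :=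
  if u.1 = c.1 then z.1 else if u.1 = c.2 then z.2 else 1

theorem monomials_smul (c : (ℤ × ℤ) × (ℤ × ℤ)) (t : F.coordGroup) (x : F.HomogCoord) :
    F.monomials c (t • x).1 = F.monomials c x.1 := by
  have key : ∀ k : (ℤ × ℤ) → ℤ, (∃ m : ℤ × ℤ, ∀ u, k u = m.1 * u.1 + m.2 * u.2) →
      ∏ u : F.rays, (t • x).1 u ^ k u.1 = ∏ u : F.rays, x.1 u ^ k u.1 := by
    rintro k ⟨m, hm⟩
    have h := congrArg (Units.val) (t.2 m)
    simp only [smul_val, mul_zpow, Finset.prod_mul_distrib, hm]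
    rw [Units.coe_prod] at h
    simp only [Units.val_zpow_eq_zpow_val, Units.val_one] at h
    rw [h, one_mul]
  refine Prod.ext (key (fun u => latticeDet u c.2) ⟨(c.2.2, -c.2.1), fun u => ?_⟩)
    (key (fun u => latticeDet c.1 u) ⟨(-c.1.2, c.1.1), fun u => ?_⟩) <;>
  · simp only [latticeDet]
    ring

variable {F}

theorem latticeDet_self (u : ℤ × ℤ) : latticeDet u u = 0 := by
  simp only [latticeDet]
  ring

theorem fst_ne_snd {c : (ℤ × ℤ) × (ℤ × ℤ)} (hc : c ∈ F.cones) : c.2 ≠ c.1 := by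
  intro h
  have h1 := F.det_eq_one c hc
  rw [h, latticeDet_self] at h1
  exact zero_ne_one h1

theorem coordVec_fst {c : (ℤ × ℤ) × (ℤ × ℤ)} (hc : c ∈ F.cones) (z : ℂ × ℂ) :
    F.coordVec c z ⟨c.1, F.mem_rays_left hc⟩ = z.1 := if_pos rfl

theorem coordVec_snd {c : (ℤ × ℤ) × (ℤ × ℤ)} (hc : c ∈ F.cones) (z : ℂ × ℂ) :
    F.coordVec c z ⟨c.2, F.mem_rays_right hc⟩ = z.2 :=
  (if_neg (fst_ne_snd hc)).trans (if_pos rfl)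

theorem coordVec_other {c : (ℤ × ℤ) × (ℤ × ℤ)} (z : ℂ × ℂ) {u : F.rays}
    (h1 : u.1 ≠ c.1) (h2 : u.1 ≠ c.2) : F.coordVec c z u = 1 :=
  (if_neg h1).trans (if_neg h2)

theorem monomials_coordVec {c : (ℤ × ℤ) × (ℤ × ℤ)} (hc : c ∈ F.cones) (z : ℂ × ℂ) :
    F.monomials c (F.coordVec c z) = z := by
  have h1 := F.det_eq_one c hc
  refine Prod.ext ?_ ?_
  · change ∏ u : F.rays, _ = _
    rw [Finset.prod_eq_single (⟨c.1, F.mem_rays_left hc⟩ : F.rays)]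
    · simp [coordVec_fst hc, h1]
    · intro u _ hu
      by_cases h2 : u.1 = c.2
      · rw [h2, latticeDet_self, zpow_zero]
      · rw [coordVec_other z (fun h => hu (Subtype.ext h)) h2, one_zpow]
    · simp
  · change ∏ u : F.rays, _ = _
    rw [Finset.prod_eq_single (⟨c.2, F.mem_rays_right hc⟩ : F.rays)]
    · simp [coordVec_snd hc, h1]
    · intro u _ hu
      by_cases h2 : u.1 = c.1
      · rw [h2, latticeDet_self, zpow_zero]
      · rw [coordVec_other z h2 (fun h => hu (Subtype.ext h)), one_zpow]
    · simp

/-- The homogeneous coordinates of the point of an affine chart with coordinates `z`. -/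
def chartCoord {c : (ℤ × ℤ) × (ℤ × ℤ)} (hc : c ∈ F.cones) (z : ℂ × ℂ) : F.HomogCoord :=
  ⟨F.coordVec c z, c, hc, fun u hu => by
    by_contra! h
    rw [coordVec_other z h.1 h.2] at hu
    exact one_ne_zero hu⟩

theorem toPoint_chartCoord_monomials {c : (ℤ × ℤ) × (ℤ × ℤ)} (hc : c ∈ F.cones)
    (x : F.HomogCoord) (hx : ∀ u : F.rays, u.1 ≠ c.1 → u.1 ≠ c.2 → x.1 u ≠ 0) :
    (chartCoord hc (F.monomials c x.1)).toPoint = x.toPoint := by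
  classical
  set v : F.rays := ⟨c.1, F.mem_rays_left hc⟩
  set w : F.rays := ⟨c.2, F.mem_rays_right hc⟩
  have hwv : w ≠ v := fun h => fst_ne_snd hc (congrArg Subtype.val h)
  have hdet := F.det_eq_one c hc
  have hx' : ∀ u : F.rays, u ≠ v → u ≠ w → x.1 u ≠ 0 := fun u h1 h2 =>
    hx u (fun h => h1 (Subtype.ext h)) (fun h => h2 (Subtype.ext h))
  let y : F.rays → ℂˣ := fun u =>
    if h : u ≠ v ∧ u ≠ w then Units.mk0 (x.1 u) (hx' u h.1 h.2) else 1
  have hyx : x.1 = fun u => (y u : ℂ) * F.coordVec c (x.1 v, x.1 w) u := by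
    funext u
    by_cases h1 : u = v
    · subst h1
      rw [coordVec_fst hc]
      simp [y]
    by_cases h2 : u = w
    · subst h2
      rw [coordVec_snd hc]
      simp [y]
    rw [coordVec_other _ (fun h => h1 (Subtype.ext h)) (fun h => h2 (Subtype.ext h))]
    simp [y, h1, h2]
  let P : ℂˣ := ∏ u : F.rays, y u ^ latticeDet u.1 c.2
  let Q : ℂˣ := ∏ u : F.rays, y u ^ latticeDet c.1 u.1
  have hmon : F.monomials c x.1 = ((P : ℂ) * x.1 v, (Q : ℂ) * x.1 w) := by
    have h := monomials_coordVec hc (x.1 v, x.1 w)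
    conv_lhs => rw [hyx]
    simp only [monomials, mul_zpow, Finset.prod_mul_distrib]
    refine Prod.ext ?_ ?_
    · have h' := congrArg Prod.fst h
      simp only [monomials] at h'
      rw [h']
      simp [P, Units.coe_prod]
    · have h' := congrArg Prod.snd h
      simp only [monomials] at h'
      rw [h']
      simp [Q, Units.coe_prod]
  let s : F.rays → ℂˣ := fun u => (if u = v then P else if u = w then Q else 1) * (y u)⁻¹
  have hs : s ∈ F.coordGroup := by
    intro m
    simp only [s, mul_zpow, Finset.prod_mul_distrib]
    have hA : ∏ u : F.rays, (if u = v then P else if u = w then Q else 1) ^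
        (m.1 * u.1.1 + m.2 * u.1.2) =
        P ^ (m.1 * c.1.1 + m.2 * c.1.2) * Q ^ (m.1 * c.2.1 + m.2 * c.2.2) := by
      rw [Finset.prod_eq_mul v w hwv.symm]
      · simp [hwv, v, w]
      · rintro u _ ⟨h1, h2⟩
        simp [h1, h2]
      · simp
      · simp
    rw [hA, ← Finset.prod_zpow, ← Finset.prod_zpow, ← Finset.prod_mul_distrib,
      ← Finset.prod_mul_distrib]
    refine Finset.prod_eq_one fun u _ => ?_
    rw [← zpow_mul, ← zpow_mul, inv_zpow', ← zpow_add, ← zpow_add]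
    rw [show latticeDet u.1 c.2 * (m.1 * c.1.1 + m.2 * c.1.2) +
        latticeDet c.1 u.1 * (m.1 * c.2.1 + m.2 * c.2.2) + -(m.1 * u.1.1 + m.2 * u.1.2) =
        (latticeDet c.1 c.2 - 1) * (m.1 * u.1.1 + m.2 * u.1.2) by
      simp only [latticeDet]
      ring, hdet]
    simp
  rw [toPoint_eq_iff]
  refine ⟨⟨s, hs⟩, Subtype.ext (funext fun u => ?_)⟩
  rw [smul_val]
  change _ = F.coordVec c (F.monomials c x.1) u
  rw [hmon]
  by_cases h1 : u = v
  · subst h1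
    rw [coordVec_fst hc]
    simp [s, y]
  by_cases h2 : u = w
  · subst h2
    rw [coordVec_snd hc]
    simp [s, y, hwv]
  rw [coordVec_other _ (fun h => h1 (Subtype.ext h)) (fun h => h2 (Subtype.ext h))]
  simp [s, y, h1, h2, hx' u h1 h2]

variable (F)

/-- The homogeneous coordinates of the points of an affine chart. -/
def chartDomain (c : (ℤ × ℤ) × (ℤ × ℤ)) : Set F.HomogCoord :=
  {x | ∀ u : F.rays, u.1 ≠ c.1 → u.1 ≠ c.2 → x.1 u ≠ 0}

theorem isOpen_chartDomain (c : (ℤ × ℤ) × (ℤ × ℤ)) : IsOpen (F.chartDomain c) := by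
  simp only [chartDomain, Set.ofPred_forall]
  refine isOpen_iInter_of_finite fun u => isOpen_iInter_of_finite fun _ =>
    isOpen_iInter_of_finite fun _ => ?_
  exact isOpen_ne_fun (F.continuous_coord u) continuous_const

theorem toPoint_mem_image_chartDomain (c : (ℤ × ℤ) × (ℤ × ℤ)) (x : F.HomogCoord) :
    x.toPoint ∈ HomogCoord.toPoint '' F.chartDomain c ↔ x ∈ F.chartDomain c := by
  refine ⟨?_, fun h => ⟨x, h, rfl⟩⟩
  rintro ⟨y, hy, h⟩ u h1 h2
  obtain ⟨t, rfl⟩ := (F.toPoint_eq_iff y x).mp h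
  exact right_ne_zero_of_mul (hy u h1 h2)

/-- The toric coordinates of a cone as a function on the toric surface. -/
def chartFun (c : (ℤ × ℤ) × (ℤ × ℤ)) (p : F.ToricSurface) : ℂ × ℂ :=
  Quotient.lift (s := MulAction.orbitRel F.coordGroup F.HomogCoord) (fun x => F.monomials c x.1)
    (by
      rintro x y ⟨t, rfl⟩
      exact F.monomials_smul c t y) p

theorem chartFun_toPoint (c : (ℤ × ℤ) × (ℤ × ℤ)) (x : F.HomogCoord) :
    F.chartFun c x.toPoint = F.monomials c x.1 := rfl

variable {F}

/-- On the generators of the cone itself the exponents of its toric coordinates are nonnegative. -/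
theorem latticeDet_nonneg {c : (ℤ × ℤ) × (ℤ × ℤ)} (hc : c ∈ F.cones) (u : ℤ × ℤ)
    (hu : u = c.1 ∨ u = c.2) : 0 ≤ latticeDet u c.2 ∧ 0 ≤ latticeDet c.1 u := by
  have h := F.det_eq_one c hc
  rcases hu with rfl | rfl
  · simp [h, latticeDet_self]
  · simp [h, latticeDet_self]

theorem continuousOn_monomials {c : (ℤ × ℤ) × (ℤ × ℤ)} (hc : c ∈ F.cones) :
    ContinuousOn (fun x : F.HomogCoord => F.monomials c x.1) (F.chartDomain c) := by
  have key : ∀ x ∈ F.chartDomain c, ∀ u : F.rays,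
      x.1 u ≠ 0 ∨ (0 ≤ latticeDet u.1 c.2 ∧ 0 ≤ latticeDet c.1 u.1) := by
    intro x hx u
    by_cases h1 : u.1 = c.1
    · exact Or.inr (latticeDet_nonneg hc _ (Or.inl h1))
    by_cases h2 : u.1 = c.2
    · exact Or.inr (latticeDet_nonneg hc _ (Or.inr h2))
    exact Or.inl (hx u h1 h2)
  intro x hx
  refine ContinuousAt.continuousWithinAt (ContinuousAt.prodMk ?_ ?_)
  · exact tendsto_finsetProd _ fun u _ =>
      ((F.continuous_coord u).continuousAt).zpow₀ _ ((key x hx u).imp_right And.left)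
  · exact tendsto_finsetProd _ fun u _ =>
      ((F.continuous_coord u).continuousAt).zpow₀ _ ((key x hx u).imp_right And.right)

theorem continuous_chartCoord {c : (ℤ × ℤ) × (ℤ × ℤ)} (hc : c ∈ F.cones) :
    Continuous (chartCoord hc) := by
  refine Continuous.subtype_mk (continuous_pi fun u => ?_) _
  simp only [coordVec]
  split_ifs
  · exact continuous_fst
  · exact continuous_snd
  · exact continuous_const

theorem chartCoord_mem_chartDomain {c : (ℤ × ℤ) × (ℤ × ℤ)} (hc : c ∈ F.cones) (z : ℂ × ℂ) :
    chartCoord hc z ∈ F.chartDomain c := by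
  intro u h1 h2
  change F.coordVec c z u ≠ 0
  rw [coordVec_other z h1 h2]
  exact one_ne_zero

/-- The affine chart `ℂ²` of a maximal cone. -/
def affineChart {c : (ℤ × ℤ) × (ℤ × ℤ)} (hc : c ∈ F.cones) :
    OpenPartialHomeomorph F.ToricSurface (ℂ × ℂ) where
  toFun := F.chartFun c
  invFun z := (chartCoord hc z).toPoint
  source := HomogCoord.toPoint '' F.chartDomain c
  target := Set.univ
  map_source' _ _ := Set.mem_univ _
  map_target' z _ := ⟨_, chartCoord_mem_chartDomain hc z, rfl⟩
  left_inv' := by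
    rintro _ ⟨x, hx, rfl⟩
    exact toPoint_chartCoord_monomials hc x hx
  right_inv' z _ := monomials_coordVec hc z
  open_source := F.isOpenMap_toPoint _ (F.isOpen_chartDomain c)
  open_target := isOpen_univ
  continuousOn_toFun := by
    refine (continuousOn_open_iff (F.isOpenMap_toPoint _ (F.isOpen_chartDomain c))).mpr
      fun O hO => ?_
    have h := F.isOpenMap_toPoint _
      ((continuousOn_monomials hc).isOpen_inter_preimage (F.isOpen_chartDomain c) hO)
    convert h using 1
    ext p
    constructor
    · rintro ⟨⟨x, hx, rfl⟩, hO⟩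
      exact ⟨x, ⟨hx, hO⟩, rfl⟩
    · rintro ⟨x, ⟨hx, hO⟩, rfl⟩
      exact ⟨⟨x, hx, rfl⟩, hO⟩
  continuousOn_invFun := (F.continuous_toPoint.comp (continuous_chartCoord hc)).continuousOn

theorem exists_mem_affineChart_source (p : F.ToricSurface) :
    ∃ c : F.cones, p ∈ (affineChart c.2).source := by
  obtain ⟨x, rfl⟩ := Quotient.exists_rep p
  obtain ⟨c, hc, h⟩ := x.2
  exact ⟨⟨c, hc⟩, x, fun u h1 h2 h0 => (h u h0).elim h1 h2, rfl⟩

/-- The complex structure of the toric surface: the atlas of the affine charts of all maximal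
cones. -/
instance : ChartedSpace (ℂ × ℂ) F.ToricSurface where
  atlas := Set.range fun c : F.cones => affineChart c.2
  chartAt p := affineChart (exists_mem_affineChart_source p).choose.2
  mem_chart_source p := (exists_mem_affineChart_source p).choose_spec
  chart_mem_atlas _ := Set.mem_range_self _

theorem contDiff_coordVec (c : (ℤ × ℤ) × (ℤ × ℤ)) (u : F.rays) :
    ContDiff ℂ ω (fun z => F.coordVec c z u) := by
  simp only [coordVec]
  split_ifs
  · exact contDiff_fst
  · exact contDiff_snd
  · exact contDiff_const

theorem contDiffAt_zpow (k : ℤ) (a : ℂ) (h : a ≠ 0 ∨ 0 ≤ k) :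
    ContDiffAt ℂ ω (fun z : ℂ => z ^ k) a := by
  by_cases hk : 0 ≤ k
  · lift k to ℕ using hk
    simp only [zpow_natCast]
    exact contDiffAt_id.pow k
  · obtain ⟨n, rfl⟩ : ∃ n : ℕ, k = -n := ⟨(-k).toNat, by omega⟩
    simp only [zpow_neg, zpow_natCast]
    exact (contDiffAt_id.pow n).inv (pow_ne_zero _ (h.resolve_right hk))

instance : IsManifold 𝓘(ℂ, ℂ × ℂ) ω F.ToricSurface := by
  refine isManifold_of_contDiffOn _ _ _ ?_
  rintro _ _ ⟨⟨c, hc⟩, rfl⟩ ⟨⟨c', hc'⟩, rfl⟩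
  intro z hz
  have hz' : chartCoord hc z ∈ F.chartDomain c' :=
    (F.toPoint_mem_image_chartDomain c' _).mp hz.1.2
  have key : ∀ u : F.rays, F.coordVec c z u ≠ 0 ∨
      (0 ≤ latticeDet u.1 c'.2 ∧ 0 ≤ latticeDet c'.1 u.1) := by
    intro u
    by_cases h1 : u.1 = c'.1
    · exact Or.inr (latticeDet_nonneg hc' _ (Or.inl h1))
    by_cases h2 : u.1 = c'.2
    · exact Or.inr (latticeDet_nonneg hc' _ (Or.inr h2))
    exact Or.inl (hz' u h1 h2)
  refine ContDiffAt.contDiffWithinAt ?_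
  change ContDiffAt ℂ ω (fun z => F.monomials c' (F.coordVec c z)) z
  refine ContDiffAt.prodMk ?_ ?_
  · exact contDiffAt_prod fun u _ => ContDiffAt.comp z
      (g := fun a : ℂ => a ^ latticeDet u.1 c'.2) (contDiffAt_zpow _ _ ((key u).imp_right And.left))
      (contDiff_coordVec c u).contDiffAt
  · exact contDiffAt_prod fun u _ => ContDiffAt.comp z
      (g := fun a : ℂ => a ^ latticeDet c'.1 u.1) (contDiffAt_zpow _ _ ((key u).imp_right And.right))
      (contDiff_coordVec c u).contDiffAt

end SmoothCompleteFan
end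

/-! Embed the sheaf `F` into an injective sheaf `I` with cokernel `G`, and `G` into an injective `J`
with cokernel `Q`. Injective sheaves are flasque, so over an open set `U` the cokernel of `I(U) →
G(U)` is `H¹(U, F)` and the cokernel of `J(U) → Q(U)` is `H¹(U, G) = H²(U, F)`. Thus, for the two
sequences `S` and `T`, `S.Acyclic U` and `T.Acyclic U` express vanishing in degrees one and two, and
Mayer–Vietoris arguments become explicit corrections of lifts (`FlasqueSeq.acyclic_sup`,
`FlasqueSeq.acyclic_sup₃`).

Geometry. Let `p` generate a ray and let `σ` be a cone containing `-p`. The line through `p` divides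
the cones other than `σ` into two half-planes `B₁`, `B₂` (`exists_decomposition`). Cover `X` by the
chart of `σ` and by the unions of the charts of `B₁` and of `B₂`. Inside a half-plane the cones can
be removed one after the other, starting from the last in angular order; the removed chart meets the
remaining ones in an open set touching at most one boundary divisor, and `H¹` vanishes there. Hence
`H²` vanishes on all three open sets. Their pairwise intersections also touch at most one divisor,
so `H²(X, F)` is zero as soon as every section over the triple intersection, which lies in the
torus, is a sum of sections over the pairwise ones.

On the torus both sheaves are the free module `N ⊗ 𝒪`, and a holomorphic function with values in `N
⊗ ℂ` gives a logarithmic vector field wherever it is defined. So it suffices to split functions. In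
the coordinates `(z, w)` of `σ`, a Laurent series is a sum of a part regular along `z = 0`, a part
regular along `w = 0`, and a part that is entire in `(z⁻¹, w⁻¹)`. The last extends over `D_p`
because `-p ∈ σ` (`exists_torus_splitting`, `HoloOn.comp_chartFun_inv`).

Analysis. What remains is the vanishing of `H¹` and `H²` for holomorphic functions on products of
copies of `ℂ` and `ℂˣ`. Near compact products it follows from additive splitting of holomorphic
functions with the Cauchy–Pompeiu formula (`exists_analyticOnNhd_add_fst`). The passage to the whole
space uses an exhaustion: approximation by Taylor polynomials on bidiscs, and Laurent splitting for
punctured factors (`mittagLeffler_coordStage`). -/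

/-! ## Presheaves of abelian groups in terms of sections -/

/-- A presheaf of abelian groups on a topological space, in terms of its groups of sections. -/
structure AbSections (Y : Type*) [TopologicalSpace Y] where
  /-- the sections over an open set -/
  sec : Opens Y → Type
  [grp : ∀ U, AddCommGroup (sec U)]
  /-- the restriction maps -/
  res : ∀ {U V : Opens Y}, U ≤ V → sec V →+ sec U
  res_res : ∀ {U V W : Opens Y} (h : U ≤ V) (h' : V ≤ W) (s : sec W),
    res h (res h' s) = res (h.trans h') s
  res_self : ∀ {U : Opens Y} (h : U ≤ U) (s : sec U), res h s = s

attribute [instance] AbSections.grp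

namespace AbSections

variable {Y : Type*} [TopologicalSpace Y]

/-- The sheaf condition. -/
structure IsSheaf (F : AbSections Y) : Prop where
  sep : ∀ {ι : Type} (U : ι → Opens Y) (V : Opens Y) (hU : ∀ i, U i ≤ V), V ≤ iSup U →
    ∀ s t : F.sec V, (∀ i, F.res (hU i) s = F.res (hU i) t) → s = t
  glue : ∀ {ι : Type} (U : ι → Opens Y) (s : ∀ i, F.sec (U i)),
    (∀ i j, F.res (inf_le_left : U i ⊓ U j ≤ U i) (s i) = F.res inf_le_right (s j)) →
    ∃ t : F.sec (iSup U), ∀ i, F.res (le_iSup U i) t = s i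

/-- All restriction maps are surjective. -/
def IsFlasque (F : AbSections Y) : Prop :=
  ∀ {U V : Opens Y} (h : U ≤ V) (s : F.sec U), ∃ t : F.sec V, F.res h t = s

theorem IsSheaf.glue_of_eq {F : AbSections Y} (hF : F.IsSheaf) {ι : Type} (U : ι → Opens Y)
    {V : Opens Y} (hV : V = iSup U) (s : ∀ i, F.sec (U i))
    (h : ∀ i j, F.res (inf_le_left : U i ⊓ U j ≤ U i) (s i) = F.res inf_le_right (s j)) :
    ∃ t : F.sec V, ∀ i, F.res (hV ▸ le_iSup U i) t = s i := by
  subst hV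
  exact hF.glue U s h

theorem IsSheaf.glue₂ {F : AbSections Y} (hF : F.IsSheaf) {U V : Opens Y} (s : F.sec U)
    (t : F.sec V) (h : F.res (inf_le_left : U ⊓ V ≤ U) s = F.res inf_le_right t) :
    ∃ r : F.sec (U ⊔ V), F.res le_sup_left r = s ∧ F.res le_sup_right r = t := by
  have hV : U ⊔ V = iSup fun b : Bool => if b then U else V := by
    rw [iSup_bool_eq]
    simp
  let f : ∀ b : Bool, F.sec (if b then U else V) := fun b => match b with
    | true => s
    | false => t
  obtain ⟨r, hr⟩ := hF.glue_of_eq _ hV f (by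
    rintro (_ | _) (_ | _)
    · rfl
    · have := congrArg (F.res (le_of_eq (inf_comm _ _) : V ⊓ U ≤ U ⊓ V)) h
      rw [F.res_res, F.res_res] at this
      exact this.symm
    · exact h
    · rfl)
  exact ⟨r, hr true, hr false⟩

theorem IsSheaf.sep₂ {F : AbSections Y} (hF : F.IsSheaf) {U V W : Opens Y} (hU : U ≤ W)
    (hV : V ≤ W) (hW : W ≤ U ⊔ V) (s t : F.sec W) (h₁ : F.res hU s = F.res hU t)
    (h₂ : F.res hV s = F.res hV t) : s = t := by
  refine hF.sep (fun b : Bool => if b then U else V) W ?_ ?_ s t ?_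
  · rintro (_ | _)
    · exact hV
    · exact hU
  · rw [iSup_bool_eq]
    simpa using hW
  · rintro (_ | _)
    · exact h₂
    · exact h₁

theorem IsSheaf.eq_of_bot {F : AbSections Y} (hF : F.IsSheaf) (s t : F.sec ⊥) : s = t :=
  hF.sep (fun i : Empty => i.elim) ⊥ (fun i => i.elim) bot_le s t fun i => i.elim

/-- The inverse image of a presheaf of sections under a map that identifies the open sets of one
space with some open sets of another one. -/
def comap {Z : Type*} [TopologicalSpace Z] (F : AbSections Y) (j : Opens Z → Opens Y)
    (hj : ∀ U V, U ≤ V → j U ≤ j V) : AbSections Z where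
  sec U := F.sec (j U)
  res h := F.res (hj _ _ h)
  res_res _ _ _ := F.res_res _ _ _
  res_self _ _ := F.res_self _ _

theorem IsSheaf.comap {Z : Type*} [TopologicalSpace Z] {F : AbSections Y} (hF : F.IsSheaf)
    {j : Opens Z → Opens Y} (hj : ∀ U V, U ≤ V → j U ≤ j V) (hinf : ∀ U V, j U ⊓ j V ≤ j (U ⊓ V))
    (hsup : ∀ {ι : Type} (U : ι → Opens Z), j (iSup U) = ⨆ i, j (U i)) :
    (F.comap j hj).IsSheaf where
  sep U V hU hV s t h := hF.sep (fun i => j (U i)) (j V) (fun i => hj _ _ (hU i))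
    ((hj _ _ hV).trans (hsup U).le) s t h
  glue U s h := by
    refine hF.glue_of_eq (fun i => j (U i)) (hsup U) s fun i k => ?_
    have := congrArg (F.res (hinf (U i) (U k))) (h i k)
    exact (F.res_res _ _ _).symm.trans (this.trans (F.res_res _ _ _))

end AbSections

/-! ## Flasque embeddings and vanishing of cohomology -/

/-- An exact sequence `0 → F → I → G → 0` of sheaves with `I` flasque. -/
structure FlasqueSeq {Y : Type*} [TopologicalSpace Y] (F I G : AbSections Y) where
  /-- the embedding -/
  emb : ∀ U, F.sec U →+ I.sec U
  /-- the projection -/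
  proj : ∀ U, I.sec U →+ G.sec U
  res_emb : ∀ {U V : Opens Y} (h : U ≤ V) (s : F.sec V), I.res h (emb V s) = emb U (F.res h s)
  res_proj : ∀ {U V : Opens Y} (h : U ≤ V) (s : I.sec V), G.res h (proj V s) = proj U (I.res h s)
  emb_injective : ∀ U, Function.Injective (emb U)
  proj_emb : ∀ U s, proj U (emb U s) = 0
  exact : ∀ U s, proj U s = 0 → ∃ t, emb U t = s
  flasque : I.IsFlasque
  sheaf₂ : I.IsSheaf
  sheaf₃ : G.IsSheaf
  -- Surjectivity of a map of sheaves gives only local lifts; the failure of global ones is the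
  -- first cohomology.
  surj : ∀ (U : Opens Y) (g : G.sec U), ∀ x ∈ U, ∃ (V : Opens Y) (h : V ≤ U),
    x ∈ V ∧ ∃ s, proj V s = G.res h g

namespace FlasqueSeq

variable {Y : Type*} [TopologicalSpace Y] {F I G J Q : AbSections Y}

/-- A section of the quotient lifts over a smaller open set. -/
def Lifts (S : FlasqueSeq F I G) {U : Opens Y} (g : G.sec U) (V : Opens Y) : Prop :=
  ∃ (h : V ≤ U) (s : I.sec V), S.proj V s = G.res h g

/-- Every section of the quotient over `U` lifts, in other words, the first cohomology of `U` with
values in `F` vanishes. -/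
def Acyclic (S : FlasqueSeq F I G) (U : Opens Y) : Prop :=
  ∀ g : G.sec U, ∃ s, S.proj U s = g

theorem Lifts.mono {S : FlasqueSeq F I G} {U V W : Opens Y} {g : G.sec U} (h : S.Lifts g V)
    (hW : W ≤ V) : S.Lifts g W := by
  obtain ⟨hV, s, hs⟩ := h
  exact ⟨hW.trans hV, I.res hW s, by rw [← S.res_proj, hs, G.res_res]⟩

theorem lifts_bot (S : FlasqueSeq F I G) {U : Opens Y} (g : G.sec U) : S.Lifts g ⊥ :=
  ⟨bot_le, 0, S.sheaf₃.eq_of_bot _ _⟩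

theorem acyclic_bot (S : FlasqueSeq F I G) : S.Acyclic ⊥ := fun _ => ⟨0, S.sheaf₃.eq_of_bot _ _⟩

theorem Lifts.of_acyclic {S : FlasqueSeq F I G} {U V : Opens Y} {g : G.sec U} (hV : S.Acyclic V)
    (h : V ≤ U) : S.Lifts g V :=
  ⟨h, hV _⟩

/-- Gluing of two lifts whose difference is a difference of sections of the kernel. -/
theorem lifts_sup_of_sub_eq (S : FlasqueSeq F I G) {U V W : Opens Y} {g : G.sec U} (hV : V ≤ U)
    (hW : W ≤ U) {s : I.sec V} {t : I.sec W} (hs : S.proj V s = G.res hV g)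
    (ht : S.proj W t = G.res hW g) (a : F.sec V) (b : F.sec W)
    (h : I.res (inf_le_left : V ⊓ W ≤ V) s - I.res inf_le_right t =
      S.emb _ (F.res inf_le_left a + F.res inf_le_right b)) : S.Lifts g (V ⊔ W) := by
  -- Subtracting `a` from one lift and adding `b` to the other does not change the projections and
  -- makes the lifts agree on the overlap.
  obtain ⟨r, hr₁, hr₂⟩ := S.sheaf₂.glue₂ (s - S.emb V a) (t + S.emb W b) (by
    rw [map_sub, map_add, S.res_emb, S.res_emb]
    rw [map_add, sub_eq_iff_eq_add] at h
    rw [h]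
    abel)
  refine ⟨sup_le hV hW, r, S.sheaf₃.sep₂ le_sup_left le_sup_right le_rfl _ _ ?_ ?_⟩
  · rw [S.res_proj, hr₁, map_sub, S.proj_emb, hs, G.res_res, sub_zero]
  · rw [S.res_proj, hr₂, map_add, S.proj_emb, ht, G.res_res, add_zero]

/-- This is the Čech cocycle of a pair of lifts: both project to `g`, so exactness applies to their
difference. -/
theorem exists_emb_eq_sub (S : FlasqueSeq F I G) {U V W : Opens Y} {g : G.sec U} (hV : V ≤ U)
    (hW : W ≤ U) {s : I.sec V} {t : I.sec W} (hs : S.proj V s = G.res hV g)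
    (ht : S.proj W t = G.res hW g) :
    ∃ f : F.sec (V ⊓ W), S.emb _ f = I.res inf_le_left s - I.res inf_le_right t := by
  refine S.exact _ _ ?_
  rw [map_sub, ← S.res_proj, ← S.res_proj, hs, ht, G.res_res, G.res_res, sub_self]

/-- The Mayer–Vietoris argument in degree two, with shrinking: two lifts over `V` and `W` give a
lift over the union of smaller open sets `V'`, `W'` if the obstruction lifts on `V' ∩ W'`. -/
theorem lifts_sup_of_lifts (S : FlasqueSeq F I G) (T : FlasqueSeq G J Q) {U V W O : Opens Y}
    {z : Q.sec U} (hV : V ≤ U) (hW : W ≤ U) {s : J.sec V} {t : J.sec W}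
    (hs : T.proj V s = Q.res hV z) (ht : T.proj W t = Q.res hW z) {γ : G.sec (V ⊓ W)}
    (hγ : T.emb _ γ = J.res inf_le_left s - J.res inf_le_right t) (hO : S.Lifts γ O)
    {V' W' : Opens Y} (hV' : V' ≤ V) (hW' : W' ≤ W) (h : V' ⊓ W' ≤ O) :
    T.Lifts z (V' ⊔ W') := by
  obtain ⟨hO', x, hx⟩ := hO
  -- Flasqueness extends the lift of `γ` from `V' ⊓ W'` to all of `V`. Its projection can then
  -- correct `s` alone, and `t` is left unchanged.
  obtain ⟨y, hy⟩ := S.flasque (h.trans (hO'.trans inf_le_left)) (I.res h x)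
  refine T.lifts_sup_of_sub_eq (hV'.trans hV) (hW'.trans hW)
    (s := J.res hV' s) (t := J.res hW' t) ?_ ?_
    (S.proj V' (I.res hV' y)) 0 ?_
  · rw [← T.res_proj, hs, Q.res_res]
  · rw [← T.res_proj, ht, Q.res_res]
  · rw [map_zero, add_zero, S.res_proj, I.res_res, hy, ← S.res_proj, hx, G.res_res,
      ← T.res_emb _ γ, hγ, map_sub]
    simp only [J.res_res]

/-- Mayer–Vietoris in degree two. -/
theorem acyclic_sup (S : FlasqueSeq F I G) (T : FlasqueSeq G J Q) {V W : Opens Y}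
    (hV : T.Acyclic V) (hW : T.Acyclic W) (hVW : S.Acyclic (V ⊓ W)) : T.Acyclic (V ⊔ W) := by
  intro z
  obtain ⟨s, hs⟩ := hV (Q.res le_sup_left z)
  obtain ⟨t, ht⟩ := hW (Q.res le_sup_right z)
  obtain ⟨γ, hγ⟩ := T.exists_emb_eq_sub _ _ hs ht
  obtain ⟨h, r, hr⟩ := S.lifts_sup_of_lifts T _ _ hs ht hγ (Lifts.of_acyclic hVW le_rfl)
    le_rfl le_rfl le_rfl
  exact ⟨r, by rw [hr, Q.res_self]⟩

/-- Degree two vanishing for a union of three open sets. -/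
theorem acyclic_sup₃ (S : FlasqueSeq F I G) (T : FlasqueSeq G J Q) {A B C : Opens Y}
    (hA : T.Acyclic A) (hB : T.Acyclic B) (hC : T.Acyclic C)
    (hAB : S.Acyclic (A ⊓ B)) (hAC : S.Acyclic (A ⊓ C)) (hBC : S.Acyclic (B ⊓ C))
    (hF : ∀ f : F.sec (A ⊓ B ⊓ C), ∃ (a : F.sec (A ⊓ B)) (b : F.sec (A ⊓ C)) (c : F.sec (B ⊓ C)),
      f = F.res inf_le_left a + F.res (inf_le_inf_right C inf_le_left) b +
        F.res (inf_le_inf_right C inf_le_right) c) :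
    T.Acyclic (A ⊔ (B ⊔ C)) := by
  intro z
  obtain ⟨yA, hyA⟩ := hA (Q.res le_sup_left z)
  obtain ⟨yB, hyB⟩ := hB (Q.res (le_sup_left.trans le_sup_right) z)
  obtain ⟨yC, hyC⟩ := hC (Q.res (le_sup_right.trans le_sup_right) z)
  obtain ⟨γAB, hγAB⟩ := T.exists_emb_eq_sub _ _ hyA hyB
  obtain ⟨γAC, hγAC⟩ := T.exists_emb_eq_sub _ _ hyA hyC
  obtain ⟨γBC, hγBC⟩ := T.exists_emb_eq_sub _ _ hyB hyC
  obtain ⟨xAB, hxAB⟩ := hAB γAB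
  obtain ⟨xAC, hxAC⟩ := hAC γAC
  obtain ⟨xBC, hxBC⟩ := hBC γBC
  have hB' : A ⊓ B ⊓ C ≤ A ⊓ C := inf_le_inf_right C inf_le_left
  have hC' : A ⊓ B ⊓ C ≤ B ⊓ C := inf_le_inf_right C inf_le_right
  -- The alternating sum of the `γ` vanishes, so that of their lifts comes from a section `f` of
  -- `F`: the Čech 2-cocycle representing the obstruction.
  obtain ⟨f, hf⟩ := S.exact _ (I.res inf_le_left xAB - I.res hB' xAC + I.res hC' xBC) (by
    apply T.emb_injective
    rw [map_add, map_sub, ← S.res_proj, ← S.res_proj, ← S.res_proj, hxAB, hxAC, hxBC]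
    rw [map_add, map_sub, ← T.res_emb, ← T.res_emb, ← T.res_emb, hγAB, hγAC, hγBC]
    simp only [map_sub, J.res_res, map_zero]
    abel)
  obtain ⟨a, b, c, habc⟩ := hF f
  -- After the correction by `a`, `b`, `c` the lifts form a cocycle with values in the flasque `I`,
  -- which is made a coboundary with component `0` on `A`: `xC` extends the lift on `A ⊓ C`, and
  -- `xB` extends the values then forced on `A ⊓ B` and `B ⊓ C`.
  obtain ⟨xC, hxC⟩ := S.flasque (inf_le_right : A ⊓ C ≤ C) (xAC + S.emb _ b)
  have hle : A ⊓ B ⊓ (B ⊓ C) ≤ A ⊓ B ⊓ C := le_inf inf_le_left (inf_le_right.trans inf_le_right)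
  obtain ⟨xB', hxB₁, hxB₂⟩ := S.sheaf₂.glue₂ (xAB - S.emb _ a)
    (I.res inf_le_right xC - (xBC - S.emb _ c)) (by
      have h1 := congrArg (I.res hle) hf
      have h2 := congrArg (I.res (hle.trans hB')) hxC
      rw [habc] at h1
      simp only [map_sub, map_add, S.res_emb, I.res_res, F.res_res] at h1 h2 ⊢
      rw [h2, sub_eq_sub_iff_add_eq_add]
      rw [← sub_eq_zero] at h1 ⊢
      rw [← neg_eq_zero, ← h1]
      abel)
  obtain ⟨xB, hxB⟩ := S.flasque (sup_le inf_le_right inf_le_left : A ⊓ B ⊔ B ⊓ C ≤ B) xB'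
  have h1 := congrArg (I.res (le_sup_left : A ⊓ B ≤ A ⊓ B ⊔ B ⊓ C)) hxB
  have h2 := congrArg (I.res (le_sup_right : B ⊓ C ≤ A ⊓ B ⊔ B ⊓ C)) hxB
  rw [I.res_res, hxB₁] at h1
  rw [I.res_res, hxB₂] at h2
  -- The lifts `yA`, `yB + xB`, `yC + xC` (with `xB`, `xC` projected to `G`) agree on the three
  -- overlaps.
  have kAB : J.res inf_le_left yA = J.res inf_le_right (yB + T.emb _ (S.proj _ xB)) := by
    rw [map_add, T.res_emb, S.res_proj, h1, map_sub, S.proj_emb, hxAB, sub_zero, hγAB]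
    abel
  have kAC : J.res inf_le_left yA = J.res inf_le_right (yC + T.emb _ (S.proj _ xC)) := by
    rw [map_add, T.res_emb, S.res_proj, hxC, map_add, S.proj_emb, hxAC, add_zero, hγAC]
    abel
  have kBC : J.res inf_le_left (yB + T.emb _ (S.proj _ xB)) =
      J.res inf_le_right (yC + T.emb _ (S.proj _ xC)) := by
    rw [map_add, map_add, T.res_emb, T.res_emb, S.res_proj, S.res_proj, h2,
      map_sub (S.proj _), map_sub (S.proj _) xBC, S.proj_emb, hxBC, sub_zero, map_sub, hγBC]
    abel
  obtain ⟨r, hr₁, hr₂⟩ := T.sheaf₂.glue₂ _ _ kBC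
  obtain ⟨y, hy₁, hy₂⟩ := T.sheaf₂.glue₂ yA r (by
    refine T.sheaf₂.sep₂ (inf_le_inf_left A le_sup_left) (inf_le_inf_left A le_sup_right)
      (inf_sup_left _ _ _).le _ _ ?_ ?_
    · have := congrArg (J.res (inf_le_right : A ⊓ B ≤ B)) hr₁
      rw [J.res_res] at this
      rw [J.res_res, J.res_res, this, kAB]
    · have := congrArg (J.res (inf_le_right : A ⊓ C ≤ C)) hr₂
      rw [J.res_res] at this
      rw [J.res_res, J.res_res, this, kAC])
  refine ⟨y, T.sheaf₃.sep₂ le_sup_left le_sup_right le_rfl _ _ ?_ ?_⟩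
  · rw [T.res_proj, hy₁, hyA]
  · rw [T.res_proj, hy₂]
    refine T.sheaf₃.sep₂ le_sup_left le_sup_right le_rfl _ _ ?_ ?_
    · rw [T.res_proj, hr₁, map_add, T.proj_emb, add_zero, hyB, Q.res_res]
    · rw [T.res_proj, hr₂, map_add, T.proj_emb, add_zero, hyC, Q.res_res]

/-- Compatible lifts over an increasing sequence of open sets give a lift over the union. -/
theorem exists_proj_eq_of_seq (S : FlasqueSeq F I G) {U : Opens Y} (g : G.sec U) (W : ℕ → Opens Y)
    (hW : Monotone W) (hU : U = iSup W) (s : ∀ n, I.sec (W n))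
    (hs : ∀ n, S.proj _ (s n) = G.res (hU ▸ le_iSup W n) g)
    (h : ∀ n, I.res (hW n.le_succ) (s (n + 1)) = s n) : ∃ t, S.proj U t = g := by
  have key : ∀ m n (hmn : m ≤ n), I.res (hW hmn) (s n) = s m := by
    intro m n hmn
    induction n, hmn using Nat.le_induction with
    | base => exact I.res_self _ _
    | succ n hmn ih => rw [← ih, ← h n, I.res_res]
  obtain ⟨t, ht⟩ := S.sheaf₂.glue_of_eq W hU s fun i j => by
    rcases le_total i j with hij | hij
    · rw [← key i j hij, I.res_res]
    · rw [← key j i hij, I.res_res]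
  refine ⟨t, S.sheaf₃.sep W U (fun n => hU ▸ le_iSup W n) hU.le _ _ fun n => ?_⟩
  rw [S.res_proj, ht n, hs n]

/-- Vanishing in degree two for the union of an increasing sequence of open sets such that lifts
exist on each of them and the obstructions to compatibility lift on smaller sets. -/
theorem exists_proj_eq_of_lifts (S : FlasqueSeq F I G) (T : FlasqueSeq G J Q) {U : Opens Y}
    (z : Q.sec U) (W : ℕ → Opens Y) (hW : Monotone W) (hU : U = iSup W)
    (hz : ∀ n, T.Lifts z (W n)) (hγ : ∀ n (γ : G.sec (W (n + 1))), S.Lifts γ (W n)) :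
    ∃ t, T.proj U t = z := by
  choose hWU y hy using hz
  -- The discrepancy of two successive lifts is a section of `G` over `W (n + 1)`. It lifts to `I`
  -- after shrinking to `W n`, and flasqueness extends that lift to `U`. This shift is why the lift
  -- with index `n + 1` is used on `W n`.
  have h1 : ∀ n, ∃ x : I.sec U,
      J.res (hW n.le_succ) (y (n + 1)) -
        J.res (hW (n.le_succ.trans (n + 1).le_succ)) (y (n + 2)) =
      J.res (hWU n) (T.emb _ (S.proj _ x)) := by
    intro n
    obtain ⟨γ, hγ'⟩ := T.exact (W (n + 1)) (y (n + 1) - J.res (hW (n + 1).le_succ) (y (n + 2)))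
      (by
        rw [map_sub, ← T.res_proj, hy, hy, Q.res_res, sub_self])
    obtain ⟨hW', x, hx⟩ := hγ n γ
    obtain ⟨x', hx'⟩ := S.flasque (hWU n) x
    refine ⟨x', ?_⟩
    rw [T.res_emb, S.res_proj, hx', hx, ← T.res_emb, hγ', map_sub, J.res_res]
  choose x hx using h1
  -- Since the corrections are defined on all of `U`, finite partial sums make the lifts compatible;
  -- no convergence is involved.
  refine T.exists_proj_eq_of_seq z W hW hU (fun n => J.res (hW n.le_succ) (y (n + 1)) +
    J.res (hWU n) (T.emb _ (S.proj _ (∑ k ∈ Finset.range n, x k)))) (fun n => ?_) fun n => ?_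
  · rw [map_add, ← T.res_proj, hy, Q.res_res, ← T.res_proj, T.proj_emb, map_zero, add_zero]
  · rw [Finset.sum_range_succ, map_add, map_add, map_add, map_add, map_add, J.res_res, J.res_res,
      J.res_res, ← hx n]
    abel

/-- The inverse image of an exact sequence. -/
def comap {Z : Type*} [TopologicalSpace Z] (S : FlasqueSeq F I G) (j : Opens Z → Opens Y)
    (hj : ∀ U V, U ≤ V → j U ≤ j V) (hinf : ∀ U V, j U ⊓ j V ≤ j (U ⊓ V))
    (hsup : ∀ {ι : Type} (U : ι → Opens Z), j (iSup U) = ⨆ i, j (U i))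
    (hmem : ∀ U, ∀ x ∈ U, ∃ y ∈ j U, ∀ V : Opens Y, y ∈ V → ∃ W ≤ U, x ∈ W ∧ j W ≤ V) :
    FlasqueSeq (F.comap j hj) (I.comap j hj) (G.comap j hj) where
  emb U := S.emb (j U)
  proj U := S.proj (j U)
  res_emb _ _ := S.res_emb _ _
  res_proj _ _ := S.res_proj _ _
  emb_injective _ := S.emb_injective _
  proj_emb _ := S.proj_emb _
  exact _ := S.exact _
  flasque h s := S.flasque (hj _ _ h) s
  sheaf₂ := S.sheaf₂.comap hj hinf hsup
  sheaf₃ := S.sheaf₃.comap hj hinf hsup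
  -- Local liftability is transported by `hmem`, which makes `j` behave on small neighborhoods like
  -- the preimage under a chart.
  surj U g x hx := by
    obtain ⟨y, hy, h⟩ := hmem U x hx
    obtain ⟨V, hV, hyV, s, hs⟩ := S.surj _ g y hy
    obtain ⟨W, hW, hxW, hWV⟩ := h V hyV
    exact ⟨W, hW, hxW, I.res hWV s,
      (S.res_proj hWV s).symm.trans ((congrArg _ hs).trans (G.res_res _ _ _))⟩

end FlasqueSeq

/-! ## Sheaves of abelian groups in the sense of Mathlib -/

section MathlibSheaves

variable {X : TopCat.{0}}

/-- The presheaf of sections of a presheaf of abelian groups. -/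
def TopCat.Presheaf.sections (F : (Opens X)ᵒᵖ ⥤ AddCommGrpCat.{0}) : AbSections X where
  sec U := F.obj (op U)
  res h := (F.map (homOfLE h).op).hom
  res_res h h' s := by
    rw [← AddCommGrpCat.comp_apply, ← F.map_comp]
    rfl
  res_self h s := by
    change (F.map (𝟙 _)).hom s = s
    rw [F.map_id]
    rfl

variable (F : CategoryTheory.Sheaf (Opens.grothendieckTopology X) AddCommGrpCat.{0})

theorem sections_isSheaf : (TopCat.Presheaf.sections F.obj).IsSheaf where
  sep U V hU hV s t h :=
    TopCat.Sheaf.eq_of_locally_eq' (F : TopCat.Sheaf AddCommGrpCat X) U V (fun i => homOfLE (hU i))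
      hV s t h
  glue {ι} U s h := by
    let s' : ∀ i : ι, ToType (F.obj.obj (op (U i))) := s
    exact (TopCat.Sheaf.existsUnique_gluing (F : TopCat.Sheaf AddCommGrpCat X) U s'
      fun i j => h i j).exists

/-- Sections over `U` are morphisms to `F` from the sheafified free abelian presheaf on `U`. For `U
≤ V` these free sheaves are related by a monomorphism, along which injectivity of `F` extends
morphisms. -/
theorem isFlasque_sections_of_injective [Injective F] :
    (TopCat.Presheaf.sections F.obj).IsFlasque := by
  intro U V h s
  let adj := ((AddCommGrpCat.adj.whiskerRight (Opens X)ᵒᵖ).comp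
    (sheafificationAdjunction (Opens.grothendieckTopology X) AddCommGrpCat.{0}))
  let L := (Functor.whiskeringRight (Opens X)ᵒᵖ _ _).obj AddCommGrpCat.free.{0} ⋙
    presheafToSheaf (Opens.grothendieckTopology X) AddCommGrpCat.{0}
  let i : yoneda.obj U ⟶ yoneda.obj V := yoneda.map (homOfLE h)
  -- Representables on `Opens X` take subsingleton values, so `i` is pointwise injective; free
  -- abelian groups preserve this, and so does sheafification.
  have hi : Mono (((Functor.whiskeringRight (Opens X)ᵒᵖ _ _).obj AddCommGrpCat.free.{0}).map i) := by
    have : ∀ W, Mono ((((Functor.whiskeringRight (Opens X)ᵒᵖ _ _).obj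
        AddCommGrpCat.free.{0}).map i).app W) := by
      intro W
      have : Mono (i.app W) := (CategoryTheory.mono_iff_injective (i.app W)).mpr
        fun a b _ => Subsingleton.elim (α := unop W ⟶ U) a b
      exact inferInstanceAs (Mono (AddCommGrpCat.free.map (i.app W)))
    exact NatTrans.mono_of_mono_app _
  have hL : Mono (L.map i) := inferInstanceAs (Mono ((presheafToSheaf _ _).map _))
  let φ : L.obj (yoneda.obj U) ⟶ F := (adj.homEquiv _ _).symm (yonedaEquiv.symm s)
  have hφ : L.map i ≫ Injective.factorThru φ (L.map i) = φ := Injective.comp_factorThru φ (L.map i)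
  generalize Injective.factorThru φ (L.map i) = ψ at hφ
  refine ⟨yonedaEquiv (adj.homEquiv _ _ ψ), ?_⟩
  have h1 := yonedaEquiv_naturality (adj.homEquiv _ _ ψ) (homOfLE h)
  refine h1.trans ?_
  have h2 := adj.homEquiv_naturality_left i ψ
  refine (Equiv.eq_symm_apply _).mp (h2.symm.trans ?_)
  rw [← Equiv.eq_symm_apply]
  exact hφ

/-- The exact sequence of sections of a short exact sequence with injective middle term. -/
noncomputable def flasqueSeq
    {S : ShortComplex (CategoryTheory.Sheaf (Opens.grothendieckTopology X) AddCommGrpCat.{0})}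
    (hS : S.ShortExact) (hI : Injective S.X₂) :
    FlasqueSeq (TopCat.Presheaf.sections S.X₁.obj) (TopCat.Presheaf.sections S.X₂.obj)
      (TopCat.Presheaf.sections S.X₃.obj) where
  emb U := (S.f.hom.app (op U)).hom
  proj U := (S.g.hom.app (op U)).hom
  res_emb h s := (NatTrans.naturality_apply S.f.hom (homOfLE h).op s).symm
  res_proj h s := (NatTrans.naturality_apply S.g.hom (homOfLE h).op s).symm
  emb_injective U := by
    have := hS.mono_f
    have h1 : Mono ((sheafToPresheaf (Opens.grothendieckTopology X) AddCommGrpCat).map S.f) :=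
      inferInstance
    have h2 : Mono (S.f.hom.app (op U)) := (NatTrans.mono_iff_mono_app _).mp h1 (op U)
    exact (AddCommGrpCat.mono_iff_injective _).mp h2
  proj_emb U s := by
    have h1 := congrArg (fun f => ((sheafToPresheaf (Opens.grothendieckTopology X)
      AddCommGrpCat).map f).app (op U)) S.zero
    exact ConcreteCategory.congr_hom h1 s
  exact U s hs := TopCat.Sheaf.sections_exact_of_left_exact hS.1 hS.2 s hs
  flasque := isFlasque_sections_of_injective S.X₂
  sheaf₂ := sections_isSheaf S.X₂
  sheaf₃ := sections_isSheaf S.X₃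
  surj U g x hx := by
    have := (TopCat.Sheaf.isLocallySurjective_iff_epi S.g).mpr hS.epi_g
    obtain ⟨V, hV, ⟨s, hs⟩, hxV⟩ :=
      (TopCat.Presheaf.isLocallySurjective_iff S.g.hom).mp this U g x hx
    exact ⟨V, hV, hxV, s, hs⟩

theorem exists_injective_shortExact :
    ∃ (I G : CategoryTheory.Sheaf (Opens.grothendieckTopology X) AddCommGrpCat.{0}) (f : F ⟶ I)
      (g : I ⟶ G) (w : f ≫ g = 0), (ShortComplex.mk f g w).ShortExact ∧ Injective I :=
  ⟨_, _, Injective.ι F, Limits.cokernel.π (Injective.ι F), Limits.cokernel.condition _,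
    { exact := ShortComplex.exact_cokernel _ }, inferInstanceAs (Injective (Injective.under F))⟩

/-- The second cohomology vanishes if for all embeddings into flasque sheaves all global sections
of the second cokernel lift. -/
theorem subsingleton_H_two
    (h : ∀ (I G J Q : AbSections X) (_ : FlasqueSeq (TopCat.Presheaf.sections F.obj) I G)
      (T : FlasqueSeq G J Q), T.Acyclic ⊤) : Subsingleton (CategoryTheory.Sheaf.H F 2) := by
  obtain ⟨I, G, f, g, w, hS, hI⟩ := exists_injective_shortExact F
  obtain ⟨J, Q, p, q, w', hT, hJ⟩ := exists_injective_shortExact G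
  have hsurj := h _ _ _ _ (flasqueSeq hS hI) (flasqueSeq hT hJ)
  refine subsingleton_of_forall_eq 0 fun α => ?_
  -- Dimension shifting: `α` comes from `H¹(G)` because `H²(I) = 0`, and then from a global section
  -- of `Q` because `H¹(J) = 0`.
  obtain ⟨β, rfl⟩ := Abelian.Ext.covariant_sequence_exact₁ _ hS α
    (Abelian.Ext.eq_zero_of_injective _) (show 1 + 1 = 2 from rfl)
  obtain ⟨γ, rfl⟩ := Abelian.Ext.covariant_sequence_exact₁ _ hT β
    (Abelian.Ext.eq_zero_of_injective _) (show 0 + 1 = 1 from rfl)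
  have hterm : Limits.IsTerminal (⊤ : Opens X) := Limits.isTerminalTop
  obtain ⟨y, hy⟩ := hsurj (CategoryTheory.Sheaf.H.equiv₀ Q hterm γ)
  obtain ⟨y', hy'⟩ := (CategoryTheory.Sheaf.H.equiv₀ J hterm).surjective y
  have hγ : γ = CategoryTheory.Sheaf.H.map q 0 y' := by
    refine (CategoryTheory.Sheaf.H.equiv₀ Q hterm).injective ?_
    rw [← CategoryTheory.Sheaf.H.equiv₀_naturality hterm q, hy']
    exact hy.symm
  -- As `γ` lifts to `J`, it is killed by the connecting map: the projection followed by the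
  -- extension class is zero.
  have h0 : γ.comp hT.extClass (show 0 + 1 = 1 from rfl) = 0 := by
    rw [hγ, CategoryTheory.Sheaf.H.map_apply]
    refine (Abelian.Ext.comp_assoc y' (Abelian.Ext.mk₀ q) hT.extClass (add_zero 0) (zero_add 1)
      (add_zero 1)).trans ?_
    exact (congrArg (fun z : Abelian.Ext _ _ 1 => y'.comp z (add_zero 1 : 0 + 1 = 1)) hT.comp_extClass).trans
      (by simp)
  rw [h0]
  simp

end MathlibSheaves

/-! ## Holomorphic functions of two variables -/

section TwoVariables

open MeasureTheory Metric Set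

variable {E : Type*} [NormedAddCommGroup E] [NormedSpace ℂ E]

/-- The Cauchy kernel `(ζ, η) ↦ ((ζ - z) (η - w))⁻¹` depends analytically on `(z, w)` as an element
of a space of continuous functions. -/
theorem analyticAt_inverse_kernel {T : Type*} [TopologicalSpace T] [CompactSpace T]
    (a b : C(T, ℂ)) (p : ℂ × ℂ) (ha : ∀ t, a t ≠ p.1) (hb : ∀ t, b t ≠ p.2) :
    AnalyticAt ℂ (fun q : ℂ × ℂ => Ring.inverse ((a - q.1 • 1) * (b - q.2 • 1))) p := by
  have hu : IsUnit ((a - p.1 • 1) * (b - p.2 • 1)) := by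
    rw [ContinuousMap.isUnit_iff_forall_ne_zero]
    intro t
    simp [sub_eq_zero, ha t, hb t]
  have h1 : AnalyticAt ℂ (fun q : ℂ × ℂ => (a - q.1 • 1) * (b - q.2 • 1)) p :=
    (analyticAt_const.sub (analyticAt_fst.smul analyticAt_const)).mul
      (analyticAt_const.sub (analyticAt_snd.smul analyticAt_const))
  have h2 := analyticAt_inverse (𝕜 := ℂ) hu.unit
  exact AnalyticAt.comp (g := Ring.inverse) h2 h1

theorem ringInverse_kernel_apply {T : Type*} [TopologicalSpace T] [CompactSpace T]
    (a b : C(T, ℂ)) (p : ℂ × ℂ) (ha : ∀ t, a t ≠ p.1) (hb : ∀ t, b t ≠ p.2) (t : T) :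
    Ring.inverse ((a - p.1 • 1) * (b - p.2 • 1)) t = (a t - p.1)⁻¹ * (b t - p.2)⁻¹ := by
  have hu : IsUnit ((a - p.1 • 1) * (b - p.2 • 1)) := by
    rw [ContinuousMap.isUnit_iff_forall_ne_zero]
    intro t
    simp [sub_eq_zero, ha t, hb t]
  have h := congrArg (fun f : C(T, ℂ) => f t) (Ring.mul_inverse_cancel _ hu)
  simp only [ContinuousMap.mul_apply, ContinuousMap.sub_apply, ContinuousMap.smul_apply,
    ContinuousMap.one_apply, smul_eq_mul, mul_one] at h
  rw [← mul_inv]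
  exact eq_inv_of_mul_eq_one_right h

/-- Integration of continuous functions on a compact space along a parametrized surface. -/
noncomputable def surfaceIntegral {T : Type*} [TopologicalSpace T] [CompactSpace T]
    (γ : C(ℝ × ℝ, T)) (h : C(ℝ × ℝ, E)) : C(T, ℂ) →L[ℂ] E :=
  have hc : ∀ k : C(T, ℂ), Continuous (Function.uncurry fun θ φ => k (γ (θ, φ)) • h (θ, φ)) :=
    fun k => by
      simp only [Function.uncurry_def]
      fun_prop
  have hi : ∀ (k : C(T, ℂ)) θ, IntervalIntegrable (fun φ => k (γ (θ, φ)) • h (θ, φ)) volume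
      0 (2 * Real.pi) := fun k θ =>
    Continuous.intervalIntegrable ((hc k).comp (Continuous.prodMk_right θ)) _ _
  have hI : ∀ k : C(T, ℂ), IntervalIntegrable
      (fun θ => ∫ φ in 0..2 * Real.pi, k (γ (θ, φ)) • h (θ, φ)) volume 0 (2 * Real.pi) := fun k =>
    Continuous.intervalIntegrable
      (intervalIntegral.continuous_parametric_intervalIntegral_of_continuous' (hc k) _ _) _ _
  have hM : ∃ M, ∀ x ∈ Icc 0 (2 * Real.pi) ×ˢ Icc 0 (2 * Real.pi), ‖h x‖ ≤ M :=
    (isCompact_Icc.prod isCompact_Icc).exists_bound_of_continuousOn h.continuous.continuousOn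
  LinearMap.mkContinuous
    { toFun := fun k => ∫ θ in 0..2 * Real.pi, ∫ φ in 0..2 * Real.pi, k (γ (θ, φ)) • h (θ, φ)
      map_add' := fun k l => by
        rw [← intervalIntegral.integral_add (hI k) (hI l)]
        congr 1
        ext θ
        rw [← intervalIntegral.integral_add (hi k θ) (hi l θ)]
        simp [add_smul]
      map_smul' := fun c k => by
        simp [mul_smul, intervalIntegral.integral_smul] }
    (hM.choose * |2 * Real.pi - 0| * |2 * Real.pi - 0|) fun k => by
      have h2 : Set.uIoc 0 (2 * Real.pi) ⊆ Icc 0 (2 * Real.pi) := by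
        rw [uIoc_of_le Real.two_pi_pos.le]
        exact Ioc_subset_Icc_self
      have key : ∀ θ ∈ Set.uIoc 0 (2 * Real.pi),
          ‖∫ φ in 0..2 * Real.pi, k (γ (θ, φ)) • h (θ, φ)‖ ≤
          (‖k‖ * hM.choose) * |2 * Real.pi - 0| := fun θ hθ =>
        intervalIntegral.norm_integral_le_of_norm_le_const fun φ hφ => by
          rw [norm_smul]
          exact mul_le_mul (k.norm_coe_le_norm _) (hM.choose_spec _ ⟨h2 hθ, h2 hφ⟩)
            (norm_nonneg _) (norm_nonneg _)
      refine (intervalIntegral.norm_integral_le_of_norm_le_const key).trans (le_of_eq ?_)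
      ring

theorem surfaceIntegral_apply {T : Type*} [TopologicalSpace T] [CompactSpace T]
    (γ : C(ℝ × ℝ, T)) (h : C(ℝ × ℝ, E)) (k : C(T, ℂ)) : surfaceIntegral γ h k =
    ∫ θ in 0..2 * Real.pi, ∫ φ in 0..2 * Real.pi, k (γ (θ, φ)) • h (θ, φ) := rfl

variable [CompleteSpace E]

/-- Osgood's lemma: a continuous function of two variables which is holomorphic in each variable is
analytic. -/
theorem analyticOnNhd_of_separately {f : ℂ × ℂ → E} {U : Set (ℂ × ℂ)} (hU : IsOpen U)
    (hf : ContinuousOn f U) (h₁ : ∀ p ∈ U, DifferentiableAt ℂ (fun z => f (z, p.2)) p.1)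
    (h₂ : ∀ p ∈ U, DifferentiableAt ℂ (fun w => f (p.1, w)) p.2) : AnalyticOnNhd ℂ f U := by
  rintro ⟨z₀, w₀⟩ hp
  obtain ⟨r, hr, hrU⟩ : ∃ r > 0, closedBall z₀ r ×ˢ closedBall w₀ r ⊆ U := by
    obtain ⟨r, hr, h⟩ := Metric.nhds_basis_closedBall.mem_iff.mp (hU.mem_nhds hp)
    exact ⟨r, hr, by rwa [closedBall_prod_same]⟩
  -- `T` is the distinguished boundary of a bidisc. The iterated Cauchy formula writes `f` as a
  -- continuous linear functional on `C(T, ℂ)` applied to the Cauchy kernel, which depends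
  -- analytically on the point.
  let T := ↥(sphere z₀ r ×ˢ sphere w₀ r)
  have hT : CompactSpace T :=
    isCompact_iff_compactSpace.mp ((isCompact_sphere z₀ r).prod (isCompact_sphere w₀ r))
  have hTU : ∀ t : T, (t : ℂ × ℂ) ∈ U := fun t =>
    hrU ⟨sphere_subset_closedBall t.2.1, sphere_subset_closedBall t.2.2⟩
  let a : C(T, ℂ) := ⟨fun t => t.1.1, by fun_prop⟩
  let b : C(T, ℂ) := ⟨fun t => t.1.2, by fun_prop⟩
  let γ : C(ℝ × ℝ, T) := ⟨fun x => ⟨(circleMap z₀ r x.1, circleMap w₀ r x.2),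
    circleMap_mem_sphere _ hr.le _, circleMap_mem_sphere _ hr.le _⟩, by
      refine Continuous.subtype_mk (Continuous.prodMk ?_ ?_) _
      · exact (continuous_circleMap z₀ r).comp continuous_fst
      · exact (continuous_circleMap w₀ r).comp continuous_snd⟩
  let h : C(ℝ × ℝ, E) := ⟨fun x => (deriv (circleMap z₀ r) x.1 * deriv (circleMap w₀ r) x.2) •
    f (circleMap z₀ r x.1, circleMap w₀ r x.2), by
      have h1 : Continuous fun x : ℝ × ℝ => f (circleMap z₀ r x.1, circleMap w₀ r x.2) :=
        (continuousOn_iff_continuous_domRestrict.mp hf).comp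
          (f := fun x : ℝ × ℝ => (⟨(circleMap z₀ r x.1, circleMap w₀ r x.2), hTU (γ x)⟩ : U)) (by fun_prop)
      simp only [deriv_circleMap]
      exact Continuous.smul (by fun_prop) h1⟩
  have key : ∀ p ∈ ball z₀ r ×ˢ ball w₀ r, f p = ((2 * Real.pi * Complex.I : ℂ)⁻¹ *
      (2 * Real.pi * Complex.I : ℂ)⁻¹) •
      surfaceIntegral γ h (Ring.inverse ((a - p.1 • 1) * (b - p.2 • 1))) := by
    rintro ⟨z, w⟩ ⟨hz, hw⟩
    have ha : ∀ t, a t ≠ z := fun t ht => (ne_of_lt (mem_ball.mp hz)) (ht ▸ mem_sphere.mp t.2.1)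
    have hb : ∀ t, b t ≠ w := fun t ht => (ne_of_lt (mem_ball.mp hw)) (ht ▸ mem_sphere.mp t.2.2)
    have e1 : (∮ ζ in C(z₀, r), (ζ - z)⁻¹ • f (ζ, w)) = (2 * Real.pi * Complex.I : ℂ) • f (z, w) := by
      refine DifferentiableOn.circleIntegral_sub_inv_smul (f := fun ζ => f (ζ, w)) ?_ hz
      exact fun ζ hζ =>
        (h₁ (ζ, w) (hrU ⟨hζ, ball_subset_closedBall hw⟩)).differentiableWithinAt
    have e2 : ∀ ζ ∈ sphere z₀ r, (∮ η in C(w₀, r), (η - w)⁻¹ • f (ζ, η)) =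
        (2 * Real.pi * Complex.I : ℂ) • f (ζ, w) := by
      intro ζ hζ
      refine DifferentiableOn.circleIntegral_sub_inv_smul (f := fun η => f (ζ, η)) ?_ hw
      exact fun η hη =>
        (h₂ (ζ, η) (hrU ⟨sphere_subset_closedBall hζ, hη⟩)).differentiableWithinAt
    have e3 : surfaceIntegral γ h (Ring.inverse ((a - z • 1) * (b - w • 1))) =
        (2 * Real.pi * Complex.I : ℂ) • ∮ ζ in C(z₀, r), (ζ - z)⁻¹ • f (ζ, w) := by
      rw [surfaceIntegral_apply, circleIntegral, ← intervalIntegral.integral_smul]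
      refine intervalIntegral.integral_congr fun θ _ => ?_
      have e4 := e2 _ (circleMap_mem_sphere z₀ hr.le θ)
      rw [circleIntegral] at e4
      rw [smul_comm _ (deriv _ _), smul_comm _ (_ - _)⁻¹, ← e4, ← intervalIntegral.integral_smul,
        ← intervalIntegral.integral_smul]
      refine intervalIntegral.integral_congr fun φ _ => ?_
      simp only [ringInverse_kernel_apply a b (z, w) ha hb]
      simp only [a, b, h, γ, ContinuousMap.coe_mk, smul_smul]
      congr 1
      ring
    rw [e3, e1, smul_smul (2 * Real.pi * Complex.I : ℂ), smul_smul]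
    have : (2 * Real.pi * Complex.I : ℂ) ≠ 0 := by simp [Real.pi_ne_zero]
    rw [← mul_inv, inv_mul_cancel₀ (mul_ne_zero this this), one_smul]
  have hz : ∀ t, a t ≠ z₀ := fun t ht => hr.ne (by simpa [show t.1.1 = z₀ from ht] using mem_sphere.mp t.2.1)
  have hw : ∀ t, b t ≠ w₀ := fun t ht => hr.ne (by simpa [show t.1.2 = w₀ from ht] using mem_sphere.mp t.2.2)
  refine AnalyticAt.congr (f := fun p => ((2 * Real.pi * Complex.I : ℂ)⁻¹ *
      (2 * Real.pi * Complex.I : ℂ)⁻¹) •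
      surfaceIntegral γ h (Ring.inverse ((a - p.1 • 1) * (b - p.2 • 1)))) ?_ ?_
  · exact (((surfaceIntegral γ h).analyticAt _).comp
      (analyticAt_inverse_kernel a b (z₀, w₀) hz hw)).const_smul
  · filter_upwards [prod_mem_nhds (ball_mem_nhds z₀ hr) (ball_mem_nhds w₀ hr)] with p hp
    exact (key p hp).symm

/-- Differentiability gives continuity and holomorphy in each variable, so Osgood's lemma applies.
Analyticity of integrals is then a matter of differentiating under the integral sign. -/
theorem DifferentiableOn.analyticOnNhd_prod {f : ℂ × ℂ → E} {U : Set (ℂ × ℂ)} (hU : IsOpen U)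
    (hf : DifferentiableOn ℂ f U) : AnalyticOnNhd ℂ f U :=
  analyticOnNhd_of_separately hU hf.continuousOn
    (fun p hp => ((hf p hp).differentiableAt (hU.mem_nhds hp)).comp p.1
      (by fun_prop : DifferentiableAt ℂ (fun z => (z, p.2)) p.1))
    (fun p hp => ((hf p hp).differentiableAt (hU.mem_nhds hp)).comp p.2
      (by fun_prop : DifferentiableAt ℂ (fun w => (p.1, w)) p.2))

/-- Sums of series of analytic functions with a summable bound are analytic. -/
theorem analyticOnNhd_tsum {f : ℕ → ℂ × ℂ → E} {U : Set (ℂ × ℂ)} (hU : IsOpen U) {u : ℕ → ℝ}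
    (hu : Summable u) (hf : ∀ n, AnalyticOnNhd ℂ (f n) U) (hfu : ∀ n, ∀ p ∈ U, ‖f n p‖ ≤ u n) :
    AnalyticOnNhd ℂ (fun p => ∑' n, f n p) U := by
  refine analyticOnNhd_of_separately hU
    (continuousOn_tsum (fun n => (hf n).continuousOn) hu hfu) ?_ ?_
  · intro p hp
    have h := Complex.differentiableOn_tsum_of_summable_norm (F := fun n z => f n (z, p.2))
      (U := (fun z => (z, p.2)) ⁻¹' U) hu ?_ (hU.preimage (by fun_prop)) fun n z hz => hfu n _ hz
    · exact (h p.1 hp).differentiableAt ((hU.preimage (by fun_prop)).mem_nhds hp)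
    · exact fun n z hz => (((hf n _ hz).differentiableAt).comp z
        (by fun_prop : DifferentiableAt ℂ (fun z => (z, p.2)) z)).differentiableWithinAt
  · intro p hp
    have h := Complex.differentiableOn_tsum_of_summable_norm (F := fun n w => f n (p.1, w))
      (U := (fun w => (p.1, w)) ⁻¹' U) hu ?_ (hU.preimage (by fun_prop)) fun n z hz => hfu n _ hz
    · exact (h p.2 hp).differentiableAt ((hU.preimage (by fun_prop)).mem_nhds hp)
    · exact fun n w hw => (((hf n _ hw).differentiableAt).comp w
        (by fun_prop : DifferentiableAt ℂ (fun w => (p.1, w)) w)).differentiableWithinAt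

/-- Integrals of Cauchy type are analytic. -/
theorem analyticOnNhd_integral_cauchy_kernel {T : Type*} [TopologicalSpace T] [T2Space T] [MeasurableSpace T]
    [OpensMeasurableSpace T] [SecondCountableTopology T] {μ : Measure T}
    [IsFiniteMeasureOnCompacts μ] {K K' : Set T} (hK : IsCompact K) (hK' : MeasurableSet K')
    (hKK' : K' ⊆ K) {f : ℂ × ℂ → E} {V Ω : Set (ℂ × ℂ)} (hΩ : IsOpen Ω)
    (hf : AnalyticOnNhd ℂ f V) {a b c : T → ℂ} (ha : ContinuousOn a K) (hb : ContinuousOn b K)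
    (hc : ContinuousOn c K) (hV : ∀ p ∈ Ω, ∀ t ∈ K, a t ≠ p.1 ∧ (b t, p.2) ∈ V) :
    AnalyticOnNhd ℂ (fun p => ∫ t in K', c t • (a t - p.1)⁻¹ • f (b t, p.2) ∂μ) Ω := by
  refine DifferentiableOn.analyticOnNhd_prod hΩ fun p₀ hp₀ => ?_
  obtain ⟨r, hr, hrΩ⟩ := Metric.nhds_basis_closedBall.mem_iff.mp (hΩ.mem_nhds hp₀)
  let F' : ℂ × ℂ → T → (ℂ × ℂ →L[ℂ] E) := fun p t => c t •
    ((a t - p.1)⁻¹ • (fderiv ℂ f (b t, p.2)).comp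
      ((0 : ℂ × ℂ →L[ℂ] ℂ).prod (ContinuousLinearMap.snd ℂ ℂ ℂ)) +
      ((((a t - p.1) ^ 2)⁻¹ • ContinuousLinearMap.fst ℂ ℂ ℂ).smulRight (f (b t, p.2))))
  have hder : ∀ t ∈ K, ∀ p ∈ Ω,
      HasFDerivAt (fun p => c t • (a t - p.1)⁻¹ • f (b t, p.2)) (F' p t) p := by
    intro t ht p hp
    have h1 : HasFDerivAt (fun p : ℂ × ℂ => (a t - p.1)⁻¹)
        (((a t - p.1) ^ 2)⁻¹ • ContinuousLinearMap.fst ℂ ℂ ℂ) p := by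
      have h := (hasDerivAt_inv (sub_ne_zero.mpr (hV p hp t ht).1)).comp_hasFDerivAt p
        ((hasFDerivAt_const (a t) p).sub (hasFDerivAt_fst (𝕜 := ℂ) (p := p)))
      refine h.congr_fderiv ?_
      ext <;> simp
    have h2 : HasFDerivAt (fun p : ℂ × ℂ => f (b t, p.2)) ((fderiv ℂ f (b t, p.2)).comp
        ((0 : ℂ × ℂ →L[ℂ] ℂ).prod (ContinuousLinearMap.snd ℂ ℂ ℂ))) p :=
      HasFDerivAt.comp p ((hf _ (hV p hp t ht).2).differentiableAt.hasFDerivAt)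
        ((hasFDerivAt_const (b t) p).prodMk hasFDerivAt_snd)
    exact (h1.smul h2).const_smul (c t)
  have hbp : ContinuousOn (fun x : (ℂ × ℂ) × T => (b x.2, x.1.2)) (Ω ×ˢ K) :=
    (hb.comp continuousOn_snd fun x hx => hx.2).prodMk (by fun_prop)
  have hbpm : MapsTo (fun x : (ℂ × ℂ) × T => (b x.2, x.1.2)) (Ω ×ˢ K) V :=
    fun x hx => (hV x.1 hx.1 x.2 hx.2).2
  have hap : ContinuousOn (fun x : (ℂ × ℂ) × T => a x.2 - x.1.1) (Ω ×ˢ K) :=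
    (ha.comp continuousOn_snd fun x hx => hx.2).sub (by fun_prop)
  have hap0 : ∀ x ∈ Ω ×ˢ K, a x.2 - x.1.1 ≠ 0 :=
    fun x hx => sub_ne_zero.mpr (hV x.1 hx.1 x.2 hx.2).1
  have hcp : ContinuousOn (fun x : (ℂ × ℂ) × T => c x.2) (Ω ×ˢ K) :=
    hc.comp continuousOn_snd fun x hx => hx.2
  have hfp : ContinuousOn (fun x : (ℂ × ℂ) × T => f (b x.2, x.1.2)) (Ω ×ˢ K) :=
    hf.continuousOn.comp hbp hbpm
  have hfp' : ContinuousOn (fun x : (ℂ × ℂ) × T => fderiv ℂ f (b x.2, x.1.2)) (Ω ×ˢ K) :=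
    hf.fderiv.continuousOn.comp hbp hbpm
  have hF : ContinuousOn (fun x : (ℂ × ℂ) × T => c x.2 • (a x.2 - x.1.1)⁻¹ • f (b x.2, x.1.2))
      (Ω ×ˢ K) := hcp.smul ((hap.inv₀ hap0).smul hfp)
  have hF' : ContinuousOn (fun x : (ℂ × ℂ) × T => F' x.1 x.2) (Ω ×ˢ K) := by
    refine hcp.smul (((hap.inv₀ hap0).smul (hfp'.clm_comp continuousOn_const)).add ?_)
    have h1 : ContinuousOn (fun x : (ℂ × ℂ) × T => ((a x.2 - x.1.1) ^ 2)⁻¹) (Ω ×ˢ K) :=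
      (hap.pow 2).inv₀ fun x hx => pow_ne_zero 2 (hap0 x hx)
    refine (((ContinuousLinearMap.smulRightL ℂ (ℂ × ℂ) E
      (ContinuousLinearMap.fst ℂ ℂ ℂ)).continuous.comp_continuousOn (h1.smul hfp))).congr ?_
    intro x _
    ext <;> simp [mul_comm]
  -- The dominating constant comes from compactness of `K`, while the integration runs over a merely
  -- measurable `K'`, such as a half-open interval or a difference of compact sets.
  obtain ⟨M, hM⟩ := ((isCompact_closedBall p₀ r).prod hK).exists_bound_of_continuousOn
    (hF'.mono (prod_mono hrΩ subset_rfl))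
  have hslice : ∀ p ∈ Ω, ContinuousOn (fun t => c t • (a t - p.1)⁻¹ • f (b t, p.2)) K :=
    fun p hp => hF.comp (f := fun t => (p, t)) (by fun_prop) fun t ht => ⟨hp, ht⟩
  have hslice' : ContinuousOn (fun t => F' p₀ t) K :=
    hF'.comp (f := fun t => (p₀, t)) (by fun_prop) fun t ht => ⟨hp₀, ht⟩
  have hfin : IsFiniteMeasure (μ.restrict K') :=
    ⟨by rw [Measure.restrict_apply_univ]; exact (measure_mono hKK').trans_lt hK.measure_lt_top⟩
  refine (hasFDerivAt_integral_of_dominated_of_fderiv_le (bound := fun _ => M) (F' := F')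
    (closedBall_mem_nhds p₀ hr) ?_ ?_ ?_ ?_ (integrable_const M) ?_).differentiableAt.differentiableWithinAt
  · filter_upwards [hΩ.mem_nhds hp₀] with p hp
    exact ((hslice p hp).mono hKK').aestronglyMeasurable hK'
  · exact ((hslice p₀ hp₀).integrableOn_compact hK).mono_set hKK'
  · exact (hslice'.mono hKK').aestronglyMeasurable hK'
  · exact (ae_restrict_iff' hK').mpr (Filter.Eventually.of_forall fun t ht p hp =>
      hM (p, t) ⟨hp, hKK' ht⟩)
  · exact (ae_restrict_iff' hK').mpr (Filter.Eventually.of_forall fun t ht p hp =>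
      hder t (hKK' ht) p (hrΩ hp))

end TwoVariables

/-! ## The Cauchy–Pompeiu formula and splitting of cocycles -/

section CauchyPompeiu

open MeasureTheory Metric Set

variable {E : Type*} [NormedAddCommGroup E] [NormedSpace ℂ E] [CompleteSpace E]

/-- Twice the Cauchy–Riemann operator `∂/∂z̄`. -/
noncomputable def dbar (φ : ℂ → E) (ζ : ℂ) : E := fderiv ℝ φ ζ 1 + Complex.I • fderiv ℝ φ ζ Complex.I

/-- This is the Cauchy–Pompeiu formula without boundary term. In polar coordinates around `z` the
Jacobian `r` cancels the kernel and the integrand becomes `∂φ/∂r + (i/r) ∂φ/∂θ`. The radial integral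
gives `-φ z` on each ray, and the angular integral vanishes by periodicity. -/
theorem integral_cauchy_kernel_dbar {φ : ℂ → E} (hφ : ContDiff ℝ 1 φ) (hc : HasCompactSupport φ)
    (z : ℂ) : ∫ ζ, (ζ - z)⁻¹ • dbar φ ζ = -(2 * Real.pi : ℂ) • φ z := by
  obtain ⟨R, hR, hRφ⟩ : ∃ R > 0, ∀ ζ, R < ‖ζ - z‖ → φ ζ = 0 ∧ fderiv ℝ φ ζ = 0 := by
    obtain ⟨R, hR, h⟩ := hc.isCompact.isBounded.subset_closedBall_lt 0 z
    refine ⟨R, hR, fun ζ hζ => ?_⟩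
    have h1 : ζ ∉ tsupport φ := fun h' => by
      have := h h'
      rw [mem_closedBall, dist_eq_norm] at this
      exact absurd this (not_le.mpr hζ)
    exact ⟨image_eq_zero_of_notMem_tsupport h1,
      image_eq_zero_of_notMem_tsupport fun h' => h1 (tsupport_fderiv_subset ℝ h')⟩
  let e : ℝ → ℂ := fun θ => Complex.exp (θ * Complex.I)
  have he : Continuous e := by fun_prop
  have hen : ∀ θ, ‖e θ‖ = 1 := fun θ => Complex.norm_exp_ofReal_mul_I θ
  have hD : Continuous (fderiv ℝ φ) := hφ.continuous_fderiv one_ne_zero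
  -- `A` is the radial derivative of `φ`, and `B` is `r⁻¹` times the angular one.
  let A : ℝ × ℝ → E := fun p => fderiv ℝ φ (z + p.1 * e p.2) (e p.2)
  let B : ℝ × ℝ → E := fun p => fderiv ℝ φ (z + p.1 * e p.2) (Complex.I * e p.2)
  have hz : ∀ p : ℝ × ℝ, R < p.1 → fderiv ℝ φ (z + p.1 * e p.2) = 0 := fun p hp =>
    (hRφ _ (by simpa [hen, abs_of_pos (hR.trans hp)] using hp)).2
  have hint : ∀ g : ℝ × ℝ → E, Continuous g → (∀ p : ℝ × ℝ, R < p.1 → g p = 0) →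
      IntegrableOn g (Ioi 0 ×ˢ Ioo (-Real.pi) Real.pi) := by
    intro g hg h0
    refine (hg.continuousOn.integrableOn_compact
      (isCompact_Icc.prod isCompact_Icc : IsCompact (Icc 0 R ×ˢ Icc (-Real.pi) Real.pi))
      ).of_forall_sdiff_eq_zero (measurableSet_Ioi.prod measurableSet_Ioo) ?_
    rintro ⟨r, θ⟩ ⟨⟨hr, hθ⟩, h⟩
    refine h0 _ (not_le.mp fun h' => h ⟨⟨le_of_lt hr, h'⟩, Ioo_subset_Icc_self hθ⟩)
  have hA : Continuous A := by
    refine (hD.comp (by fun_prop)).clm_apply (by fun_prop)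
  have hB : Continuous B := by
    refine (hD.comp (by fun_prop)).clm_apply (by fun_prop)
  have hAi := hint A hA fun p hp => by simp [A, hz p hp]
  have hBi := hint B hB fun p hp => by simp [B, hz p hp]
  have hA' : ∫ p in Ioi 0 ×ˢ Ioo (-Real.pi) Real.pi, A p = -(2 * Real.pi : ℂ) • φ z := by
    have h1 : ∀ θ, ∫ r in Ioi 0, A (r, θ) = - φ z := by
      intro θ
      have h := integral_Ioi_of_hasDerivAt_of_tendsto (f := fun r : ℝ => φ (z + r * e θ))
        (f' := fun r => A (r, θ)) (a := 0) (m := 0) ?_ ?_ ?_ ?_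
      · simpa using h
      · refine Continuous.continuousWithinAt ?_
        have := hφ.continuous
        fun_prop
      · intro r _
        have h1 : HasDerivAt (fun r : ℝ => z + r * e θ) (e θ) r := by
          have := (Complex.ofRealCLM.hasDerivAt (x := r)).mul_const (e θ)
          simpa using this.const_add z
        exact ((hφ.differentiable one_ne_zero _).hasFDerivAt).comp_hasDerivAt r h1
      · refine ((hA.comp (Continuous.prodMk_left θ)).continuousOn.integrableOn_compact
          (isCompact_Icc (a := (0:ℝ)) (b := R))).of_forall_sdiff_eq_zero measurableSet_Ioi ?_
        rintro r ⟨hr, h⟩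
        have : R < r := not_le.mp fun h' => h ⟨le_of_lt hr, h'⟩
        simp [A, hz (r, θ) this]
      · refine tendsto_const_nhds.congr' ?_
        filter_upwards [Filter.eventually_gt_atTop R] with r hr
        exact ((hRφ _ (by simpa [hen, abs_of_pos (hR.trans hr)] using hr)).1).symm
    rw [Measure.volume_eq_prod, ← setIntegral_prod_swap, setIntegral_prod]
    · simp only [Prod.swap_prod_mk, h1]
      rw [setIntegral_const]
      simp only [measureReal_def, Real.volume_Ioo]
      rw [ENNReal.toReal_ofReal (by linarith [Real.pi_pos]), smul_neg, neg_smul, ← Complex.coe_smul]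
      congr 2
      push_cast
      ring
    · rw [Measure.volume_eq_prod] at hAi
      exact hAi.swap
  have hB' : ∫ p in Ioi 0 ×ˢ Ioo (-Real.pi) Real.pi, B p = 0 := by
    rw [Measure.volume_eq_prod] at hBi ⊢
    rw [setIntegral_prod _ hBi]
    rw [setIntegral_congr_fun measurableSet_Ioi (g := fun _ => (0 : E)) fun r hr => ?_]
    · simp
    have hr' : (r : ℂ) ≠ 0 := by exact_mod_cast (ne_of_gt hr : r ≠ 0)
    have h1 : ∀ θ : ℝ, HasDerivAt (fun θ : ℝ => φ (z + r * e θ)) ((r : ℂ) • B (r, θ)) θ := by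
      intro θ
      have h2 : HasDerivAt (fun θ : ℝ => z + r * e θ) (r • (Complex.I * e θ)) θ := by
        have h3 : HasDerivAt e (e θ * Complex.I) θ := by
          have := ((Complex.ofRealCLM.hasDerivAt (x := θ)).mul_const Complex.I).cexp
          simpa [e] using this
        refine ((h3.const_mul (r : ℂ)).const_add z).congr_deriv ?_
        simp [mul_comm]
      refine (((hφ.differentiable one_ne_zero _).hasFDerivAt).comp_hasDerivAt θ h2).congr_deriv ?_
      rw [Complex.coe_smul]
      exact map_smul _ r _
    have h4 := intervalIntegral.integral_eq_sub_of_hasDerivAt (a := -Real.pi) (b := Real.pi)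
      (fun θ _ => h1 θ) (Continuous.intervalIntegrable (by fun_prop) _ _)
    rw [intervalIntegral.integral_smul, intervalIntegral.integral_of_le (by linarith [Real.pi_pos]),
      integral_Ioc_eq_integral_Ioo] at h4
    have h5 : e Real.pi = e (-Real.pi) := by
      simp [e, Complex.exp_neg]
    simp only [h5, sub_self, smul_eq_zero, hr', false_or] at h4
    exact h4
  rw [← integral_add_left_eq_self _ z, ← Complex.integral_comp_polarCoord_symm]
  rw [setIntegral_congr_fun (g := fun p => A p + Complex.I • B p)
    polarCoord.open_target.measurableSet ?_]
  · rw [polarCoord_target, integral_add (g := fun p => Complex.I • B p) hAi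
      (hBi.smul Complex.I), integral_smul, hA', hB']
    simp
  · rintro ⟨r, θ⟩ hp
    rw [polarCoord_target] at hp
    have hr' : (r : ℂ) ≠ 0 := by exact_mod_cast (ne_of_gt hp.1 : r ≠ 0)
    have h1 : Complex.polarCoord.symm (r, θ) = r * e θ := by
      simp [e, Complex.polarCoord_symm_apply, Complex.exp_mul_I]
    have h2 : e θ = (Real.cos θ : ℝ) • (1 : ℂ) + (Real.sin θ : ℝ) • Complex.I := by
      simp [e, Complex.exp_mul_I]
    have h3 : Complex.I * e θ = (-Real.sin θ : ℝ) • (1 : ℂ) + (Real.cos θ : ℝ) • Complex.I := by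
      rw [h2]
      simp [mul_add]
      linear_combination (Complex.sin θ) * Complex.I_mul_I
    have h4 : (e θ)⁻¹ = Real.cos θ - Real.sin θ * Complex.I := by
      simp only [e]
      rw [← Complex.exp_neg, ← neg_mul, ← Complex.ofReal_neg, Complex.exp_mul_I]
      simp [sub_eq_add_neg]
    -- The Cauchy–Riemann operator in the rotated frame `e θ`, `I * e θ`; here `e θ` has inverse
    -- equal to its conjugate.
    have h5 : ∀ D : ℂ →L[ℝ] E, r • ((z + r * e θ - z)⁻¹ • (D 1 + Complex.I • D Complex.I)) =
        D (e θ) + Complex.I • D (Complex.I * e θ) := by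
      intro D
      rw [h3, h2, map_add, map_add, map_smul, map_smul, map_smul, map_smul, ← h2, add_sub_cancel_left,
        mul_inv, h4]
      simp only [← Complex.coe_smul, smul_smul, smul_add]
      simp only [← mul_assoc, mul_inv_cancel₀ hr', one_mul]
      push_cast
      match_scalars
      · ring
      · linear_combination -(Complex.sin θ) * Complex.I_mul_I
    simp only [h1, A, B, dbar]
    exact h5 _

end CauchyPompeiu

/-! ### Additive splitting of holomorphic functions near compact products -/

section Cousin

open MeasureTheory Metric Set

variable {E : Type*} [NormedAddCommGroup E] [NormedSpace ℂ E]

/-- The operator is a derivation, and it annihilates the holomorphic factor. -/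
theorem dbar_smul {χ : ℂ → ℂ} {f : ℂ → E} {ζ : ℂ} (hχ : DifferentiableAt ℝ χ ζ)
    (hf : DifferentiableAt ℂ f ζ) : dbar (fun ζ => χ ζ • f ζ) ζ = dbar χ ζ • f ζ := by
  have h := (hχ.hasFDerivAt.smul (hf.hasFDerivAt.restrictScalars ℝ)).fderiv
  have h1 : fderiv ℂ f ζ Complex.I = Complex.I • fderiv ℂ f ζ 1 := by
    rw [← map_smul, smul_eq_mul, mul_one]
  have h2 : fderiv ℝ (fun ζ => χ ζ • f ζ) ζ = _ := h
  simp only [dbar, h2]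
  simp only [add_apply, smul_apply,
    ContinuousLinearMap.coe_restrictScalars', ContinuousLinearMap.smulRight_apply, h1, smul_eq_mul]
  match_scalars
  · linear_combination (χ ζ) * Complex.I_mul_I
  · ring

/-- Divide `S` according to which of `K₁`, `K₂` is nearer. A point of `K₁` at least as near to `K₂`
has distance zero from both, hence lies in `K₁ ∩ K₂`, which `S` avoids. -/
theorem exists_isCompact_partition {K₁ K₂ S : Set ℂ} (h₁ : IsCompact K₁) (h₂ : IsCompact K₂)
    (hS : IsCompact S) (hd : Disjoint S (K₁ ∩ K₂)) : ∃ E₁ E₂, IsCompact E₁ ∧ IsCompact E₂ ∧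
      Disjoint E₁ K₁ ∧ Disjoint E₂ K₂ ∧ E₁ ⊆ S ∧ S \ E₁ ⊆ E₂ ∧ E₂ ⊆ S := by
  have hc : ∀ A B : Set ℂ, IsCompact (S ∩ {x | infEDist x A ≤ infEDist x B}) := fun A B =>
    hS.inter_right (isClosed_le continuous_infEDist continuous_infEDist)
  have key : ∀ A B : Set ℂ, IsCompact A → IsCompact B → Disjoint S (A ∩ B) →
      Disjoint (S ∩ {x | infEDist x A ≤ infEDist x B}) B := by
    intro A B hA hB hd
    rw [disjoint_left]
    rintro x ⟨hxS, hx⟩ hxB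
    have hx' : infEDist x A ≤ infEDist x B := hx
    rw [infEDist_zero_of_mem hxB, nonpos_iff_eq_zero] at hx'
    exact disjoint_left.mp hd hxS ⟨(mem_iff_infEDist_zero_of_closed hA.isClosed).mpr hx', hxB⟩
  refine ⟨_, _, hc K₂ K₁, hc K₁ K₂, key _ _ h₂ h₁ (by rwa [inter_comm]), key _ _ h₁ h₂ hd,
    inter_subset_left, ?_, inter_subset_left⟩
  rintro x ⟨hxS, hx⟩
  exact ⟨hxS, (le_total (infEDist x K₁) (infEDist x K₂)).resolve_right fun h => hx ⟨hxS, h⟩⟩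

variable [CompleteSpace E]

/-- A function which is analytic near `(K₁ ∩ K₂) × L` is the sum of a function which is analytic
near `K₁ × L` and a function which is analytic near `K₂ × L`. -/
theorem exists_analyticOnNhd_add_fst {K₁ K₂ L : Set ℂ} (h₁ : IsCompact K₁) (h₂ : IsCompact K₂)
    (hL : IsCompact L) {V : Set (ℂ × ℂ)} (hV : IsOpen V) (hKV : (K₁ ∩ K₂) ×ˢ L ⊆ V)
    {f : ℂ × ℂ → E} (hf : AnalyticOnNhd ℂ f V) :
    ∃ N₁ N₂ M : Set ℂ, IsOpen N₁ ∧ IsOpen N₂ ∧ IsOpen M ∧ K₁ ⊆ N₁ ∧ K₂ ⊆ N₂ ∧ L ⊆ M ∧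
      (N₁ ∩ N₂) ×ˢ M ⊆ V ∧ ∃ f₁ f₂ : ℂ × ℂ → E, AnalyticOnNhd ℂ f₁ (N₁ ×ˢ M) ∧
        AnalyticOnNhd ℂ f₂ (N₂ ×ˢ M) ∧ ∀ p ∈ (N₁ ∩ N₂) ×ˢ M, f p = f₁ p + f₂ p := by
  obtain ⟨N, M, hN, hM, hKN, hLM, hNM⟩ := generalized_tube_lemma (h₁.inter h₂) hL hV hKV
  obtain ⟨C, hC, hKC, hCN⟩ := exists_compact_between (h₁.inter h₂) hN hKN
  -- A cutoff equal to `1` near `K₁ ∩ K₂` and supported in the compact `C ⊆ N`, so that `χ f`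
  -- extends by zero in the first variable.
  obtain ⟨χ', hχ1, hχ0, -⟩ := exists_contMDiffMap_one_nhds_of_subset_interior (n := 1) 𝓘(ℝ, ℂ)
    (h₁.inter h₂).isClosed hKC
  obtain ⟨N₀, hN₀, hKN₀, hχN₀⟩ := mem_nhdsSet_iff_exists.mp hχ1
  let χ : ℂ → ℂ := fun ζ => (χ' ζ : ℂ)
  have hχ : ContDiff ℝ 1 χ := Complex.ofRealCLM.contDiff.comp χ'.contMDiff.contDiff
  have hχC : ∀ ζ ∉ C, χ ζ = 0 := fun ζ h => by simp [χ, hχ0 ζ h]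
  have hχN : ∀ ζ ∈ N₀, χ ζ = 1 := fun ζ h => by
    have : χ' ζ = 1 := hχN₀ h
    simp [χ, this]
  have hβ : Continuous (dbar χ) := by
    have h := hχ.continuous_fderiv one_ne_zero
    unfold dbar
    fun_prop
  let S := C \ N₀
  have hS : IsCompact S := hC.diff hN₀
  have hβ0 : ∀ ζ ∉ S, dbar χ ζ = 0 := by
    intro ζ hζ
    have : fderiv ℝ χ ζ = 0 := by
      by_cases h : ζ ∈ N₀
      · have : χ =ᶠ[𝓝 ζ] fun _ => 1 := by
          filter_upwards [hN₀.mem_nhds h] with x hx using hχN x hx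
        rw [this.fderiv_eq, fderiv_const_apply]
      · have : χ =ᶠ[𝓝 ζ] fun _ => 0 := by
          filter_upwards [hC.isClosed.isOpen_compl.mem_nhds fun h' => hζ ⟨h', h⟩] with x hx
          exact hχC x hx
        rw [this.fderiv_eq, fderiv_const_apply]
    simp [dbar, this]
  obtain ⟨E₁, E₂, hE₁, hE₂, hd₁, hd₂, hE₁S, hSE, hE₂S⟩ := exists_isCompact_partition h₁ h₂ hS
    (disjoint_left.mpr fun x hx hx' => hx.2 (hKN₀ hx'))
  -- Outside `N₀` the compact sets are disjoint. Separating them there forces the overlap of the two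
  -- new neighborhoods into `N₀` minus `S`, where `χ = 1` and the kernel is not singular.
  obtain ⟨P₁, P₂, hP₁, hP₂, hKP₁, hKP₂, hP⟩ := SeparatedNhds.of_isCompact_isCompact
    (h₁.diff hN₀) (h₂.diff hN₀) (disjoint_left.mpr fun x hx hx' => hx.2 (hKN₀ ⟨hx.1, hx'.1⟩))
  have hN12 : (P₁ ∪ N₀) ∩ E₁ᶜ ∩ ((P₂ ∪ N₀) ∩ E₂ᶜ) ⊆ N₀ ∩ Sᶜ := by
    rintro x ⟨⟨hx1, hx2⟩, hx3, hx4⟩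
    refine ⟨?_, fun hS => hx4 (hSE ⟨hS, hx2⟩)⟩
    rcases hx1 with hx1 | hx1
    · exact hx3.resolve_left fun hx3 => disjoint_left.mp hP hx1 hx3
    · exact hx1
  have hV' : ∀ A ⊆ S, ∀ p ∈ Aᶜ ×ˢ M, ∀ t ∈ A, id t ≠ p.1 ∧ (id t, p.2) ∈ V := fun A hA p hp t ht =>
    ⟨fun h => hp.1 (h ▸ ht), hNM ⟨hCN (hA ht).1, hp.2⟩⟩
  have hk : (2 * Real.pi : ℂ) ≠ 0 := by simp [Real.pi_ne_zero]
  refine ⟨(P₁ ∪ N₀) ∩ E₁ᶜ, (P₂ ∪ N₀) ∩ E₂ᶜ, M, (hP₁.union hN₀).inter hE₁.isClosed.isOpen_compl,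
    (hP₂.union hN₀).inter hE₂.isClosed.isOpen_compl, hM, ?_, ?_, hLM, ?_,
    -- Represent `χ f` by the Cauchy–Pompeiu integral and distribute the support of `dbar χ`: the
    -- integral over `E₁` is holomorphic off `E₁`, hence near `K₁`, and the other one near `K₂`. The
    -- constant is `1 / (2π)` since `dbar` is twice `∂/∂z̄`.
    fun p => (-(2 * Real.pi : ℂ)⁻¹) • ∫ t in E₁, dbar χ t • (id t - p.1)⁻¹ • f (id t, p.2),
    fun p => (-(2 * Real.pi : ℂ)⁻¹) • ∫ t in S \ E₁, dbar χ t • (id t - p.1)⁻¹ • f (id t, p.2),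
    ?_, ?_, ?_⟩
  · exact fun x hx => ⟨by_cases (fun h : x ∈ N₀ => Or.inr h) fun h => Or.inl (hKP₁ ⟨hx, h⟩),
      disjoint_right.mp hd₁ hx⟩
  · exact fun x hx => ⟨by_cases (fun h : x ∈ N₀ => Or.inr h) fun h => Or.inl (hKP₂ ⟨hx, h⟩),
      disjoint_right.mp hd₂ hx⟩
  · rintro ⟨z, w⟩ ⟨hz, hw⟩
    by_cases hzN : z ∈ N
    · exact hNM ⟨hzN, hw⟩
    · have h0 := hχN z (hN12 hz).1
      rw [hχC z fun h => hzN (hCN h)] at h0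
      exact absurd h0 zero_ne_one
  · refine AnalyticOnNhd.mono ?_ (prod_mono inter_subset_right subset_rfl)
    exact (analyticOnNhd_integral_cauchy_kernel hE₁ hE₁.measurableSet subset_rfl
      (hE₁.isClosed.isOpen_compl.prod hM) hf continuousOn_id continuousOn_id hβ.continuousOn
      (hV' _ hE₁S)).const_smul
  · refine AnalyticOnNhd.mono ?_ (prod_mono inter_subset_right subset_rfl)
    exact (analyticOnNhd_integral_cauchy_kernel hE₂ (hS.measurableSet.diff hE₁.measurableSet) hSE
      (hE₂.isClosed.isOpen_compl.prod hM) hf continuousOn_id continuousOn_id hβ.continuousOn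
      (hV' _ hE₂S)).const_smul
  · rintro ⟨z, w⟩ ⟨hz, hw⟩
    obtain ⟨hzN, hzS⟩ := hN12 hz
    have hslice : ∀ t ∈ N, DifferentiableAt ℂ (fun t => f (t, w)) t := fun t ht =>
      ((hf (t, w) (hNM ⟨ht, hw⟩)).differentiableAt).comp t
        (by fun_prop : DifferentiableAt ℂ (fun t => (t, w)) t)
    have hcont : ContinuousOn (fun t => dbar χ t • (id t - z)⁻¹ • f (id t, w)) S := by
      refine hβ.continuousOn.smul (ContinuousOn.smul (ContinuousOn.inv₀ (by fun_prop) ?_) ?_)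
      · exact fun t ht h => hzS (by rwa [← sub_eq_zero.mp h])
      · exact fun t ht => (hslice t (hCN ht.1)).continuousAt.continuousWithinAt
    have hint := hcont.integrableOn_compact hS (μ := volume)
    have hφ : ContDiff ℝ 1 fun t => χ t • f (t, w) := by
      rw [contDiff_iff_contDiffAt]
      intro t
      by_cases ht : t ∈ N
      · refine hχ.contDiffAt.smul ?_
        exact ((hf (t, w) (hNM ⟨ht, hw⟩)).fun_comp (f := fun t => (t, w))
          (by fun_prop)).contDiffAt.restrict_scalars ℝ
      · refine (contDiffAt_const (c := (0 : E))).congr_of_eventuallyEq ?_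
        filter_upwards [hC.isClosed.isOpen_compl.mem_nhds fun h' => ht (hCN h')] with x hx
        simp [hχC x hx]
    have hφc : HasCompactSupport fun t => χ t • f (t, w) :=
      HasCompactSupport.intro hC fun t ht => by simp [hχC t ht]
    have key := integral_cauchy_kernel_dbar hφ hφc z
    have h2 : ∀ t, (t - z)⁻¹ • dbar (fun t => χ t • f (t, w)) t =
        dbar χ t • (id t - z)⁻¹ • f (id t, w) := by
      intro t
      by_cases ht : t ∈ N
      · rw [dbar_smul (hχ.differentiable one_ne_zero _) (hslice t ht), smul_comm]
        rfl
      · have h3 : (fun t => χ t • f (t, w)) =ᶠ[𝓝 t] fun _ => 0 := by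
          filter_upwards [hC.isClosed.isOpen_compl.mem_nhds fun h' => ht (hCN h')] with x hx
          simp [hχC x hx]
        rw [hβ0 t fun h => ht (hCN h.1), dbar, h3.fderiv_eq, fderiv_const_apply]
        simp
    simp only [h2] at key
    rw [← setIntegral_eq_integral_of_forall_compl_eq_zero (s := S)
      fun t ht => by rw [hβ0 t ht, zero_smul], ← union_sdiff_cancel hE₁S,
      setIntegral_union disjoint_sdiff_right (hS.measurableSet.diff hE₁.measurableSet)
      (hint.mono_set hE₁S) (hint.mono_set sdiff_subset), hχN z hzN, one_smul] at key
    change _ = _ • _ + _ • _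
    rw [← smul_add, key, smul_smul, neg_mul_neg, inv_mul_cancel₀ hk, one_smul]

theorem exists_analyticOnNhd_add_snd {K₁ K₂ L : Set ℂ} (h₁ : IsCompact K₁) (h₂ : IsCompact K₂)
    (hL : IsCompact L) {V : Set (ℂ × ℂ)} (hV : IsOpen V) (hKV : L ×ˢ (K₁ ∩ K₂) ⊆ V)
    {f : ℂ × ℂ → E} (hf : AnalyticOnNhd ℂ f V) :
    ∃ N₁ N₂ M : Set ℂ, IsOpen N₁ ∧ IsOpen N₂ ∧ IsOpen M ∧ K₁ ⊆ N₁ ∧ K₂ ⊆ N₂ ∧ L ⊆ M ∧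
      M ×ˢ (N₁ ∩ N₂) ⊆ V ∧ ∃ f₁ f₂ : ℂ × ℂ → E, AnalyticOnNhd ℂ f₁ (M ×ˢ N₁) ∧
        AnalyticOnNhd ℂ f₂ (M ×ˢ N₂) ∧ ∀ p ∈ M ×ˢ (N₁ ∩ N₂), f p = f₁ p + f₂ p := by
  have hs : ∀ (g : ℂ × ℂ → E) (W : Set (ℂ × ℂ)), AnalyticOnNhd ℂ g W →
      AnalyticOnNhd ℂ (g ∘ Prod.swap) (Prod.swap ⁻¹' W) := fun g W hg p hp =>
    AnalyticAt.comp (g := g) (f := Prod.swap) (hg _ hp) (AnalyticAt.prod analyticAt_snd analyticAt_fst)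
  obtain ⟨N₁, N₂, M, hN₁, hN₂, hM, hK₁, hK₂, hLM, hsub, f₁, f₂, hf₁, hf₂, hadd⟩ :=
    exists_analyticOnNhd_add_fst h₁ h₂ hL (hV.preimage continuous_swap)
      (fun p hp => hKV ⟨hp.2, hp.1⟩) (hs f V hf)
  exact ⟨N₁, N₂, M, hN₁, hN₂, hM, hK₁, hK₂, hLM, fun p hp => hsub (a := p.swap) ⟨hp.2, hp.1⟩,
    f₁ ∘ Prod.swap, f₂ ∘ Prod.swap, (hs f₁ _ hf₁).mono fun p hp => ⟨hp.2, hp.1⟩,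
    (hs f₂ _ hf₂).mono fun p hp => ⟨hp.2, hp.1⟩, fun p hp => hadd p.swap ⟨hp.2, hp.1⟩⟩

end Cousin

/-! ### Laurent splitting in one of two variables -/

section Laurent

open MeasureTheory Metric Set

variable {E : Type*} [NormedAddCommGroup E] [NormedSpace ℂ E]

/-- The Cauchy integral of `f` in the first variable. -/
noncomputable def cauchyFst (ρ : ℝ) (f : ℂ × ℂ → E) (p : ℂ × ℂ) : E :=
  (2 * Real.pi * Complex.I : ℂ)⁻¹ • ∮ ζ in C(0, ρ), (ζ - p.1)⁻¹ • f (ζ, p.2)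

/-- The Cauchy integral of `f` in the first variable, outside of the circle, in terms of the inverse
of the first variable. -/
noncomputable def cauchyFstInv (ρ : ℝ) (f : ℂ × ℂ → E) (p : ℂ × ℂ) : E :=
  p.1 • (2 * Real.pi * Complex.I : ℂ)⁻¹ • ∮ ζ in C(0, ρ), ζ⁻¹ • (ζ⁻¹ - p.1)⁻¹ • f (ζ, p.2)

/-- From `z⁻¹ ζ⁻¹ (ζ⁻¹ - z⁻¹)⁻¹ = -(ζ - z)⁻¹`. It lets the principal part be continued to a function
of `u = z⁻¹` that is regular at `u = 0`. -/
theorem cauchyFstInv_inv {ρ : ℝ} (hρ : 0 < ρ) (f : ℂ × ℂ → E) {z : ℂ} (hz : z ≠ 0) (hzρ : ‖z‖ ≠ ρ)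
    (w : ℂ) : cauchyFstInv ρ f (z⁻¹, w) = -cauchyFst ρ f (z, w) := by
  rw [cauchyFstInv, cauchyFst, smul_comm, ← smul_neg, ← neg_one_smul ℂ (∮ ζ in C(0, ρ), _)]
  congr 1
  rw [← circleIntegral.integral_smul, ← circleIntegral.integral_smul]
  refine circleIntegral.integral_congr hρ.le fun ζ hζ => ?_
  have hζ' : ‖ζ‖ = ρ := by simpa using hζ
  have h0 : ζ ≠ 0 := norm_pos_iff.mp (hζ' ▸ hρ)
  have h1 : ζ - z ≠ 0 := fun h => hzρ (by rw [← sub_eq_zero.mp h, hζ'])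
  simp only [smul_smul]
  congr 1
  have h2 : ζ⁻¹ - z⁻¹ = (z - ζ) / (ζ * z) := by field_simp
  have h3 : z - ζ ≠ 0 := fun h => h1 (by rw [← neg_sub, h, neg_zero])
  rw [h2]
  field_simp
  ring

variable [CompleteSpace E]

theorem analyticOnNhd_cauchyFst {ρ : ℝ} {D W Ω : Set ℂ} {f : ℂ × ℂ → E} (hρ : 0 < ρ)
    (hf : AnalyticOnNhd ℂ f (D ×ˢ W)) (hD : sphere 0 ρ ⊆ D) (hW : IsOpen W) (hΩ : IsOpen Ω)
    (hΩρ : ∀ z ∈ Ω, ‖z‖ ≠ ρ) : AnalyticOnNhd ℂ (cauchyFst ρ f) (Ω ×ˢ W) := by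
  have h := analyticOnNhd_integral_cauchy_kernel (μ := volume) (T := ℝ) (K := Icc 0 (2 * Real.pi))
    (K' := Ioc 0 (2 * Real.pi)) isCompact_Icc measurableSet_Ioc Ioc_subset_Icc_self
    (hΩ.prod hW) hf (a := circleMap 0 ρ) (b := circleMap 0 ρ) (c := deriv (circleMap 0 ρ))
    (continuous_circleMap 0 ρ).continuousOn (continuous_circleMap 0 ρ).continuousOn
    (by rw [funext (deriv_circleMap 0 ρ)]; fun_prop) ?_
  · have e : cauchyFst ρ f = fun p => (2 * Real.pi * Complex.I : ℂ)⁻¹ •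
        ∫ t in Ioc 0 (2 * Real.pi), deriv (circleMap 0 ρ) t • (circleMap 0 ρ t - p.1)⁻¹ •
          f (circleMap 0 ρ t, p.2) := by
      funext p
      rw [cauchyFst, circleIntegral, intervalIntegral.integral_of_le Real.two_pi_pos.le]
    rw [e]
    exact h.const_smul
  · refine fun p hp t _ => ⟨fun h => hΩρ _ hp.1 ?_, hD (circleMap_mem_sphere _ hρ.le _), hp.2⟩
    rw [← h]
    simpa using circleMap_mem_sphere 0 hρ.le t

theorem analyticOnNhd_cauchyFstInv {ρ : ℝ} {D W : Set ℂ} {f : ℂ × ℂ → E} (hρ : 0 < ρ)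
    (hf : AnalyticOnNhd ℂ f (D ×ˢ W)) (hD : sphere 0 ρ ⊆ D) (hW : IsOpen W) :
    AnalyticOnNhd ℂ (cauchyFstInv ρ f) (ball 0 ρ⁻¹ ×ˢ W) := by
  have hc : ∀ t, ‖circleMap 0 ρ t‖ = ρ := fun t => by simpa using circleMap_mem_sphere 0 hρ.le t
  have hc0 : ∀ t, circleMap 0 ρ t ≠ 0 := fun t => norm_pos_iff.mp ((hc t).symm ▸ hρ)
  have h := analyticOnNhd_integral_cauchy_kernel (μ := volume) (T := ℝ) (K := Icc 0 (2 * Real.pi))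
    (K' := Ioc 0 (2 * Real.pi)) isCompact_Icc measurableSet_Ioc Ioc_subset_Icc_self
    (isOpen_ball.prod hW : IsOpen (ball (0 : ℂ) ρ⁻¹ ×ˢ W)) hf (a := fun t => (circleMap 0 ρ t)⁻¹)
    (b := circleMap 0 ρ)
    (c := fun t => deriv (circleMap 0 ρ) t * (circleMap 0 ρ t)⁻¹)
    ((continuous_circleMap 0 ρ).inv₀ hc0).continuousOn (continuous_circleMap 0 ρ).continuousOn
    (by
      simp only [deriv_circleMap]
      exact (Continuous.mul (by fun_prop) ((continuous_circleMap 0 ρ).inv₀ hc0)).continuousOn) ?_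
  · have e : cauchyFstInv ρ f = fun p => p.1 • (2 * Real.pi * Complex.I : ℂ)⁻¹ •
        ∫ t in Ioc 0 (2 * Real.pi), (deriv (circleMap 0 ρ) t * (circleMap 0 ρ t)⁻¹) •
          ((circleMap 0 ρ t)⁻¹ - p.1)⁻¹ • f (circleMap 0 ρ t, p.2) := by
      funext p
      rw [cauchyFstInv, circleIntegral, intervalIntegral.integral_of_le Real.two_pi_pos.le]
      simp only [mul_smul]
    rw [e]
    exact (analyticOnNhd_fst).smul h.const_smul
  · refine fun p hp t _ => ⟨fun h => ?_, hD (circleMap_mem_sphere _ hρ.le _), hp.2⟩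
    have h1 := mem_ball_zero_iff.mp hp.1
    rw [← h, norm_inv, hc] at h1
    exact lt_irrefl _ h1

/-- The Cauchy integral formula for an annulus. -/
theorem cauchyFst_sub_cauchyFst {ρ ρ' : ℝ} (hρ : 0 < ρ) {D W : Set ℂ}
    {f : ℂ × ℂ → E} (hf : AnalyticOnNhd ℂ f (D ×ˢ W)) (hD : closedBall 0 ρ' \ ball 0 ρ ⊆ D)
    {z w : ℂ} (hw : w ∈ W) (hz : ρ < ‖z‖) (hz' : ‖z‖ < ρ') :
    cauchyFst ρ' f (z, w) - cauchyFst ρ f (z, w) = f (z, w) := by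
  have hg : ∀ ζ ∈ closedBall 0 ρ' \ ball 0 ρ, DifferentiableAt ℂ (fun ζ => f (ζ, w)) ζ :=
    fun ζ hζ => ((hf (ζ, w) ⟨hD hζ, hw⟩).differentiableAt).comp ζ
        (by fun_prop : DifferentiableAt ℂ (fun t => (t, w)) ζ)
  set g : ℂ → E := fun ζ => f (ζ, w) with hgdef
  have hzA : z ∈ closedBall 0 ρ' \ ball 0 ρ := ⟨by simpa using hz'.le, by simpa using hz.le⟩
  have hnhds : closedBall (0 : ℂ) ρ' \ ball 0 ρ ∈ 𝓝 z :=
    Filter.mem_of_superset ((isOpen_ball.sdiff isClosed_closedBall).mem_nhds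
      (⟨by simpa using hz', by simpa using hz⟩ : z ∈ ball 0 ρ' \ closedBall 0 ρ))
      (sdiff_subset_sdiff ball_subset_closedBall ball_subset_closedBall)
  have hcont : ContinuousOn g (closedBall 0 ρ' \ ball 0 ρ) :=
    fun ζ hζ => (hg ζ hζ).continuousAt.continuousWithinAt
  -- The difference quotient of `g` at `z` is continuous on the annulus and holomorphic away from
  -- `z`, so its integrals over both circles agree. Expanding it, `∮ (ζ - z)⁻¹` is `2πi` on the
  -- outer circle and `0` on the inner one.
  have key := Complex.circleIntegral_eq_of_differentiable_on_annulus_off_countable (c := 0) hρ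
    (hz.trans hz').le (f := dslope g z) (countable_singleton z)
    ((continuousOn_dslope hnhds).mpr ⟨hcont, hg z hzA⟩)
    (fun ζ hζ => (differentiableAt_dslope_of_ne (fun h => hζ.2 h)).mpr
      (hg ζ ⟨ball_subset_closedBall hζ.1.1, fun h => hζ.1.2 (ball_subset_closedBall h)⟩))
  have hsph : ∀ r, (r = ρ ∨ r = ρ') → sphere 0 r ⊆ closedBall (0 : ℂ) ρ' \ ball 0 ρ := by
    rintro r (rfl | rfl) x hx
    · exact ⟨by simpa using (mem_sphere_zero_iff_norm.mp hx).le.trans (hz.trans hz').le,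
        by simpa using (mem_sphere_zero_iff_norm.mp hx).ge⟩
    · exact ⟨sphere_subset_closedBall hx,
        by simpa using (hz.trans hz').le.trans (mem_sphere_zero_iff_norm.mp hx).ge⟩
  have hds : ∀ r, (r = ρ ∨ r = ρ') → (∮ ζ in C(0, r), dslope g z ζ) =
      (∮ ζ in C(0, r), (ζ - z)⁻¹ • g ζ) - (∮ ζ in C(0, r), (ζ - z)⁻¹) • g z := by
    intro r hr
    have hr0 : 0 < r := by rcases hr with rfl | rfl; exacts [hρ, hρ.trans (hz.trans hz')]
    have hne : ∀ ζ ∈ sphere (0 : ℂ) r, ζ - z ≠ 0 := by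
      intro ζ hζ h
      rw [sub_eq_zero.mp h, mem_sphere_zero_iff_norm] at hζ
      rcases hr with rfl | rfl <;> linarith
    have hc1 : ContinuousOn (fun ζ : ℂ => (ζ - z)⁻¹) (sphere 0 r) :=
      ContinuousOn.inv₀ (by fun_prop) hne
    rw [← circleIntegral.integral_smul_const, ← circleIntegral.integral_sub]
    · refine circleIntegral.integral_congr hr0.le fun ζ hζ => ?_
      rw [dslope_of_ne _ (sub_ne_zero.mp (hne ζ hζ)), slope, vsub_eq_sub, smul_sub]
    · exact (hc1.smul (hcont.mono (hsph r hr))).circleIntegrable hr0.le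
    · exact (hc1.smul continuousOn_const).circleIntegrable hr0.le
  rw [hds _ (Or.inl rfl), hds _ (Or.inr rfl),
    circleIntegral.integral_sub_inv_of_mem_ball (by simpa using hz')] at key
  have h0 : (∮ ζ in C(0, ρ), (ζ - z)⁻¹) = 0 := by
    refine Complex.circleIntegral_eq_zero_of_differentiable_on_off_countable hρ.le countable_empty
      (ContinuousOn.inv₀ (by fun_prop) ?_) ?_
    · intro x hx h
      rw [← sub_eq_zero.mp h] at hz
      exact absurd hz (not_lt.mpr (by simpa using hx))
    · intro x hx
      refine DifferentiableAt.inv (by fun_prop) fun h => ?_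
      rw [← sub_eq_zero.mp h] at hz
      exact absurd hz (not_lt.mpr (by simpa using (ball_subset_closedBall hx.1)))
  have hk : (2 * Real.pi * Complex.I : ℂ) ≠ 0 := by simp [Real.pi_ne_zero]
  rw [h0, zero_smul, sub_zero, sub_eq_iff_eq_add, ← sub_eq_iff_eq_add'] at key
  simp only [cauchyFst]
  rw [← smul_sub, key, smul_smul, inv_mul_cancel₀ hk, one_smul]

/-- Laurent splitting in the first variable. -/
theorem exists_laurent_fst {ρ ρ' : ℝ} (hρ : 0 < ρ) (hρρ' : ρ < ρ') {D W : Set ℂ}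
    (hW : IsOpen W) {f : ℂ × ℂ → E} (hf : AnalyticOnNhd ℂ f (D ×ˢ W)) (hD0 : 0 ∉ D)
    (hD : closedBall 0 ρ' \ ball 0 ρ ⊆ D) : ∃ f₁ f₂ : ℂ × ℂ → E,
      AnalyticOnNhd ℂ f₁ ((D ∪ ball 0 ρ') ×ˢ W) ∧
      AnalyticOnNhd ℂ f₂ (((fun u => u⁻¹) ⁻¹' D ∪ ball 0 ρ⁻¹) ×ˢ W) ∧
      ∀ z ∈ D, ∀ w ∈ W, f (z, w) = f₁ (z, w) + f₂ (z⁻¹, w) := by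
  classical
  have hs : sphere 0 ρ ⊆ D := fun x hx => hD
    ⟨by simpa using (mem_sphere_zero_iff_norm.mp hx).le.trans hρρ'.le,
      by simpa using (mem_sphere_zero_iff_norm.mp hx).ge⟩
  have hs' : sphere 0 ρ' ⊆ D := fun x hx => hD ⟨sphere_subset_closedBall hx,
        by simpa using hρρ'.le.trans (mem_sphere_zero_iff_norm.mp hx).ge⟩
  have hC1 := analyticOnNhd_cauchyFst hρ hf hs hW (Ω := (closedBall 0 ρ)ᶜ)
    isClosed_closedBall.isOpen_compl fun z hz h => hz (by simpa using h.le)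
  have hC2 := analyticOnNhd_cauchyFst (hρ.trans hρρ') hf hs' hW (Ω := ball 0 ρ') isOpen_ball
    fun z hz h => absurd (mem_ball_zero_iff.mp hz) (by simp [h])
  have hC3 := analyticOnNhd_cauchyFstInv hρ hf hs hW
  -- `f₁` is the Cauchy integral over the outer circle, continued to the rest of `D` by `f` plus the
  -- integral over the inner one; `f₂` is minus the inner integral, continued likewise. The annulus
  -- formula makes the two expressions agree where both are defined (`e1`, `e2`).
  let f₁ : ℂ × ℂ → E := fun p => if ‖p.1‖ < ρ' then cauchyFst ρ' f p else f p + cauchyFst ρ f p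
  let f₂ : ℂ × ℂ → E := fun p => if ‖p.1‖ < ρ⁻¹ then cauchyFstInv ρ f p else
    f (p.1⁻¹, p.2) - cauchyFst ρ' f (p.1⁻¹, p.2)
  have e1 : ∀ p ∈ (closedBall 0 ρ)ᶜ ×ˢ W, f₁ p = f p + cauchyFst ρ f p := by
    rintro ⟨z, w⟩ ⟨hz, hw⟩
    by_cases h : ‖z‖ < ρ'
    · simp only [f₁, h, if_true]
      rw [← cauchyFst_sub_cauchyFst hρ hf hD hw (by simpa using hz) h, sub_add_cancel]
    · simp only [f₁, h, if_false]
  have e2 : ∀ u w, w ∈ W → u ≠ 0 → ‖u⁻¹‖ < ρ' →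
      f₂ (u, w) = f (u⁻¹, w) - cauchyFst ρ' f (u⁻¹, w) := by
    intro u w hw hu0 hu
    by_cases h : ‖u‖ < ρ⁻¹
    · have h' : ρ < ‖u⁻¹‖ := by
        rw [norm_inv]
        exact (lt_inv_comm₀ hρ (norm_pos_iff.mpr hu0)).mpr h
      simp only [f₂, h, if_true]
      have := cauchyFstInv_inv hρ f (inv_ne_zero hu0) h'.ne' w
      rw [inv_inv] at this
      rw [this, ← cauchyFst_sub_cauchyFst hρ hf hD hw h' hu]
      abel
    · simp only [f₂, h, if_false]
  refine ⟨f₁, f₂, ?_, ?_, ?_⟩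
  · rintro ⟨z, w⟩ ⟨hz, hw⟩
    by_cases h : ‖z‖ < ρ'
    · refine (hC2 (z, w) ⟨by simpa using h, hw⟩).congr ?_
      filter_upwards [(isOpen_ball.prod isOpen_univ).mem_nhds
        (⟨by simpa using h, mem_univ w⟩ : (z, w) ∈ ball (0 : ℂ) ρ' ×ˢ univ)] with p hp
      exact (if_pos (by simpa using hp.1)).symm
    · have hz' : z ∈ D := hz.resolve_right fun h' => h (by simpa using h')
      have hzρ : z ∈ (closedBall (0 : ℂ) ρ)ᶜ := by simpa using hρρ'.trans_le (not_lt.mp h)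
      refine ((hf (z, w) ⟨hz', hw⟩).add (hC1 (z, w) ⟨hzρ, hw⟩)).congr ?_
      filter_upwards [(isClosed_closedBall.isOpen_compl.prod hW).mem_nhds
        (⟨hzρ, hw⟩ : (z, w) ∈ (closedBall (0 : ℂ) ρ)ᶜ ×ˢ W)] with p hp using (e1 p hp).symm
  · rintro ⟨u, w⟩ ⟨hu, hw⟩
    by_cases h : ‖u‖ < ρ⁻¹
    · refine (hC3 (u, w) ⟨by simpa using h, hw⟩).congr ?_
      filter_upwards [(isOpen_ball.prod isOpen_univ).mem_nhds
        (⟨by simpa using h, mem_univ w⟩ : (u, w) ∈ ball (0 : ℂ) ρ⁻¹ ×ˢ univ)] with p hp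
      exact (if_pos (by simpa using hp.1)).symm
    · have hu' : u⁻¹ ∈ D := hu.resolve_right fun h' => h (by simpa using h')
      have hu0 : u ≠ 0 := fun h0 => h (by simpa [h0] using hρ)
      have hun : ‖u⁻¹‖ < ρ' := by
        rw [norm_inv]
        exact ((inv_le_comm₀ (norm_pos_iff.mpr hu0) hρ).mpr (not_lt.mp h)).trans_lt hρρ'
      have hinv : AnalyticAt ℂ (fun p : ℂ × ℂ => (p.1⁻¹, p.2)) (u, w) :=
        (analyticAt_fst.inv hu0).prod analyticAt_snd
      have h1 := AnalyticAt.comp (g := f) (f := fun p : ℂ × ℂ => (p.1⁻¹, p.2)) (x := (u, w))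
        (hf (u⁻¹, w) ⟨hu', hw⟩) hinv
      have h2 := AnalyticAt.comp (g := cauchyFst ρ' f) (f := fun p : ℂ × ℂ => (p.1⁻¹, p.2))
        (x := (u, w)) (hC2 (u⁻¹, w) ⟨by simpa using hun, hw⟩) hinv
      refine (h1.sub h2).congr ?_
      have hO : ∀ᶠ p : ℂ × ℂ in 𝓝 (u, w), p.1 ≠ 0 ∧ ‖p.1⁻¹‖ < ρ' ∧ p.2 ∈ W := by
        have c1 : ContinuousAt (fun p : ℂ × ℂ => p.1⁻¹) (u, w) := continuousAt_fst.inv₀ hu0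
        refine (continuousAt_fst.eventually_ne hu0).and ((c1.norm.eventually_lt_const hun).and ?_)
        exact continuousAt_snd.eventually (hW.mem_nhds hw)
      filter_upwards [hO] with p hp using (e2 p.1 p.2 hp.2.2 hp.1 hp.2.1).symm
  · intro z hz w hw
    have hz0 : z ≠ 0 := fun h => hD0 (h ▸ hz)
    by_cases h : ‖z‖ < ρ'
    · rw [e2 z⁻¹ w hw (inv_ne_zero hz0) (by simpa using h), inv_inv]
      simp [f₁, h]
    · have hzρ : ρ < ‖z‖ := hρρ'.trans_le (not_lt.mp h)
      rw [e1 (z, w) ⟨by simpa using hzρ, hw⟩]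
      have h2 : f₂ (z⁻¹, w) = cauchyFstInv ρ f (z⁻¹, w) := if_pos (by
        rw [norm_inv]
        exact inv_strictAnti₀ hρ hzρ)
      rw [h2, cauchyFstInv_inv hρ f hz0 hzρ.ne' w, add_neg_cancel_right]

end Laurent

/-! ### Approximation and the Mittag-Leffler argument -/

section Runge

open MeasureTheory Metric Set

variable {E : Type*} [NormedAddCommGroup E] [NormedSpace ℂ E] [CompleteSpace E]

/-- An analytic function on a bidisc is approximated by entire functions on smaller bidiscs. -/
theorem exists_entire_approx {f : ℂ × ℂ → E} {r R : ℝ} (hr : 0 < r) (hrR : r < R)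
    (hf : AnalyticOnNhd ℂ f (ball 0 R)) {ε : ℝ} (hε : 0 < ε) :
    ∃ g : ℂ × ℂ → E, AnalyticOnNhd ℂ g univ ∧ ∀ x ∈ ball (0 : ℂ × ℂ) r, ‖f x - g x‖ ≤ ε := by
  obtain ⟨s, hrs, hsR⟩ := exists_between hrR
  obtain ⟨M, hM⟩ := (isCompact_closedBall (0 : ℂ × ℂ) s).exists_bound_of_continuousOn
    (hf.continuousOn.mono (closedBall_subset_ball hsR))
  have hM0 : 0 ≤ M := (norm_nonneg _).trans (hM 0 (mem_closedBall_self (hr.trans hrs).le))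
  obtain ⟨q, hq⟩ := hf 0 (mem_ball_self (hr.trans hrR))
  set ρ : ℝ := s / r with hρdef
  have hρ : 1 < ρ := (one_lt_div hr).mpr hrs
  have hρ0 : 0 < ρ := one_pos.trans hρ
  have hbound : ∀ x ∈ ball (0 : ℂ × ℂ) r, HasSum (fun n => q n fun _ => x) (f x) ∧
      ∀ n, ‖q n fun _ => x‖ ≤ M * ρ⁻¹ ^ n := by
    intro x hx
    -- On the complex line through `x` the Taylor terms of `f` become those of a function of one
    -- variable on the disc of radius `ρ = s / r > 1`. Cauchy's estimates there bound them by `M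
    -- ρ⁻ⁿ`, uniformly in `x`.
    let u : ℂ →L[ℂ] ℂ × ℂ := ContinuousLinearMap.toSpanSingleton ℂ x
    have hu : ∀ t, u t = t • x := fun t => by simp [u]
    have hmaps : ∀ t ∈ closedBall (0 : ℂ) ρ, u t ∈ closedBall (0 : ℂ × ℂ) s := by
      intro t ht
      rw [mem_closedBall_zero_iff] at ht ⊢
      rw [hu, norm_smul]
      calc ‖t‖ * ‖x‖ ≤ ρ * r := mul_le_mul ht (mem_ball_zero_iff.mp hx).le (norm_nonneg _) hρ0.le
        _ = s := div_mul_cancel₀ s hr.ne'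
    have hg : DifferentiableOn ℂ (f ∘ u) (closedBall 0 ρ) := fun t ht =>
      (((hf _ (closedBall_subset_ball hsR (hmaps t ht))).differentiableAt).comp t
        u.differentiableAt).differentiableWithinAt
    lift ρ to NNReal using hρ0.le with ρ'
    have h1 := hg.hasFPowerSeriesOnBall (by exact_mod_cast hρ0)
    have h2 : HasFPowerSeriesAt (f ∘ u) (q.compContinuousLinearMap u) 0 :=
      HasFPowerSeriesAt.compContinuousLinearMap (by rwa [map_zero])
    have h3 := h1.hasFPowerSeriesAt.eq_formalMultilinearSeries h2
    have h4 : ∀ n, cauchyPowerSeries (f ∘ u) 0 ρ' n (fun _ => 1) = q n fun _ => x := by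
      intro n
      rw [h3, FormalMultilinearSeries.compContinuousLinearMap_apply]
      congr 1
      ext i : 1
      simp [hu]
    constructor
    · have h5 := h1.hasSum (y := 1) (by
        rw [eball_coe, mem_ball_zero_iff, norm_one]
        exact hρ)
      simp only [h4, zero_add] at h5
      simpa [hu] using h5
    · intro n
      rw [← h4]
      refine (ContinuousMultilinearMap.le_opNorm _ _).trans ?_
      simp only [norm_one, Finset.prod_const_one, mul_one]
      refine (norm_cauchyPowerSeries_le _ _ _ _).trans ?_
      rw [abs_of_pos hρ0]
      refine mul_le_mul_of_nonneg_right ?_ (by positivity)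
      have h6 : ∫ θ in (0 : ℝ)..2 * Real.pi, ‖(f ∘ u) (circleMap 0 ρ' θ)‖ ≤ M * (2 * Real.pi) := by
        refine (le_abs_self _).trans ?_
        rw [← Real.norm_eq_abs]
        refine (intervalIntegral.norm_integral_le_of_norm_le_const (C := M) fun θ _ => ?_).trans ?_
        · rw [norm_norm]
          exact hM _ (hmaps _ (circleMap_mem_closedBall _ hρ0.le _))
        · rw [sub_zero, abs_of_pos Real.two_pi_pos]
      calc (2 * Real.pi)⁻¹ * _ ≤ (2 * Real.pi)⁻¹ * (M * (2 * Real.pi)) :=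
            mul_le_mul_of_nonneg_left h6 (by positivity)
        _ = M := by field_simp
  have hρ1 : ρ⁻¹ < 1 := inv_lt_one_of_one_lt₀ hρ
  obtain ⟨N, hN⟩ : ∃ N : ℕ, M * ρ⁻¹ ^ N / (1 - ρ⁻¹) ≤ ε := by
    have h : Filter.Tendsto (fun N : ℕ => M * ρ⁻¹ ^ N / (1 - ρ⁻¹)) Filter.atTop (𝓝 (M * 0 / (1 - ρ⁻¹))) :=
      ((tendsto_pow_atTop_nhds_zero_of_lt_one (by positivity) hρ1).const_mul M).div_const _
    rw [mul_zero, zero_div] at h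
    exact (h.eventually (ge_mem_nhds hε)).exists
  -- The approximant is a Taylor polynomial.
  refine ⟨fun x => ∑ n ∈ Finset.range N, q n fun _ => x, ?_, fun x hx => ?_⟩
  · refine DifferentiableOn.analyticOnNhd_prod isOpen_univ (Differentiable.differentiableOn ?_)
    refine Differentiable.fun_sum fun n _ => ?_
    exact ((q n).contDiff (n := 1)).differentiable one_ne_zero |>.comp
      (differentiable_pi.mpr fun _ => differentiable_id)
  · obtain ⟨h1, h2⟩ := hbound x hx
    rw [norm_sub_rev]
    exact (norm_sub_le_of_geometric_bound_of_hasSum hρ1 h2 h1 N).trans hN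

/-- The Mittag-Leffler property of an exhaustion: sequences of analytic functions on its members
are telescoping. -/
def MittagLeffler (E : Type*) [NormedAddCommGroup E] [NormedSpace ℂ E]
    (W : ℕ → Set (ℂ × ℂ)) : Prop :=
  ∀ f : ℕ → ℂ × ℂ → E, (∀ n, AnalyticOnNhd ℂ (f n) (W (n + 1))) →
    ∃ h : ℕ → ℂ × ℂ → E, (∀ n, AnalyticOnNhd ℂ (h n) (W n)) ∧
      ∀ n, ∀ x ∈ W n, h n x - h (n + 1) x = f n x

/-- Subtract from `f k` an entire `g k` within `2⁻ᵏ` of it. The tail `∑_{k ≥ n} (f k - g k)`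
converges to an analytic function on the `n`-th ball and telescopes to `f n - g n`; the finite sum
`∑_{k < n} g k` of entire functions restores `g n`. -/
theorem mittagLeffler_ball : MittagLeffler E fun n => ball (0 : ℂ) (n + 1) ×ˢ ball (0 : ℂ) (n + 1) := by
  intro f hf
  simp only [ball_prod_same, Prod.mk_zero_zero] at hf ⊢
  have happ : ∀ n : ℕ, ∃ g : ℂ × ℂ → E, AnalyticOnNhd ℂ g univ ∧
      ∀ x ∈ ball (0 : ℂ × ℂ) (n + 1), ‖f n x - g x‖ ≤ (1 / 2) ^ n := fun n =>
    exists_entire_approx (by positivity) (by push_cast; linarith) (hf n) (by positivity)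
  choose g hg hfg using happ
  have hsum : Summable fun n : ℕ => ((1 : ℝ) / 2) ^ n := summable_geometric_two
  have hb : ∀ n k : ℕ, ∀ x ∈ ball (0 : ℂ × ℂ) (n + 1),
      ‖f (n + k) x - g (n + k) x‖ ≤ (1 / 2) ^ k := fun n k x hx =>
    (hfg (n + k) x (ball_subset_ball (by push_cast; linarith [(Nat.cast_nonneg k : (0 : ℝ) ≤ k)]) hx)).trans
      (pow_le_pow_of_le_one (by norm_num) (by norm_num) (Nat.le_add_left k n))
  refine ⟨fun n x => ∑' k, (f (n + k) x - g (n + k) x) - ∑ k ∈ Finset.range n, g k x,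
    fun n => ?_, fun n x hx => ?_⟩
  · refine AnalyticOnNhd.sub (analyticOnNhd_tsum isOpen_ball hsum (fun k => ?_) (hb n)) ?_
    · refine ((hf (n + k)).mono (ball_subset_ball ?_)).sub ((hg _).mono (subset_univ _))
      push_cast
      linarith [(Nat.cast_nonneg k : (0 : ℝ) ≤ k)]
    · exact Finset.analyticOnNhd_fun_sum _ fun k _ => (hg k).mono (subset_univ _)
  · have hs : Summable fun k => f (n + k) x - g (n + k) x :=
      Summable.of_norm_bounded hsum fun k => hb n k x hx
    beta_reduce
    rw [hs.tsum_eq_zero_add, Finset.sum_range_succ]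
    simp only [add_zero, Nat.add_assoc, Nat.add_comm 1]
    abel

theorem MittagLeffler.comp_swap {X Y : ℕ → Set ℂ} (h : MittagLeffler E fun n => X n ×ˢ Y n) :
    MittagLeffler E fun n => Y n ×ˢ X n := by
  have hs : ∀ (g : ℂ × ℂ → E) (A B : Set ℂ), AnalyticOnNhd ℂ g (A ×ˢ B) →
      AnalyticOnNhd ℂ (g ∘ Prod.swap) (B ×ˢ A) := fun g A B hg p hp =>
    AnalyticAt.comp (g := g) (f := Prod.swap) (hg _ ⟨hp.2, hp.1⟩)
      (AnalyticAt.prod analyticAt_snd analyticAt_fst)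
  intro f hf
  obtain ⟨g, hg, hgf⟩ := h (fun n => f n ∘ Prod.swap) fun n => hs _ _ _ (hf n)
  exact ⟨fun n => g n ∘ Prod.swap, fun n => hs _ _ _ (hg n),
    fun n x hx => hgf n x.swap ⟨hx.2, hx.1⟩⟩

/-- The annuli `{n⁻¹ < |z| < n}`. -/
def openAnnulus (R : ℝ) : Set ℂ := {z | z ≠ 0 ∧ z ∈ ball 0 R ∧ z⁻¹ ∈ ball 0 R}

/-- Laurent splitting writes each `f n` as a function of `(z, w)` plus a function of `(z⁻¹, w)`,
both on discs in the first variable. The problem is solved for each separately and the solutions are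
added. -/
theorem MittagLeffler.annulus {Y : ℕ → Set ℂ} (hY : ∀ n, IsOpen (Y n))
    (hYm : ∀ n, Y n ⊆ Y (n + 1))
    (h : MittagLeffler E fun n : ℕ => ball (0 : ℂ) (n + 1) ×ˢ Y n) :
    MittagLeffler E fun n : ℕ => openAnnulus (n + 1) ×ˢ Y n := by
  intro f hf
  have hf' : ∀ n, ∃ f₁ f₂ : ℂ × ℂ → E, AnalyticOnNhd ℂ f₁ (ball 0 ((n + 1 : ℕ) + 1) ×ˢ Y (n + 1)) ∧
      AnalyticOnNhd ℂ f₂ (ball 0 ((n + 1 : ℕ) + 1) ×ˢ Y (n + 1)) ∧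
      ∀ z ∈ openAnnulus ((n + 1 : ℕ) + 1), ∀ w ∈ Y (n + 1),
        f n (z, w) = f₁ (z, w) + f₂ (z⁻¹, w) := by
    intro n
    have hn : (2 : ℝ) ≤ (n + 1 : ℕ) + 1 := by
      push_cast
      linarith [(Nat.cast_nonneg n : (0 : ℝ) ≤ n)]
    -- The radii `1` and `3 / 2` work for every `n`, since the annulus in question contains `1 / 2 <
    -- |z| < 2`.
    obtain ⟨f₁, f₂, h₁, h₂, h₃⟩ := exists_laurent_fst one_pos (by norm_num : (1 : ℝ) < 3 / 2)
      (hY (n + 1)) (hf n) (fun h => h.1 rfl) (by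
        rintro z ⟨hz, hz'⟩
        have hz1 : ‖z‖ ≤ 3 / 2 := by simpa using hz
        have hz2 : 1 ≤ ‖z‖ := by simpa using hz'
        refine ⟨norm_pos_iff.mp (one_pos.trans_le hz2), ?_, ?_⟩
        · rw [mem_ball_zero_iff]
          linarith
        · rw [mem_ball_zero_iff, norm_inv]
          have := inv_le_one_of_one_le₀ hz2
          linarith)
    refine ⟨f₁, f₂, h₁.mono (prod_mono ?_ subset_rfl), h₂.mono (prod_mono ?_ subset_rfl), h₃⟩
    · intro z hz
      by_cases hz' : ‖z‖ < 3 / 2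
      · exact Or.inr (by simpa using hz')
      · have hz2 : 1 ≤ ‖z‖ := by linarith
        refine Or.inl ⟨norm_pos_iff.mp (one_pos.trans_le hz2), hz, ?_⟩
        rw [mem_ball_zero_iff, norm_inv]
        have := inv_le_one_of_one_le₀ hz2
        linarith
    · intro z hz
      by_cases hz' : ‖z‖ < 1
      · exact Or.inr (by simpa using hz')
      · have hz2 : 1 ≤ ‖z‖ := by linarith
        refine Or.inl ⟨inv_ne_zero (norm_pos_iff.mp (one_pos.trans_le hz2)), ?_, by rwa [inv_inv]⟩
        rw [mem_ball_zero_iff, norm_inv]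
        have := inv_le_one_of_one_le₀ hz2
        linarith
  choose f₁ f₂ h₁ h₂ h₃ using hf'
  obtain ⟨g₁, hg₁, hgf₁⟩ := h f₁ h₁
  obtain ⟨g₂, hg₂, hgf₂⟩ := h f₂ h₂
  have hsub : ∀ n : ℕ, ∀ z ∈ openAnnulus (n + 1), z ∈ openAnnulus ((n + 1 : ℕ) + 1) := by
    rintro n z ⟨hz0, hz1, hz2⟩
    have hle : (n + 1 : ℝ) ≤ (n + 1 : ℕ) + 1 := by push_cast; linarith
    exact ⟨hz0, ball_subset_ball hle hz1, ball_subset_ball hle hz2⟩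
  refine ⟨fun n x => g₁ n x + g₂ n (x.1⁻¹, x.2), fun n x hx => ?_, fun n x hx => ?_⟩
  · refine (hg₁ n x ⟨hx.1.2.1, hx.2⟩).add ?_
    exact AnalyticAt.comp (g := g₂ n) (f := fun p : ℂ × ℂ => (p.1⁻¹, p.2)) (x := x)
      (hg₂ n (x.1⁻¹, x.2) ⟨hx.1.2.2, hx.2⟩) ((analyticAt_fst.inv hx.1.1).prod analyticAt_snd)
  · have h4 := h₃ n x.1 (hsub n _ hx.1) x.2 (hYm n hx.2)
    rw [h4, ← hgf₁ n x ⟨hx.1.2.1, hx.2⟩, ← hgf₂ n (x.1⁻¹, x.2) ⟨hx.1.2.2, hx.2⟩]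
    exact add_sub_add_comm _ _ _ _

end Runge

/-! ## Vanishing of cohomology on products of planes and punctured planes -/

/-- An identification of a sheaf on `ℂ²` with the sheaf of holomorphic functions with values in
`E`. -/
structure HolomorphicModel (E : Type) [NormedAddCommGroup E] [NormedSpace ℂ E]
    (F : AbSections (ℂ × ℂ)) where
  /-- the section given by a holomorphic function -/
  ofFun : ∀ (V : Opens (ℂ × ℂ)) (f : ℂ × ℂ → E), AnalyticOnNhd ℂ f V → F.sec V
  exists_ofFun : ∀ V s, ∃ f hf, ofFun V f hf = s
  ofFun_add : ∀ V f g hf hg, ofFun V (fun x => f x + g x) (hf.add hg) = ofFun V f hf + ofFun V g hg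
  res_ofFun : ∀ {U V} (h : U ≤ V) f hf, F.res h (ofFun V f hf) = ofFun U f (hf.mono h)
  ofFun_congr : ∀ V f g hf hg, (∀ x ∈ V, f x = g x) → ofFun V f hf = ofFun V g hg

/-! ### Vanishing near compact products -/

section Chart

open Metric Set

/-- A property of open sets which holds locally and passes to neighborhoods of unions of compact
products which share a factor holds near all compact products. -/
theorem exists_open_of_isCompact_prod {V : Set (ℂ × ℂ)} (p : Opens (ℂ × ℂ) → Prop) (h0 : p ⊥)
    (hloc : ∀ x ∈ V, ∃ W : Opens (ℂ × ℂ), x ∈ W ∧ p W)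
    (hfst : ∀ K₁ K₂ L : Set ℂ, IsCompact K₁ → IsCompact K₂ → IsCompact L →
      ∀ W₁ W₂ : Opens (ℂ × ℂ), p W₁ → p W₂ → K₁ ×ˢ L ⊆ (W₁ : Set (ℂ × ℂ)) →
        K₂ ×ˢ L ⊆ (W₂ : Set (ℂ × ℂ)) →
        ∃ W : Opens (ℂ × ℂ), (K₁ ∪ K₂) ×ˢ L ⊆ (W : Set (ℂ × ℂ)) ∧ p W)
    (hsnd : ∀ K₁ K₂ L : Set ℂ, IsCompact K₁ → IsCompact K₂ → IsCompact L →
      ∀ W₁ W₂ : Opens (ℂ × ℂ), p W₁ → p W₂ → L ×ˢ K₁ ⊆ (W₁ : Set (ℂ × ℂ)) →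
        L ×ˢ K₂ ⊆ (W₂ : Set (ℂ × ℂ)) →
        ∃ W : Opens (ℂ × ℂ), L ×ˢ (K₁ ∪ K₂) ⊆ (W : Set (ℂ × ℂ)) ∧ p W)
    {K L : Set ℂ} (hK : IsCompact K) (hL : IsCompact L) (hV : K ×ˢ L ⊆ V) :
    ∃ W : Opens (ℂ × ℂ), K ×ˢ L ⊆ (W : Set (ℂ × ℂ)) ∧ p W := by
  have h1 : ∀ z ∈ K, ∃ W : Opens (ℂ × ℂ), {z} ×ˢ L ⊆ (W : Set (ℂ × ℂ)) ∧ p W := by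
    intro z hz
    -- Compact induction passes through arbitrary subsets of `L`, whereas gluing needs compact
    -- factors; hence the compact superset `L'` in the predicate.
    have key : ∃ L', IsCompact L' ∧ L ⊆ L' ∧
        ∃ W : Opens (ℂ × ℂ), {z} ×ˢ L' ⊆ (W : Set (ℂ × ℂ)) ∧ p W := by
      refine hL.induction_on (p := fun B => ∃ L', IsCompact L' ∧ B ⊆ L' ∧
        ∃ W : Opens (ℂ × ℂ), {z} ×ˢ L' ⊆ (W : Set (ℂ × ℂ)) ∧ p W) ?_ ?_ ?_ ?_
      · exact ⟨∅, isCompact_empty, subset_rfl, ⊥, by simp, h0⟩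
      · rintro s t hst ⟨L', hL', ht, h⟩
        exact ⟨L', hL', hst.trans ht, h⟩
      · rintro s t ⟨L₁, hL₁, hs, W₁, hW₁, hp₁⟩ ⟨L₂, hL₂, ht, W₂, hW₂, hp₂⟩
        exact ⟨L₁ ∪ L₂, hL₁.union hL₂, union_subset_union hs ht,
          hsnd L₁ L₂ {z} hL₁ hL₂ isCompact_singleton W₁ W₂ hp₁ hp₂ hW₁ hW₂⟩
      · intro w hw
        obtain ⟨W, hxW, hpW⟩ := hloc (z, w) (hV ⟨hz, hw⟩)
        have hnhds : {w' | (z, w') ∈ W} ∈ 𝓝 w :=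
          (Continuous.prodMk_right z).continuousAt.preimage_mem_nhds (W.2.mem_nhds hxW)
        obtain ⟨C, hC, hCW, hCc⟩ := local_compact_nhds hnhds
        refine ⟨C, mem_nhdsWithin_of_mem_nhds hC, C, hCc, subset_rfl, W, ?_, hpW⟩
        rintro ⟨a, b⟩ ⟨rfl, hb⟩
        exact hCW hb
    obtain ⟨L', -, hLL', W, hW, hpW⟩ := key
    exact ⟨W, (prod_mono subset_rfl hLL').trans hW, hpW⟩
  have key : ∃ K', IsCompact K' ∧ K ⊆ K' ∧
      ∃ W : Opens (ℂ × ℂ), K' ×ˢ L ⊆ (W : Set (ℂ × ℂ)) ∧ p W := by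
    refine hK.induction_on (p := fun B => ∃ K', IsCompact K' ∧ B ⊆ K' ∧
      ∃ W : Opens (ℂ × ℂ), K' ×ˢ L ⊆ (W : Set (ℂ × ℂ)) ∧ p W) ?_ ?_ ?_ ?_
    · exact ⟨∅, isCompact_empty, subset_rfl, ⊥, by simp, h0⟩
    · rintro s t hst ⟨L', hL', ht, h⟩
      exact ⟨L', hL', hst.trans ht, h⟩
    · rintro s t ⟨K₁, hK₁, hs, W₁, hW₁, hp₁⟩ ⟨K₂, hK₂, ht, W₂, hW₂, hp₂⟩
      exact ⟨K₁ ∪ K₂, hK₁.union hK₂, union_subset_union hs ht,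
        hfst K₁ K₂ L hK₁ hK₂ hL W₁ W₂ hp₁ hp₂ hW₁ hW₂⟩
    · intro z hz
      obtain ⟨W, hW, hpW⟩ := h1 z hz
      -- The tube lemma thickens the slice over `z`, so that compactness of `K` can be used in turn.
      obtain ⟨N, M, hN, -, hzN, hLM, hNM⟩ := generalized_tube_lemma isCompact_singleton hL W.2 hW
      obtain ⟨C, hC, hCN, hCc⟩ := local_compact_nhds (hN.mem_nhds (hzN rfl))
      exact ⟨C, mem_nhdsWithin_of_mem_nhds hC, C, hCc, subset_rfl, W,
        (prod_mono hCN hLM).trans hNM, hpW⟩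
  obtain ⟨K', -, hKK', W, hW, hpW⟩ := key
  exact ⟨W, (prod_mono hKK' subset_rfl).trans hW, hpW⟩

/-- Outside `O` the two compact sets are disjoint and have disjoint neighborhoods; adjoin `O` to
each. This shrinks two domains until their overlap lies where an obstruction lifts. -/
theorem exists_open_separation {A B O : Set (ℂ × ℂ)} (hA : IsCompact A) (hB : IsCompact B)
    (hO : IsOpen O) (h : A ∩ B ⊆ O) : ∃ A' B' : Set (ℂ × ℂ), IsOpen A' ∧ IsOpen B' ∧ A ⊆ A' ∧
      B ⊆ B' ∧ A' ∩ B' ⊆ O := by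
  obtain ⟨P₁, P₂, hP₁, hP₂, hAP, hBP, hP⟩ := SeparatedNhds.of_isCompact_isCompact
    (hA.diff hO) (hB.diff hO) (disjoint_left.mpr fun x hx hx' => hx.2 (h ⟨hx.1, hx'.1⟩))
  refine ⟨P₁ ∪ O, P₂ ∪ O, hP₁.union hO, hP₂.union hO, fun x hx => ?_, fun x hx => ?_, ?_⟩
  · exact by_cases (fun h : x ∈ O => Or.inr h) fun h => Or.inl (hAP ⟨hx, h⟩)
  · exact by_cases (fun h : x ∈ O => Or.inr h) fun h => Or.inl (hBP ⟨hx, h⟩)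
  · rintro x ⟨hx | hx, hx' | hx'⟩
    · exact absurd hx' (disjoint_left.mp hP hx)
    all_goals assumption

variable {E : Type} [NormedAddCommGroup E] [NormedSpace ℂ E] [CompleteSpace E]
  {F I G J Q : AbSections (ℂ × ℂ)}

namespace FlasqueSeq

/-- The difference of the two lifts is a holomorphic function on the overlap. If it splits
additively after shrinking, the lifts can be corrected to agree. -/
theorem exists_lifts_of_split (S : FlasqueSeq F I G) (M : HolomorphicModel E F) {U : Opens (ℂ × ℂ)}
    {g : G.sec U} {W₁ W₂ : Opens (ℂ × ℂ)} (h₁ : S.Lifts g W₁) (h₂ : S.Lifts g W₂)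
    {P : Set (ℂ × ℂ)} (hs : ∀ f : ℂ × ℂ → E, AnalyticOnNhd ℂ f (W₁ ⊓ W₂ : Opens (ℂ × ℂ)) →
      ∃ V₁ V₂ : Opens (ℂ × ℂ), V₁ ≤ W₁ ∧ V₂ ≤ W₂ ∧ P ⊆ (V₁ ⊔ V₂ : Opens (ℂ × ℂ)) ∧
        ∃ f₁ f₂ : ℂ × ℂ → E, AnalyticOnNhd ℂ f₁ V₁ ∧ AnalyticOnNhd ℂ f₂ V₂ ∧
          ∀ x ∈ V₁ ⊓ V₂, f x = f₁ x + f₂ x) :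
    ∃ W : Opens (ℂ × ℂ), P ⊆ W ∧ S.Lifts g W := by
  obtain ⟨hW₁, s₁, hs₁⟩ := h₁
  obtain ⟨hW₂, s₂, hs₂⟩ := h₂
  obtain ⟨φ, hφ⟩ := S.exists_emb_eq_sub hW₁ hW₂ hs₁ hs₂
  obtain ⟨f, hf, rfl⟩ := M.exists_ofFun _ φ
  obtain ⟨V₁, V₂, hV₁, hV₂, hP, f₁, f₂, hf₁, hf₂, hadd⟩ := hs f hf
  refine ⟨V₁ ⊔ V₂, hP, S.lifts_sup_of_sub_eq (hV₁.trans hW₁) (hV₂.trans hW₂) (s := I.res hV₁ s₁)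
    (t := I.res hV₂ s₂) ?_ ?_ (M.ofFun V₁ f₁ hf₁) (M.ofFun V₂ f₂ hf₂) ?_⟩
  · rw [← S.res_proj, hs₁, G.res_res]
  · rw [← S.res_proj, hs₂, G.res_res]
  · have := congrArg (I.res (inf_le_inf hV₁ hV₂)) hφ
    rw [S.res_emb, map_sub, I.res_res, I.res_res] at this
    rw [I.res_res, I.res_res, ← this, M.res_ofFun, M.res_ofFun, M.res_ofFun, ← M.ofFun_add]
    exact congrArg _ (M.ofFun_congr _ _ _ _ _ hadd)

/-- First cohomology vanishes near compact products: local lifts are glued one factor at a time,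
with the splittings supplied by the Cauchy–Pompeiu formula. -/
theorem exists_lifts_of_isCompact (S : FlasqueSeq F I G) (M : HolomorphicModel E F)
    {U : Opens (ℂ × ℂ)} (g : G.sec U) {K L : Set ℂ} (hK : IsCompact K) (hL : IsCompact L)
    (hU : K ×ˢ L ⊆ (U : Set (ℂ × ℂ))) :
    ∃ W : Opens (ℂ × ℂ), K ×ˢ L ⊆ (W : Set (ℂ × ℂ)) ∧ S.Lifts g W := by
  refine exists_open_of_isCompact_prod (fun W => S.Lifts g W) (S.lifts_bot g) ?_ ?_ ?_ hK hL hU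
  · intro x hx
    obtain ⟨W, hW, hxW, h⟩ := S.surj U g x hx
    exact ⟨W, hxW, hW, h⟩
  · intro K₁ K₂ L h₁ h₂ hL W₁ W₂ hp₁ hp₂ hW₁ hW₂
    refine S.exists_lifts_of_split M hp₁ hp₂ fun f hf => ?_
    obtain ⟨N₁, N₂, O, hN₁, hN₂, hO, hK₁, hK₂, hLO, -, f₁, f₂, hf₁, hf₂, hadd⟩ :=
      exists_analyticOnNhd_add_fst h₁ h₂ hL (W₁ ⊓ W₂).2
        (fun x hx => ⟨hW₁ ⟨hx.1.1, hx.2⟩, hW₂ ⟨hx.1.2, hx.2⟩⟩) hf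
    refine ⟨W₁ ⊓ ⟨N₁ ×ˢ O, hN₁.prod hO⟩, W₂ ⊓ ⟨N₂ ×ˢ O, hN₂.prod hO⟩, inf_le_left, inf_le_left,
      ?_, f₁, f₂, hf₁.mono inter_subset_right, hf₂.mono inter_subset_right,
      fun x hx => hadd x ⟨⟨hx.1.2.1, hx.2.2.1⟩, hx.1.2.2⟩⟩
    rintro x ⟨hx | hx, hx'⟩
    · exact Or.inl ⟨hW₁ ⟨hx, hx'⟩, hK₁ hx, hLO hx'⟩
    · exact Or.inr ⟨hW₂ ⟨hx, hx'⟩, hK₂ hx, hLO hx'⟩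
  · intro K₁ K₂ L h₁ h₂ hL W₁ W₂ hp₁ hp₂ hW₁ hW₂
    refine S.exists_lifts_of_split M hp₁ hp₂ fun f hf => ?_
    obtain ⟨N₁, N₂, O, hN₁, hN₂, hO, hK₁, hK₂, hLO, -, f₁, f₂, hf₁, hf₂, hadd⟩ :=
      exists_analyticOnNhd_add_snd h₁ h₂ hL (W₁ ⊓ W₂).2
        (fun x hx => ⟨hW₁ ⟨hx.1, hx.2.1⟩, hW₂ ⟨hx.1, hx.2.2⟩⟩) hf
    refine ⟨W₁ ⊓ ⟨O ×ˢ N₁, hO.prod hN₁⟩, W₂ ⊓ ⟨O ×ˢ N₂, hO.prod hN₂⟩, inf_le_left, inf_le_left,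
      ?_, f₁, f₂, hf₁.mono inter_subset_right, hf₂.mono inter_subset_right,
      fun x hx => hadd x ⟨hx.1.2.1, hx.1.2.2, hx.2.2.2⟩⟩
    rintro x ⟨hx', hx | hx⟩
    · exact Or.inl ⟨hW₁ ⟨hx', hx⟩, hLO hx', hK₁ hx⟩
    · exact Or.inr ⟨hW₂ ⟨hx', hx⟩, hLO hx', hK₂ hx⟩

/-- The same induction in degree two. The obstruction to gluing is now a section of `G` near the
intersection of the two compact sets, again a compact product, where the degree one result lifts it.
-/
theorem exists_lifts_two_of_isCompact (S : FlasqueSeq F I G) (T : FlasqueSeq G J Q)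
    (M : HolomorphicModel E F) {U : Opens (ℂ × ℂ)} (z : Q.sec U) {K L : Set ℂ} (hK : IsCompact K)
    (hL : IsCompact L) (hU : K ×ˢ L ⊆ (U : Set (ℂ × ℂ))) :
    ∃ W : Opens (ℂ × ℂ), K ×ˢ L ⊆ (W : Set (ℂ × ℂ)) ∧ T.Lifts z W := by
  have key : ∀ A B : Set (ℂ × ℂ), IsCompact A → IsCompact B →
      (∃ K' L' : Set ℂ, IsCompact K' ∧ IsCompact L' ∧ A ∩ B = K' ×ˢ L') →
      ∀ W₁ W₂ : Opens (ℂ × ℂ), T.Lifts z W₁ → T.Lifts z W₂ → A ⊆ (W₁ : Set (ℂ × ℂ)) →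
        B ⊆ (W₂ : Set (ℂ × ℂ)) → ∃ W : Opens (ℂ × ℂ), A ∪ B ⊆ (W : Set (ℂ × ℂ)) ∧ T.Lifts z W := by
    rintro A B hA hB ⟨K', L', hK', hL', hAB⟩ W₁ W₂ ⟨hW₁, s₁, hs₁⟩ ⟨hW₂, s₂, hs₂⟩ hA₁ hB₂
    obtain ⟨γ, hγ⟩ := T.exists_emb_eq_sub hW₁ hW₂ hs₁ hs₂
    obtain ⟨O, hO, hOγ⟩ := S.exists_lifts_of_isCompact M γ hK' hL'
      (hAB ▸ inter_subset_inter hA₁ hB₂)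
    obtain ⟨A', B', hA', hB', hAA', hBB', hO'⟩ := exists_open_separation hA hB O.2 (hAB ▸ hO)
    refine ⟨(W₁ ⊓ ⟨A', hA'⟩) ⊔ (W₂ ⊓ ⟨B', hB'⟩), ?_, S.lifts_sup_of_lifts T hW₁ hW₂ hs₁ hs₂ hγ hOγ
      inf_le_left inf_le_left fun x hx => hO' ⟨hx.1.2, hx.2.2⟩⟩
    rintro x (hx | hx)
    · exact Or.inl ⟨hA₁ hx, hAA' hx⟩
    · exact Or.inr ⟨hB₂ hx, hBB' hx⟩
  refine exists_open_of_isCompact_prod (fun W => T.Lifts z W) (T.lifts_bot z) ?_ ?_ ?_ hK hL hU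
  · intro x hx
    obtain ⟨W, hW, hxW, h⟩ := T.surj U z x hx
    exact ⟨W, hxW, hW, h⟩
  · intro K₁ K₂ L h₁ h₂ hL W₁ W₂ hp₁ hp₂ hW₁ hW₂
    rw [union_prod]
    exact key _ _ (h₁.prod hL) (h₂.prod hL) ⟨K₁ ∩ K₂, L, h₁.inter h₂, hL, by rw [inter_prod]⟩
      W₁ W₂ hp₁ hp₂ hW₁ hW₂
  · intro K₁ K₂ L h₁ h₂ hL W₁ W₂ hp₁ hp₂ hW₁ hW₂
    rw [prod_union]
    exact key _ _ (hL.prod h₁) (hL.prod h₂) ⟨L, K₁ ∩ K₂, hL, h₁.inter h₂, by rw [prod_inter]⟩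
      W₁ W₂ hp₁ hp₂ hW₁ hW₂

/-- Lifts on successive stages differ by holomorphic functions; writing these as differences of
functions on the stages makes the lifts compatible. -/
theorem acyclic_of_mittagLeffler (S : FlasqueSeq F I G) (M : HolomorphicModel E F)
    {U : Opens (ℂ × ℂ)} {W : ℕ → Opens (ℂ × ℂ)} (hW : Monotone W) (hU : U = iSup W)
    (hML : MittagLeffler E fun n => (W n : Set (ℂ × ℂ)))
    (hl : ∀ (g : G.sec U) n, S.Lifts g (W n)) : S.Acyclic U := by
  intro g
  choose hWU s hs using hl g
  have h1 : ∀ n, ∃ f : ℂ × ℂ → E, ∃ hf : AnalyticOnNhd ℂ f (W n),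
      S.emb _ (M.ofFun (W n) f hf) = s n - I.res (hW n.le_succ) (s (n + 1)) := by
    intro n
    obtain ⟨φ, hφ⟩ := S.exact (W n) (s n - I.res (hW n.le_succ) (s (n + 1))) (by
      rw [map_sub, ← S.res_proj, hs, hs, G.res_res, sub_self])
    obtain ⟨f, hf, rfl⟩ := M.exists_ofFun _ φ
    exact ⟨f, hf, hφ⟩
  choose f hf hfs using h1
  -- The shift of index matches `MittagLeffler`, which takes its `n`-th function on the stage `n +
  -- 1` and solves on the stage `n`.
  obtain ⟨h, hh, hhf⟩ := hML (fun n => f (n + 1)) fun n => hf (n + 1)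
  refine S.exists_proj_eq_of_seq g W hW hU
    (fun n => I.res (hW n.le_succ) (s (n + 1)) - S.emb _ (M.ofFun (W n) (h n) (hh n)))
    (fun n => ?_) fun n => ?_
  · rw [map_sub, ← S.res_proj, hs, S.proj_emb, sub_zero, G.res_res]
  · have h2 := congrArg (I.res (hW n.le_succ)) (hfs (n + 1))
    rw [S.res_emb, map_sub, I.res_res, M.res_ofFun] at h2
    rw [map_sub, I.res_res, S.res_emb, M.res_ofFun]
    have h3 : M.ofFun (W n) (h n) (hh n) = M.ofFun (W n) (h (n + 1)) ((hh (n + 1)).mono (hW n.le_succ)) +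
        M.ofFun (W n) (f (n + 1)) ((hf (n + 1)).mono (hW n.le_succ)) := by
      rw [← M.ofFun_add]
      refine M.ofFun_congr _ _ _ _ _ fun x hx => ?_
      rw [← hhf n x hx, add_sub_cancel]
    rw [h3, map_add, h2]
    abel

end FlasqueSeq

end Chart

/-! ### Products of planes and punctured planes -/

section CoordOpen

open Metric Set

/-- The open subset of `ℂ²` where the indicated coordinates do not vanish. -/
def coordOpen (b b' : Bool) : Opens (ℂ × ℂ) where
  carrier := {z | (b = true → z.1 ≠ 0) ∧ (b' = true → z.2 ≠ 0)}
  is_open' := by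
    cases b <;> cases b' <;> simp only [forall_const, reduceCtorEq, false_imp_iff, true_and, and_true]
    · exact isOpen_univ
    · exact isOpen_ne_fun continuous_snd continuous_const
    · exact isOpen_ne_fun continuous_fst continuous_const
    · exact (isOpen_ne_fun continuous_fst continuous_const).inter
        (isOpen_ne_fun continuous_snd continuous_const)

/-- The members of an exhaustion of `ℂ` or of the punctured plane. -/
def planeStage (b : Bool) (n : ℕ) : Set ℂ :=
  if b then openAnnulus (n + 1) else ball 0 (n + 1)

theorem isOpen_openAnnulus (R : ℝ) : IsOpen (openAnnulus R) := by
  have h : openAnnulus R = {0}ᶜ ∩ (ball 0 R ∩ (fun z => z⁻¹) ⁻¹' ball 0 R) := rfl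
  rw [isOpen_iff_mem_nhds]
  intro z hz
  have hz0 : ContinuousAt (fun z : ℂ => z⁻¹) z := continuousAt_inv₀ hz.1
  rw [h]
  exact Filter.inter_mem (isOpen_compl_singleton.mem_nhds hz.1)
    (Filter.inter_mem (isOpen_ball.mem_nhds hz.2.1)
      (hz0.preimage_mem_nhds (isOpen_ball.mem_nhds hz.2.2)))

theorem isOpen_planeStage (b : Bool) (n : ℕ) : IsOpen (planeStage b n) := by
  cases b
  · exact isOpen_ball
  · exact isOpen_openAnnulus _

theorem planeStage_mono (b : Bool) : Monotone (planeStage b) := by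
  intro m n hmn
  have hle : (m + 1 : ℝ) ≤ n + 1 := by exact_mod_cast Nat.succ_le_succ hmn
  cases b
  · exact ball_subset_ball hle
  · exact fun z hz => ⟨hz.1, ball_subset_ball hle hz.2.1, ball_subset_ball hle hz.2.2⟩

theorem ne_zero_of_mem_planeStage {n : ℕ} {b : Bool} {z : ℂ} (hz : z ∈ planeStage b n)
    (hb : b = true) : z ≠ 0 := by
  subst hb
  exact hz.1

theorem exists_mem_planeStage (b : Bool) {z : ℂ} (hz : b = true → z ≠ 0) : ∃ n, z ∈ planeStage b n := by
  obtain ⟨n, hn⟩ := exists_nat_gt (max ‖z‖ ‖z⁻¹‖)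
  have h1 : z ∈ ball (0 : ℂ) (n + 1) := by
    rw [mem_ball_zero_iff]
    linarith [le_max_left ‖z‖ ‖z⁻¹‖]
  have h2 : z⁻¹ ∈ ball (0 : ℂ) (n + 1) := by
    rw [mem_ball_zero_iff]
    linarith [le_max_right ‖z‖ ‖z⁻¹‖]
  refine ⟨n, ?_⟩
  cases b
  · exact h1
  · exact ⟨hz rfl, h1, h2⟩

theorem exists_isCompact_planeStage (b : Bool) (n : ℕ) :
    ∃ K, IsCompact K ∧ planeStage b n ⊆ K ∧ K ⊆ planeStage b (n + 1) := by
  have hle : (n + 1 : ℝ) < (n + 1 : ℕ) + 1 := by push_cast; linarith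
  cases b
  · exact ⟨closedBall 0 (n + 1), isCompact_closedBall _ _, ball_subset_closedBall,
      closedBall_subset_ball hle⟩
  · have hn : (0 : ℝ) < n + 1 := by positivity
    refine ⟨closedBall 0 (n + 1) \ ball 0 (n + 1 : ℝ)⁻¹, (isCompact_closedBall _ _).diff isOpen_ball,
      fun z hz => ⟨ball_subset_closedBall hz.2.1, fun h => ?_⟩, fun z hz => ?_⟩
    · have h1 := mem_ball_zero_iff.mp hz.2.2
      have h2 := mem_ball_zero_iff.mp h
      rw [norm_inv, inv_lt_comm₀ (norm_pos_iff.mpr hz.1) hn] at h1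
      exact lt_asymm h1 h2
    · have h2 : (n + 1 : ℝ)⁻¹ ≤ ‖z‖ := by simpa using hz.2
      have h0 : 0 < ‖z‖ := (inv_pos.mpr hn).trans_le h2
      refine ⟨norm_pos_iff.mp h0, closedBall_subset_ball hle hz.1, ?_⟩
      rw [mem_ball_zero_iff, norm_inv]
      exact ((inv_le_comm₀ hn h0).mp h2).trans_lt hle

/-- The members of an exhaustion of `coordOpen b b'`. -/
def coordStage (b b' : Bool) (n : ℕ) : Opens (ℂ × ℂ) :=
  ⟨planeStage b n ×ˢ planeStage b' n, (isOpen_planeStage b n).prod (isOpen_planeStage b' n)⟩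

theorem coordStage_mono (b b' : Bool) : Monotone (coordStage b b') := fun _ _ h =>
  prod_mono (planeStage_mono b h) (planeStage_mono b' h)

theorem coordOpen_eq_iSup (b b' : Bool) : coordOpen b b' = iSup (coordStage b b') := by
  ext z
  simp only [SetLike.mem_coe, Opens.mem_iSup]
  constructor
  · rintro ⟨h1, h2⟩
    obtain ⟨m, hm⟩ := exists_mem_planeStage b h1
    obtain ⟨n, hn⟩ := exists_mem_planeStage b' h2
    exact ⟨max m n, planeStage_mono b (le_max_left m n) hm, planeStage_mono b' (le_max_right m n) hn⟩
  · rintro ⟨n, h1, h2⟩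
    exact ⟨ne_zero_of_mem_planeStage h1, ne_zero_of_mem_planeStage h2⟩

variable {E : Type} [NormedAddCommGroup E] [NormedSpace ℂ E] [CompleteSpace E]

/-- The bidisc case is carried to punctured factors by Laurent splitting, one factor at a time. -/
theorem mittagLeffler_coordStage (b b' : Bool) :
    MittagLeffler E fun n => (coordStage b b' n : Set (ℂ × ℂ)) := by
  have h1 : ∀ b, MittagLeffler E fun n => planeStage b n ×ˢ planeStage false n := by
    rintro (_ | _)
    · exact mittagLeffler_ball
    · exact MittagLeffler.annulus (isOpen_planeStage false)
        (fun n => planeStage_mono false n.le_succ) mittagLeffler_ball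
  cases b'
  · exact h1 b
  · exact (MittagLeffler.annulus (isOpen_planeStage b)
      (fun n => planeStage_mono b n.le_succ) (h1 b).comp_swap).comp_swap

variable {F I G J Q : AbSections (ℂ × ℂ)}

/-- A compact product fits between consecutive stages. -/
theorem FlasqueSeq.lifts_coordStage (S : FlasqueSeq F I G) (M : HolomorphicModel E F) {b b' : Bool}
    {U : Opens (ℂ × ℂ)} {n : ℕ} (hU : coordStage b b' (n + 1) ≤ U) (g : G.sec U) :
    S.Lifts g (coordStage b b' n) := by
  obtain ⟨K, hK, hnK, hKn⟩ := exists_isCompact_planeStage b n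
  obtain ⟨L, hL, hnL, hLn⟩ := exists_isCompact_planeStage b' n
  obtain ⟨W, hW, hl⟩ := S.exists_lifts_of_isCompact M g hK hL ((prod_mono hKn hLn).trans hU)
  exact hl.mono ((prod_mono hnK hnL).trans hW)

theorem FlasqueSeq.acyclic_coordOpen (S : FlasqueSeq F I G) (M : HolomorphicModel E F)
    (b b' : Bool) : S.Acyclic (coordOpen b b') :=
  S.acyclic_of_mittagLeffler M (coordStage_mono b b') (coordOpen_eq_iSup b b')
    (mittagLeffler_coordStage b b')
    fun g n => S.lifts_coordStage M (coordOpen_eq_iSup b b' ▸ le_iSup _ (n + 1)) g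

/-- No approximation is needed in degree two: obstructions over one stage lift over the preceding
one, and those lifts extend by flasqueness. -/
theorem FlasqueSeq.acyclic_two_coordOpen (S : FlasqueSeq F I G) (T : FlasqueSeq G J Q)
    (M : HolomorphicModel E F) (b b' : Bool) : T.Acyclic (coordOpen b b') := by
  intro z
  refine S.exists_proj_eq_of_lifts T z _ (coordStage_mono b b') (coordOpen_eq_iSup b b')
    (fun n => ?_) fun n γ => S.lifts_coordStage M le_rfl γ
  obtain ⟨K, hK, hnK, hKn⟩ := exists_isCompact_planeStage b n
  obtain ⟨L, hL, hnL, hLn⟩ := exists_isCompact_planeStage b' n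
  obtain ⟨W, hW, hl⟩ := S.exists_lifts_two_of_isCompact T M z hK hL ((prod_mono hKn hLn).trans
    (coordOpen_eq_iSup b b' ▸ le_iSup (coordStage b b') (n + 1)))
  exact hl.mono ((prod_mono hnK hnL).trans hW)

/-- Laurent splitting on the torus. -/
theorem exists_torus_splitting {f : ℂ × ℂ → E} (hf : AnalyticOnNhd ℂ f (coordOpen true true)) :
    ∃ f₁ f₂ f₃ : ℂ × ℂ → E, AnalyticOnNhd ℂ f₁ (coordOpen false true) ∧
      AnalyticOnNhd ℂ f₂ (coordOpen true false) ∧ AnalyticOnNhd ℂ f₃ univ ∧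
      ∀ z w : ℂ, z ≠ 0 → w ≠ 0 → f (z, w) = f₁ (z, w) + f₂ (z, w) + f₃ (z⁻¹, w⁻¹) := by
  have hD : closedBall (0 : ℂ) 2 \ ball 0 1 ⊆ {0}ᶜ := by
    rintro z ⟨-, hz⟩ rfl
    simp at hz
  have hu : ({0}ᶜ ∪ ball 0 2 : Set ℂ) = univ ∧ ((fun u : ℂ => u⁻¹) ⁻¹' {0}ᶜ ∪ ball 0 (1 : ℝ)⁻¹ : Set ℂ) = univ := by
    constructor <;>
    · ext z
      by_cases hz : z = 0 <;> simp [hz]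
  -- With `D = {0}ᶜ` both Laurent parts become entire in their first variable.
  have step : ∀ {W : Set ℂ}, IsOpen W → ∀ {g : ℂ × ℂ → E}, AnalyticOnNhd ℂ g ({0}ᶜ ×ˢ W) →
      ∃ g₁ g₂ : ℂ × ℂ → E, AnalyticOnNhd ℂ g₁ (univ ×ˢ W) ∧ AnalyticOnNhd ℂ g₂ (univ ×ˢ W) ∧
        ∀ z w : ℂ, z ≠ 0 → w ∈ W → g (z, w) = g₁ (z, w) + g₂ (z⁻¹, w) := by
    intro W hW g hg
    obtain ⟨g₁, g₂, h₁, h₂, h⟩ := exists_laurent_fst one_pos one_lt_two hW hg (by simp) hD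
    rw [hu.1] at h₁
    rw [hu.2] at h₂
    exact ⟨g₁, g₂, h₁, h₂, fun z w hz hw => h z hz w hw⟩
  -- Split in `z` first; the regular part is `f₁` and needs no further splitting. Only the part in
  -- `z⁻¹` is split again in `w`, giving `f₂` and `f₃`.
  obtain ⟨f₁, k, hf₁, hk, hfk⟩ := step isOpen_compl_singleton (W := {0}ᶜ) (g := f)
    (hf.mono fun p hp => ⟨fun _ => hp.1, fun _ => hp.2⟩)
  have hswap : AnalyticOnNhd ℂ (Prod.swap : ℂ × ℂ → ℂ × ℂ) univ := fun p _ =>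
    AnalyticAt.prod analyticAt_snd analyticAt_fst
  obtain ⟨k₁, k₂, hk₁, hk₂, hkk⟩ := step isOpen_univ (g := k ∘ Prod.swap)
    (hk.comp (hswap.mono (subset_univ _)) fun p hp => ⟨mem_univ _, hp.1⟩)
  rw [univ_prod_univ] at hk₁ hk₂
  refine ⟨f₁, fun p => k₁ (p.2, p.1⁻¹), fun p => k₂ (p.2, p.1), hf₁.mono fun p hp =>
    ⟨mem_univ _, hp.2 rfl⟩, fun p hp => ?_, hk₂.comp hswap fun _ _ => mem_univ _,
    fun z w hz hw => ?_⟩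
  · exact AnalyticAt.comp (g := k₁) (f := fun p : ℂ × ℂ => (p.2, p.1⁻¹)) (x := p)
      (hk₁ _ (mem_univ _)) (AnalyticAt.prod analyticAt_snd (analyticAt_fst.inv (hp.1 rfl)))
  · have h1 := hkk w z⁻¹ hw (mem_univ _)
    rw [hfk z w hz hw, add_assoc]
    exact congrArg _ h1

end CoordOpen

/-! ## Combinatorics of fans in the plane -/

theorem mem_latticeCone_pair {u v : ℤ × ℤ} {x : ℝ × ℝ} : x ∈ latticeCone {u, v} ↔
    ∃ a b : ℝ, 0 ≤ a ∧ 0 ≤ b ∧ x = (a * u.1 + b * v.1, a * u.2 + b * v.2) := by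
  rw [latticeCone, Set.image_pair]
  refine Submodule.mem_span_pair.trans ⟨?_, ?_⟩
  · rintro ⟨a, b, rfl⟩
    exact ⟨a, b, a.2, b.2, rfl⟩
  · rintro ⟨a, b, ha, hb, rfl⟩
    exact ⟨⟨a, ha⟩, ⟨b, hb⟩, rfl⟩

theorem latticeDet_antisymm (u v : ℤ × ℤ) : latticeDet u v = -latticeDet v u := by
  simp only [latticeDet]
  ring

theorem latticeDet_expand {v w : ℤ × ℤ} (h : latticeDet v w = 1) (x : ℤ × ℤ) :
    x = (latticeDet x w * v.1 + latticeDet v x * w.1, latticeDet x w * v.2 + latticeDet v x * w.2) := by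
  simp only [latticeDet] at *
  ext
  · linear_combination -x.1 * h
  · linear_combination -x.2 * h

theorem latticeDet_expand_det {v w : ℤ × ℤ} (h : latticeDet v w = 1) (y x : ℤ × ℤ) :
    latticeDet y x = latticeDet x w * latticeDet y v + latticeDet v x * latticeDet y w := by
  simp only [latticeDet] at *
  linear_combination -(y.1 * x.2 - y.2 * x.1) * h

namespace SmoothCompleteFan

variable {F : SmoothCompleteFan}

/-- Completeness in integral terms: by Cramer's rule the two determinants are the coefficients of
`x` with respect to the generators of a cone containing it. -/
theorem exists_cone_det_nonneg (x : ℤ × ℤ) :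
    ∃ c ∈ F.cones, 0 ≤ latticeDet x c.2 ∧ 0 ≤ latticeDet c.1 x := by
  obtain ⟨c, hc, hx⟩ := F.complete (x.1, x.2)
  obtain ⟨a, b, ha, hb, hab⟩ := mem_latticeCone_pair.mp hx
  have h1 : (c.1.1 : ℝ) * c.2.2 - c.1.2 * c.2.1 = 1 := by exact_mod_cast F.det_eq_one c hc
  simp only [Prod.mk.injEq] at hab
  obtain ⟨hab1, hab2⟩ := hab
  refine ⟨c, hc, ?_, ?_⟩ <;> simp only [latticeDet]
  · have : ((x.1 * c.2.2 - x.2 * c.2.1 : ℤ) : ℝ) = a := by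
      push_cast
      rw [hab1, hab2]
      linear_combination a * h1
    exact_mod_cast this ▸ ha
  · have : ((c.1.1 * x.2 - c.1.2 * x.1 : ℤ) : ℝ) = b := by
      push_cast
      rw [hab1, hab2]
      linear_combination b * h1
    exact_mod_cast this ▸ hb

/-- A cone is determined by any lattice point in its interior. -/
theorem eq_of_det_pos {c c' : (ℤ × ℤ) × (ℤ × ℤ)} (hc : c ∈ F.cones) (hc' : c' ∈ F.cones)
    (x : ℤ × ℤ) (h₁ : 0 < latticeDet x c.2) (h₂ : 0 < latticeDet c.1 x)
    (h₁' : 0 ≤ latticeDet x c'.2) (h₂' : 0 ≤ latticeDet c'.1 x) : c = c' := by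
  have hd := F.det_eq_one c hc
  have hd' := F.det_eq_one c' hc'
  have hmem : ∀ d : (ℤ × ℤ) × (ℤ × ℤ), latticeDet d.1 d.2 = 1 → 0 ≤ latticeDet x d.2 →
      0 ≤ latticeDet d.1 x → ((x.1 : ℝ), (x.2 : ℝ)) ∈ latticeCone {d.1, d.2} := by
    intro d hd h1 h2
    have h3 := latticeDet_expand hd x
    refine mem_latticeCone_pair.mpr ⟨latticeDet x d.2, latticeDet d.1 x, by exact_mod_cast h1,
      by exact_mod_cast h2, ?_⟩
    have h4 := congrArg Prod.fst h3
    have h5 := congrArg Prod.snd h3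
    dsimp only at h4 h5
    exact Prod.ext (by dsimp only; exact_mod_cast h4) (by dsimp only; exact_mod_cast h5)
  have key : ((x.1 : ℝ), (x.2 : ℝ)) ∈ latticeCone ({c.1, c.2} ∩ {c'.1, c'.2}) := by
    rw [← SetLike.mem_coe, ← F.inter_eq c hc c' hc']
    exact ⟨hmem c hd h₁.le h₂.le, hmem c' hd' h₁' h₂'⟩
  -- If the cones shared at most the ray of `u`, then `x` would lie on that ray. Hence both
  -- generators of `c` are generators of `c'`, and the orientation fixes their order.
  have hne : ∀ u : ℤ × ℤ, latticeDet u x ≠ 0 → ¬ ({c.1, c.2} ∩ {c'.1, c'.2} : Set (ℤ × ℤ)) ⊆ {u} := by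
    intro u hu hsub
    have h3 : ((x.1 : ℝ), (x.2 : ℝ)) ∈ latticeCone {u, u} := by
      rw [Set.pair_eq_singleton]
      exact Submodule.span_mono (Set.image_mono hsub) key
    obtain ⟨a, b, -, -, hab⟩ := mem_latticeCone_pair.mp h3
    simp only [Prod.mk.injEq] at hab
    refine hu ?_
    have : ((latticeDet u x : ℤ) : ℝ) = 0 := by
      simp only [latticeDet]
      push_cast
      rw [hab.1, hab.2]
      ring
    exact_mod_cast this
  have hm1 : c.1 ∈ ({c'.1, c'.2} : Set (ℤ × ℤ)) := by
    by_contra h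
    refine hne c.2 (by rw [latticeDet_antisymm]; omega) ?_
    rintro u ⟨rfl | rfl, hu⟩
    · exact absurd hu h
    · rfl
  have hm2 : c.2 ∈ ({c'.1, c'.2} : Set (ℤ × ℤ)) := by
    by_contra h
    refine hne c.1 (by omega) ?_
    rintro u ⟨rfl | rfl, hu⟩
    · rfl
    · exact absurd hu h
  rcases hm1 with e1 | e1 <;> rcases hm2 with e2 | e2
  · rw [e1, e2, latticeDet_self] at hd
    exact absurd hd zero_ne_one
  · exact Prod.ext e1 e2
  · rw [e1, e2, latticeDet_antisymm, hd'] at hd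
    norm_num at hd
  · rw [e1, e2, latticeDet_self] at hd
    exact absurd hd zero_ne_one

/-- Of two cones with the same first ray, the narrower has its second ray in the interior of the
wider one. -/
theorem eq_of_fst_eq {c c' : (ℤ × ℤ) × (ℤ × ℤ)} (hc : c ∈ F.cones) (hc' : c' ∈ F.cones)
    (h : c.1 = c'.1) : c = c' := by
  have key : ∀ c c' : (ℤ × ℤ) × (ℤ × ℤ), c ∈ F.cones → c' ∈ F.cones → c.1 = c'.1 →
      0 < latticeDet c'.2 c.2 → c = c' := by
    intro c c' hc hc' h h1
    have hd' := F.det_eq_one c' hc'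
    refine eq_of_det_pos hc hc' c'.2 h1 (by rw [h, hd']; exact one_pos) (by rw [latticeDet_self])
      (by rw [hd']; exact zero_le_one)
  rcases lt_trichotomy (latticeDet c'.2 c.2) 0 with h1 | h1 | h1
  · refine (key c' c hc' hc h.symm ?_).symm
    rw [latticeDet_antisymm]
    omega
  · refine Prod.ext h ?_
    have hd := F.det_eq_one c hc
    have hd' := F.det_eq_one c' hc'
    rw [← h] at hd'
    have := latticeDet_expand hd c'.2
    rw [h1, hd'] at this
    rw [this]
    simp
  · exact key c c' hc hc' h h1

theorem eq_of_snd_eq {c c' : (ℤ × ℤ) × (ℤ × ℤ)} (hc : c ∈ F.cones) (hc' : c' ∈ F.cones)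
    (h : c.2 = c'.2) : c = c' := by
  have key : ∀ c c' : (ℤ × ℤ) × (ℤ × ℤ), c ∈ F.cones → c' ∈ F.cones → c.2 = c'.2 →
      0 < latticeDet c.1 c'.1 → c = c' := by
    intro c c' hc hc' h h1
    have hd' := F.det_eq_one c' hc'
    refine eq_of_det_pos hc hc' c'.1 (by rw [h, hd']; exact one_pos) h1
      (by rw [hd']; exact zero_le_one) (by rw [latticeDet_self])
  rcases lt_trichotomy (latticeDet c.1 c'.1) 0 with h1 | h1 | h1
  · refine (key c' c hc' hc h.symm ?_).symm
    rw [latticeDet_antisymm]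
    omega
  · refine Prod.ext ?_ h
    have hd := F.det_eq_one c hc
    have hd' := F.det_eq_one c' hc'
    rw [← h] at hd'
    have := latticeDet_expand hd c'.1
    rw [h1, hd'] at this
    rw [this]
    simp
  · exact key c c' hc hc' h h1

/-- Among cones in a half-plane there is a last one. -/
theorem exists_last_cone (p : ℤ × ℤ) (hp : p ≠ 0) (S : Finset ((ℤ × ℤ) × (ℤ × ℤ)))
    (hS : S ⊆ F.cones) (hne : S.Nonempty)
    (hp0 : ∀ c ∈ S, 0 ≤ latticeDet p c.1 ∧ 0 ≤ latticeDet p c.2) :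
    ∃ c ∈ S, ∀ c' ∈ S, c' ≠ c → c.2 ≠ c'.1 ∧ c.2 ≠ c'.2 := by
  have hpp : 0 < p.1 ^ 2 + p.2 ^ 2 := by
    rcases not_and_or.mp (fun h => hp (Prod.ext h.1 h.2) : ¬ (p.1 = 0 ∧ p.2 = 0)) with h | h
    · have := sq_nonneg p.2
      positivity
    · have := sq_nonneg p.1
      positivity
  -- This identity says that the cotangent of the angle from `p`, the inner product with `p` over
  -- `latticeDet p`, decreases from the first to the second ray of a cone.
  have hid : ∀ v w : ℤ × ℤ, (p.1 * v.1 + p.2 * v.2) * latticeDet p w -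
      (p.1 * w.1 + p.2 * w.2) * latticeDet p v = (p.1 ^ 2 + p.2 ^ 2) * latticeDet v w := by
    intro v w
    simp only [latticeDet]
    ring
  suffices h : ∃ c ∈ S, ∀ c' ∈ S, c.2 ≠ c'.1 by
    obtain ⟨c, hc, h⟩ := h
    exact ⟨c, hc, fun c' hc' hne => ⟨h c' hc', fun h2 =>
      hne (eq_of_snd_eq (hS hc) (hS hc') h2).symm⟩⟩
  by_cases hS' : (S.filter fun c => 0 < latticeDet p c.1).Nonempty
  · obtain ⟨c, hc, hmin⟩ := Finset.exists_min_image _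
      (fun c : (ℤ × ℤ) × (ℤ × ℤ) => ((p.1 * c.1.1 + p.2 * c.1.2 : ℤ) : ℚ) / latticeDet p c.1) hS'
    rw [Finset.mem_filter] at hc
    have hd := F.det_eq_one c (hS hc.1)
    refine ⟨c, hc.1, fun c' hc' h => ?_⟩
    have hd' := F.det_eq_one c' (hS hc')
    have h1 := hid c.1 c.2
    rw [hd] at h1
    rcases (hp0 c' hc').1.lt_or_eq with h2 | h2
    · have h3 := hmin c' (Finset.mem_filter.mpr ⟨hc', h2⟩)
      rw [div_le_div_iff₀ (by exact_mod_cast hc.2) (by exact_mod_cast h2)] at h3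
      rw [← h] at h3
      norm_cast at h3
      omega
    · have h3 := hid c'.1 c'.2
      rw [← h2, hd', ← h] at h3
      rw [← h] at h2
      rw [← h2] at h1
      have h4 := (hp0 c' hc').2
      have h5 := hc.2
      have h6 : 0 < -(p.1 * c.2.1 + p.2 * c.2.2) := by nlinarith
      nlinarith
  -- Here all first rays lie on the line of `p`, so no second ray, being independent of its first
  -- one, can be among them.
  · obtain ⟨c, hc⟩ := hne
    refine ⟨c, hc, fun c' hc' h => ?_⟩
    have h0 : ∀ d ∈ S, latticeDet p d.1 = 0 := fun d hd => le_antisymm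
      (not_lt.mp fun h => hS' ⟨d, Finset.mem_filter.mpr ⟨hd, h⟩⟩) (hp0 d hd).1
    have h1 := hid c.1 c.2
    rw [F.det_eq_one c (hS hc), h0 c hc, h, h0 c' hc'] at h1
    omega

/-- The decomposition of a fan into a cone and two half-planes. -/
theorem exists_decomposition (F : SmoothCompleteFan) : ∃ p : ℤ × ℤ, p ≠ 0 ∧ ∃ σ ∈ F.cones,
    ∃ B₁ B₂ : Finset ((ℤ × ℤ) × (ℤ × ℤ)), B₁ ⊆ F.cones ∧ B₂ ⊆ F.cones ∧
      (∀ c ∈ F.cones, c = σ ∨ c ∈ B₁ ∨ c ∈ B₂) ∧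
      (∀ c ∈ B₁, 0 ≤ latticeDet (-p) c.1 ∧ 0 ≤ latticeDet (-p) c.2) ∧
      (∀ c ∈ B₂, 0 ≤ latticeDet p c.1 ∧ 0 ≤ latticeDet p c.2) ∧
      (∀ c ∈ B₁, σ.1 ≠ c.1 ∧ σ.1 ≠ c.2) ∧ (∀ c ∈ B₂, σ.2 ≠ c.1 ∧ σ.2 ≠ c.2) ∧
      (∀ c ∈ B₁, ∀ c' ∈ B₂, ∀ u : ℤ × ℤ, (u = c.1 ∨ u = c.2) → (u = c'.1 ∨ u = c'.2) → u = p) ∧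
      latticeDet p σ.2 ≤ 0 ∧ latticeDet σ.1 p ≤ 0 := by
  obtain ⟨c₀, hc₀, -⟩ := F.exists_cone_det_nonneg 0
  set p := c₀.1 with hp
  have hd₀ := F.det_eq_one c₀ hc₀
  -- The cone `σ` contains `-p`; below, `a` and `b` are the coefficients of `-p` in its generators.
  obtain ⟨σ, hσ, hσ1, hσ2⟩ := F.exists_cone_det_nonneg (-p)
  have hdσ := F.det_eq_one σ hσ
  have hneg : ∀ u v : ℤ × ℤ, latticeDet (-u) v = -latticeDet u v ∧ latticeDet u (-v) = -latticeDet u v := by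
    intro u v
    simp only [latticeDet, Prod.fst_neg, Prod.snd_neg]
    constructor <;> ring
  have hp0 : p ≠ 0 := by
    intro h
    rw [← hp, h] at hd₀
    simp [latticeDet] at hd₀
  have hcone : ∀ c ∈ F.cones, c ≠ σ → ∀ u : ℤ × ℤ, u = c.1 ∨ u = c.2 → u = -p →
      latticeDet (-p) σ.2 = 0 ∨ latticeDet σ.1 (-p) = 0 := by
    intro c hc hcσ u hu hup
    by_contra! h
    have hd := F.det_eq_one c hc
    refine hcσ (eq_of_det_pos hσ hc (-p) (lt_of_le_of_ne hσ1 h.1.symm)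
      (lt_of_le_of_ne hσ2 h.2.symm) ?_ ?_).symm <;> rw [← hup] <;> rcases hu with rfl | rfl <;>
      simp [latticeDet_self, hd]
  have hexp := latticeDet_expand hdσ (-p)
  have hexpd := fun y => latticeDet_expand_det hdσ y (-p)
  set a := latticeDet (-p) σ.2 with ha
  set b := latticeDet σ.1 (-p) with hb
  have ha' : latticeDet p σ.2 = -a := by rw [ha, (hneg p σ.2).1, neg_neg]
  have hb' : latticeDet σ.1 p = -b := by rw [hb, (hneg σ.1 p).2, neg_neg]
  have hab : ¬ (a = 0 ∧ b = 0) := by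
    rintro ⟨h1, h2⟩
    rw [h1, h2] at hexp
    exact hp0 (neg_eq_zero.mp (by rw [hexp]; simp))
  -- The first generator of `σ` lies on the `B₂` side. It could belong to a cone of `B₁` only if it
  -- spans the ray of `-p`; as the second generator of that cone, its first one would then be on the
  -- wrong side.
  have hB₁ : ∀ c ∈ F.cones, c ≠ σ → latticeDet p c.1 ≤ 0 → latticeDet p c.2 ≤ 0 →
      σ.1 ≠ c.1 ∧ σ.1 ≠ c.2 := by
    intro c hc hcσ h1 h2
    refine ⟨fun h => hcσ (eq_of_fst_eq hσ hc h).symm, fun h => hab ?_⟩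
    have h3 := hexpd c.1
    rw [(hneg c.1 p).2, latticeDet_antisymm c.1 p, h, F.det_eq_one c hc] at h3
    rw [← h, latticeDet_antisymm, hb'] at h2
    have hb0 : b = 0 := by omega
    rw [hb0] at h3
    omega
  have hB₂ : ∀ c ∈ F.cones, c ≠ σ → 0 ≤ latticeDet p c.1 → 0 ≤ latticeDet p c.2 →
      σ.2 ≠ c.1 ∧ σ.2 ≠ c.2 := by
    intro c hc hcσ h1 h2
    refine ⟨fun h => hab ?_, fun h => hcσ (eq_of_snd_eq hσ hc h).symm⟩
    have h3 := hexpd c.2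
    rw [(hneg c.2 p).2, latticeDet_antisymm c.2 p, h, latticeDet_antisymm c.2 c.1,
      F.det_eq_one c hc] at h3
    rw [← h, ha'] at h1
    have ha0 : a = 0 := by omega
    rw [ha0] at h3
    omega
  have hunit : ∀ k m : ℤ, 0 ≤ k → k * m = 1 → k = 1 := by
    intro k m hk h
    rcases Int.eq_one_or_neg_one_of_mul_eq_one h with h | h <;> omega
  refine ⟨p, hp0, σ, hσ,
    F.cones.filter fun c => c ≠ σ ∧ latticeDet p c.1 ≤ 0 ∧ latticeDet p c.2 ≤ 0,
    F.cones.filter fun c => c ≠ σ ∧ 0 ≤ latticeDet p c.1 ∧ 0 ≤ latticeDet p c.2,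
    Finset.filter_subset _ _, Finset.filter_subset _ _, ?_, ?_, ?_, ?_, ?_, ?_, by omega, by omega⟩
  · intro c hc
    by_cases hcσ : c = σ
    · exact Or.inl hcσ
    simp only [Finset.mem_filter, hc, hcσ, true_and, ne_eq, not_false_eq_true, false_or]
    -- A cone in neither half-plane has `p` or `-p` in its interior. The first case makes it `c₀`,
    -- on whose boundary `p` lies; the second makes it `σ`.
    by_contra! h
    rcases lt_trichotomy (latticeDet p c.1) 0 with h1 | h1 | h1
    · have h2 := h.1 h1.le
      have h3 : c = c₀ := eq_of_det_pos hc hc₀ p h2 (by rw [latticeDet_antisymm]; omega)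
        (by rw [hd₀]; exact zero_le_one) (by rw [hp, latticeDet_self])
      rw [h3, hp, latticeDet_self] at h1
      exact lt_irrefl _ h1
    · have h2 := h.1 h1.le
      have h3 := h.2 h1.ge
      omega
    · have h2 := h.2 h1.le
      exact hcσ (eq_of_det_pos hc hσ (-p) (by rw [(hneg _ _).1]; omega)
        (by rw [(hneg _ _).2, latticeDet_antisymm]; omega) hσ1 hσ2)
  · intro c hc
    have h := (Finset.mem_filter.mp hc).2
    rw [(hneg _ _).1, (hneg _ _).1]
    omega
  · exact fun c hc => (Finset.mem_filter.mp hc).2.2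
  · intro c hc
    obtain ⟨h1, h2, h3, h4⟩ := Finset.mem_filter.mp hc
    exact hB₁ c h1 h2 h3 h4
  · intro c hc
    obtain ⟨h1, h2, h3, h4⟩ := Finset.mem_filter.mp hc
    exact hB₂ c h1 h2 h3 h4
  · intro c hc c' hc' u hu hu'
    obtain ⟨h1, h2, h3, h4⟩ := Finset.mem_filter.mp hc
    obtain ⟨h1', h2', h3', h4'⟩ := Finset.mem_filter.mp hc'
    -- A ray common to both sides lies on the line of `p` and is primitive, so it is `p` or `-p`.
    have hu0 : latticeDet p u = 0 := by
      refine le_antisymm ?_ ?_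
      · rcases hu with rfl | rfl <;> assumption
      · rcases hu' with rfl | rfl <;> assumption
    have hk : u = (latticeDet u c₀.2 * p.1, latticeDet u c₀.2 * p.2) := by
      have := latticeDet_expand hd₀ u
      rw [← hp, hu0] at this
      simpa using this
    have hd := F.det_eq_one c h1
    have hk1 : ∃ w : ℤ × ℤ, latticeDet u w = 1 := by
      rcases hu with rfl | rfl
      · exact ⟨_, hd⟩
      · exact ⟨-c.1, by rw [(hneg _ _).2, latticeDet_antisymm, neg_neg, hd]⟩
    obtain ⟨w, hw⟩ := hk1
    have hkw : latticeDet u c₀.2 * latticeDet p w = 1 := by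
      rw [← hw]
      nth_rw 2 [hk]
      simp only [latticeDet]
      ring
    rcases Int.eq_one_or_neg_one_of_mul_eq_one hkw with h5 | h5
    · rw [h5] at hk
      rw [hk]
      simp
    · exfalso
      rw [h5] at hk
      have hup : u = -p := by
        rw [hk]
        ext <;> simp
      have hd' : latticeDet (-p) (-c₀.2) = 1 := by rw [(hneg _ _).1, (hneg _ _).2, neg_neg, hd₀]
      -- If `-p` generates a cone other than `σ`, it lies on the boundary of `σ`; being primitive,
      -- it is a generator of `σ`, which cannot belong to both `c` and `c'`.
      rcases hcone c h1 h2 u hu hup with h6 | h6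
      · rw [h6] at hexp
        have hb1 : b = 1 := hunit b (latticeDet σ.2 (-c₀.2)) hσ2 (by
          rw [← hd', hexp]
          simp only [latticeDet]
          ring)
        have h7 : σ.2 = u := by
          rw [hup, hexp, hb1]
          simp
        have h8 := hB₂ c' h1' h2' h3' h4'
        rw [h7] at h8
        exact hu'.elim h8.1 h8.2
      · rw [h6] at hexp
        have ha1 : a = 1 := hunit a (latticeDet σ.1 (-c₀.2)) hσ1 (by
          rw [← hd', hexp]
          simp only [latticeDet]
          ring)
        have h7 : σ.1 = u := by
          rw [hup, hexp, ha1]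
          simp
        have h8 := hB₁ c h1 h2 h3 h4
        rw [h7] at h8
        exact hu.elim h8.1 h8.2

end SmoothCompleteFan

/-! ## Toric open sets -/

namespace SmoothCompleteFan

variable {F : SmoothCompleteFan}

/-- The open subset of the toric surface given by an open subset of an affine chart. -/
def chartOpens {c : (ℤ × ℤ) × (ℤ × ℤ)} (hc : c ∈ F.cones) (V : Opens (ℂ × ℂ)) :
    Opens F.ToricSurface :=
  ⟨(affineChart hc).source ∩ affineChart hc ⁻¹' V, (affineChart hc).isOpen_inter_preimage V.2⟩

theorem exists_toPoint (p : F.ToricSurface) : ∃ x : F.HomogCoord, x.toPoint = p := Quotient.exists_rep p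

section ChartOpens

variable {c : (ℤ × ℤ) × (ℤ × ℤ)} (hc : c ∈ F.cones)

theorem toPoint_mem_chartOpens (V : Opens (ℂ × ℂ)) (x : F.HomogCoord) :
    x.toPoint ∈ chartOpens hc V ↔ x ∈ F.chartDomain c ∧ F.monomials c x.1 ∈ V :=
  and_congr_left fun _ => F.toPoint_mem_image_chartDomain c x

theorem chartFun_chartCoord (z : ℂ × ℂ) : F.chartFun c (chartCoord hc z).toPoint = z :=
  monomials_coordVec hc z

theorem toPoint_chartCoord_mem_chartOpens (V : Opens (ℂ × ℂ)) (z : ℂ × ℂ) :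
    (chartCoord hc z).toPoint ∈ chartOpens hc V ↔ z ∈ V := by
  rw [toPoint_mem_chartOpens, chartCoord, monomials_coordVec hc z]
  exact and_iff_right (chartCoord_mem_chartDomain hc z)

theorem chartOpens_mono (U V : Opens (ℂ × ℂ)) (h : U ≤ V) : chartOpens hc U ≤ chartOpens hc V :=
  fun _ hx => ⟨hx.1, h hx.2⟩

theorem chartOpens_inf (U V : Opens (ℂ × ℂ)) :
    chartOpens hc U ⊓ chartOpens hc V ≤ chartOpens hc (U ⊓ V) :=
  fun _ hx => ⟨hx.1.1, hx.1.2, hx.2.2⟩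

theorem chartOpens_iSup {ι : Type} (U : ι → Opens (ℂ × ℂ)) :
    chartOpens hc (iSup U) = ⨆ i, chartOpens hc (U i) := by
  ext x
  simp only [chartOpens, SetLike.mem_coe, Opens.mem_iSup, Opens.mem_mk, Set.mem_inter_iff,
    Set.mem_preimage, exists_and_left]

theorem exists_chartOpens_le (U : Opens (ℂ × ℂ)) (z : ℂ × ℂ) (hz : z ∈ U) :
    ∃ y ∈ chartOpens hc U, ∀ V : Opens F.ToricSurface, y ∈ V →
      ∃ W ≤ U, z ∈ W ∧ chartOpens hc W ≤ V := by
  refine ⟨(chartCoord hc z).toPoint, (toPoint_chartCoord_mem_chartOpens hc U z).mpr hz, fun V hV =>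
    ⟨U ⊓ ⟨_, V.2.preimage (F.continuous_toPoint.comp (continuous_chartCoord hc))⟩, inf_le_left,
      ⟨hz, hV⟩, fun y hy => ?_⟩⟩
  have h : (chartCoord hc (F.chartFun c y)).toPoint ∈ V := hy.2.2
  rwa [show (chartCoord hc (F.chartFun c y)).toPoint = y from (affineChart hc).left_inv hy.1] at h

/-- The restriction of a sheaf on the toric surface to an affine chart. -/
noncomputable abbrev chartSections (A : AbSections F.ToricSurface) : AbSections (ℂ × ℂ) :=
  A.comap (chartOpens hc) (chartOpens_mono hc)

/-- The restriction of an exact sequence to an affine chart. -/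
noncomputable abbrev chartSeq {A I G : AbSections F.ToricSurface} (S : FlasqueSeq A I G) :
    FlasqueSeq (chartSections hc A) (chartSections hc I) (chartSections hc G) :=
  S.comap (chartOpens hc) (chartOpens_mono hc) (chartOpens_inf hc) (chartOpens_iSup hc)
    (exists_chartOpens_le hc)

end ChartOpens

/-- The rays at which the homogeneous coordinates of a point vanish. -/
def HomogCoord.zeros (x : F.HomogCoord) : Set (ℤ × ℤ) := {u | ∃ h : u ∈ F.rays, x.1 ⟨u, h⟩ = 0}

theorem mem_chartDomain_iff (c : (ℤ × ℤ) × (ℤ × ℤ)) (x : F.HomogCoord) :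
    x ∈ F.chartDomain c ↔ x.zeros ⊆ {c.1, c.2} := by
  constructor
  · rintro h u ⟨hu, h0⟩
    by_contra h'
    exact h ⟨u, hu⟩ (fun h => h' (Or.inl h)) (fun h => h' (Or.inr h)) h0
  · intro h u h1 h2 h0
    exact (h ⟨u.2, h0⟩).elim h1 h2

/-- The exponents of the first coordinate at the generators are `1` and `0`, those of the second `0`
and `1`, and all other homogeneous coordinates are nonzero on the chart. -/
theorem monomials_ne_zero {c : (ℤ × ℤ) × (ℤ × ℤ)} (hc : c ∈ F.cones) {x : F.HomogCoord}
    (hx : x ∈ F.chartDomain c) : ((F.monomials c x.1).1 ≠ 0 ↔ c.1 ∉ x.zeros) ∧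
      ((F.monomials c x.1).2 ≠ 0 ↔ c.2 ∉ x.zeros) := by
  have hd := F.det_eq_one c hc
  simp only [monomials, Finset.prod_ne_zero_iff, Finset.mem_univ, true_imp_iff]
  refine ⟨⟨?_, fun h u => ?_⟩, ⟨?_, fun h u => ?_⟩⟩
  · rintro h ⟨h1, h0⟩
    refine h ⟨c.1, h1⟩ ?_
    rw [h0, hd, zpow_one]
  · by_cases h1 : u.1 = c.1
    · exact zpow_ne_zero _ fun h0 => h (h1 ▸ ⟨u.2, h0⟩)
    by_cases h2 : u.1 = c.2
    · rw [h2, latticeDet_self, zpow_zero]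
      exact one_ne_zero
    · exact zpow_ne_zero _ (hx u h1 h2)
  · rintro h ⟨h1, h0⟩
    refine h ⟨c.2, h1⟩ ?_
    rw [h0, hd, zpow_one]
  · by_cases h1 : u.1 = c.1
    · rw [h1, latticeDet_self, zpow_zero]
      exact one_ne_zero
    by_cases h2 : u.1 = c.2
    · exact zpow_ne_zero _ fun h0 => h (h2 ▸ ⟨u.2, h0⟩)
    · exact zpow_ne_zero _ (hx u h1 h2)

/-- Toric open sets are described by their admissible sets of vanishing coordinates, so that
comparing them becomes combinatorics of rays. -/
theorem toPoint_mem_chartOpens_coordOpen {c : (ℤ × ℤ) × (ℤ × ℤ)} (hc : c ∈ F.cones) (b b' : Bool)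
    (x : F.HomogCoord) : x.toPoint ∈ chartOpens hc (coordOpen b b') ↔ x.zeros ⊆ {c.1, c.2} ∧
      (b = true → c.1 ∉ x.zeros) ∧ (b' = true → c.2 ∉ x.zeros) := by
  rw [toPoint_mem_chartOpens, ← mem_chartDomain_iff]
  refine and_congr_right fun hx => ?_
  rw [← (monomials_ne_zero hc hx).1, ← (monomials_ne_zero hc hx).2]
  rfl

/-- The union of the affine charts of some cones. -/
def coneOpen (F : SmoothCompleteFan) (B : Finset ((ℤ × ℤ) × (ℤ × ℤ))) : Opens F.ToricSurface :=
  ⟨⋃ c ∈ B, HomogCoord.toPoint '' F.chartDomain c,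
    isOpen_biUnion fun c _ => F.isOpenMap_toPoint _ (F.isOpen_chartDomain c)⟩

theorem toPoint_mem_coneOpen (B : Finset ((ℤ × ℤ) × (ℤ × ℤ))) (x : F.HomogCoord) :
    x.toPoint ∈ F.coneOpen B ↔ ∃ c ∈ B, x.zeros ⊆ {c.1, c.2} := by
  have h : x.toPoint ∈ F.coneOpen B ↔
      x.toPoint ∈ ⋃ c ∈ B, HomogCoord.toPoint '' F.chartDomain c := Iff.rfl
  simp only [h, Set.mem_iUnion, F.toPoint_mem_image_chartDomain, mem_chartDomain_iff, exists_prop]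

theorem opens_ext {U V : Opens F.ToricSurface}
    (h : ∀ x : F.HomogCoord, x.toPoint ∈ U ↔ x.toPoint ∈ V) : U = V := by
  ext p
  obtain ⟨x, rfl⟩ := exists_toPoint p
  exact h x

/-! ### Vanishing of cohomology on toric open sets -/

section Vanishing

variable {E : Type} [NormedAddCommGroup E] [NormedSpace ℂ E] [CompleteSpace E]
  {A I G J Q : AbSections F.ToricSurface}

theorem acyclic_chartOpens (S : FlasqueSeq A I G)
    (M : ∀ c (hc : c ∈ F.cones), HolomorphicModel E (chartSections hc A))
    {c : (ℤ × ℤ) × (ℤ × ℤ)} (hc : c ∈ F.cones) (b b' : Bool) :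
    S.Acyclic (chartOpens hc (coordOpen b b')) :=
  (chartSeq hc S).acyclic_coordOpen (M c hc) b b'

/-- The first cohomology of a toric open set which meets at most one of the divisors vanishes. -/
theorem acyclic_of_zeros (S : FlasqueSeq A I G)
    (M : ∀ c (hc : c ∈ F.cones), HolomorphicModel E (chartSections hc A)) {W : Opens F.ToricSurface}
    (v : ℤ × ℤ) (D : Set (Set (ℤ × ℤ)))
    (hW : ∀ x : F.HomogCoord, x.toPoint ∈ W ↔ ∃ d ∈ D, x.zeros ⊆ d) (hD : ∀ d ∈ D, d ⊆ {v})
    (hv : ∀ d ∈ D, v ∈ d → ∃ c ∈ F.cones, v = c.1 ∨ v = c.2) : S.Acyclic W := by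
  -- If `v` may vanish, `W` is a product of `ℂ` and `ℂˣ` inside a chart; otherwise it is the torus
  -- or empty.
  by_cases hvd : ∃ d ∈ D, v ∈ d
  · obtain ⟨d, hd, hvd⟩ := hvd
    obtain ⟨c, hc, h⟩ := hv d hd hvd
    have hW' : ∀ x : F.HomogCoord, x.toPoint ∈ W ↔ x.zeros ⊆ {v} := fun x => by
      rw [hW]
      exact ⟨fun ⟨d', hd', hx⟩ => hx.trans (hD d' hd'), fun hx =>
        ⟨d, hd, hx.trans (Set.singleton_subset_iff.mpr hvd)⟩⟩
    have hne := fst_ne_snd hc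
    rcases h with rfl | rfl
    · rw [show W = chartOpens hc (coordOpen false true) from opens_ext fun x => ?_]
      · exact acyclic_chartOpens S M hc _ _
      · rw [hW', toPoint_mem_chartOpens_coordOpen]
        refine ⟨fun h => ⟨h.trans (by simp), by simp, fun _ h2 => hne (h h2)⟩, fun h u hu => ?_⟩
        exact (h.1 hu).resolve_right fun h2 => h.2.2 rfl (h2 ▸ hu)
    · rw [show W = chartOpens hc (coordOpen true false) from opens_ext fun x => ?_]
      · exact acyclic_chartOpens S M hc _ _
      · rw [hW', toPoint_mem_chartOpens_coordOpen]
        refine ⟨fun h => ⟨h.trans (by simp), fun _ h2 => hne (h h2).symm, by simp⟩, fun h u hu => ?_⟩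
        exact (h.1 hu).resolve_left fun h2 => h.2.1 rfl (h2 ▸ hu)
  · have hD' : ∀ d ∈ D, d = ∅ := fun d hd => Set.eq_empty_iff_forall_notMem.mpr fun u hu =>
      hvd ⟨d, hd, (hD d hd hu : u = v) ▸ hu⟩
    rcases D.eq_empty_or_nonempty with rfl | ⟨d, hd⟩
    · rw [show W = ⊥ from opens_ext fun x => by simp [hW]]
      exact S.acyclic_bot
    · obtain ⟨c, hc, -⟩ := F.exists_cone_det_nonneg 0
      rw [show W = chartOpens hc (coordOpen true true) from opens_ext fun x => ?_]
      · exact acyclic_chartOpens S M hc _ _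
      · rw [hW, toPoint_mem_chartOpens_coordOpen]
        constructor
        · rintro ⟨d', hd', hx⟩
          rw [hD' d' hd', Set.subset_empty_iff] at hx
          simp [hx]
        · rintro ⟨h1, h2, h3⟩
          refine ⟨d, hd, fun u hu => ?_⟩
          rcases h1 hu with rfl | rfl
          exacts [absurd hu (h2 rfl), absurd hu (h3 rfl)]

theorem toPoint_mem_inf_coneOpen (B B' : Finset ((ℤ × ℤ) × (ℤ × ℤ))) (x : F.HomogCoord) :
    x.toPoint ∈ F.coneOpen B ⊓ F.coneOpen B' ↔
      ∃ d ∈ {d | ∃ c ∈ B, ∃ c' ∈ B', d = ({c.1, c.2} ∩ {c'.1, c'.2} : Set (ℤ × ℤ))}, x.zeros ⊆ d := by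
  have h : x.toPoint ∈ F.coneOpen B ⊓ F.coneOpen B' ↔
    x.toPoint ∈ F.coneOpen B ∧ x.toPoint ∈ F.coneOpen B' := Iff.rfl
  rw [h, toPoint_mem_coneOpen, toPoint_mem_coneOpen]
  constructor
  · rintro ⟨⟨c, hc, h1⟩, c', hc', h2⟩
    exact ⟨_, ⟨c, hc, c', hc', rfl⟩, Set.subset_inter h1 h2⟩
  · rintro ⟨_, ⟨c, hc, c', hc', rfl⟩, h⟩
    exact ⟨⟨c, hc, h.trans Set.inter_subset_left⟩, c', hc', h.trans Set.inter_subset_right⟩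

/-- The charts of two cones meet in the toric open set of their common rays, here at most the ray
`v`. -/
theorem acyclic_inf_coneOpen (S : FlasqueSeq A I G)
    (M : ∀ c (hc : c ∈ F.cones), HolomorphicModel E (chartSections hc A))
    {B B' : Finset ((ℤ × ℤ) × (ℤ × ℤ))} (hB : B ⊆ F.cones) (v : ℤ × ℤ)
    (h : ∀ c ∈ B, ∀ c' ∈ B', ∀ u : ℤ × ℤ, (u = c.1 ∨ u = c.2) → (u = c'.1 ∨ u = c'.2) → u = v) :
    S.Acyclic (F.coneOpen B ⊓ F.coneOpen B') := by
  refine acyclic_of_zeros S M v _ (toPoint_mem_inf_coneOpen B B') ?_ ?_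
  · rintro _ ⟨c, hc, c', hc', rfl⟩ u ⟨hu, hu'⟩
    exact h c hc c' hc' u hu hu'
  · rintro _ ⟨c, hc, c', hc', rfl⟩ ⟨hu, hu'⟩
    exact ⟨c, hB hc, hu⟩

theorem coneOpen_singleton {c : (ℤ × ℤ) × (ℤ × ℤ)} (hc : c ∈ F.cones) :
    F.coneOpen {c} = chartOpens hc (coordOpen false false) :=
  opens_ext fun x => by simp [toPoint_mem_coneOpen, toPoint_mem_chartOpens_coordOpen]

theorem coneOpen_union (B B' : Finset ((ℤ × ℤ) × (ℤ × ℤ))) :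
    F.coneOpen (B ∪ B') = F.coneOpen B ⊔ F.coneOpen B' :=
  opens_ext fun x => by
    have h : x.toPoint ∈ F.coneOpen B ⊔ F.coneOpen B' ↔
      x.toPoint ∈ F.coneOpen B ∨ x.toPoint ∈ F.coneOpen B' := Iff.rfl
    simp only [h, toPoint_mem_coneOpen, Finset.mem_union, or_and_right, exists_or]

/-- The second cohomology vanishes on the union of the charts of cones in a half-plane. -/
theorem acyclic_coneOpen (S : FlasqueSeq A I G) (T : FlasqueSeq G J Q)
    (M : ∀ c (hc : c ∈ F.cones), HolomorphicModel E (chartSections hc A)) (p : ℤ × ℤ) (hp : p ≠ 0)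
    (B : Finset ((ℤ × ℤ) × (ℤ × ℤ))) (hB : B ⊆ F.cones)
    (hp0 : ∀ c ∈ B, 0 ≤ latticeDet p c.1 ∧ 0 ≤ latticeDet p c.2) : T.Acyclic (F.coneOpen B) := by
  induction B using Finset.strongInduction with
  | H B ih =>
    rcases B.eq_empty_or_nonempty with rfl | hne
    · rw [show F.coneOpen ∅ = ⊥ from opens_ext fun x => by simp [toPoint_mem_coneOpen]]
      exact T.acyclic_bot
    -- Split off the last cone: its second ray belongs to no other cone, so its chart meets the rest
    -- along at most the divisor of its first ray.
    · obtain ⟨c, hc, hlast⟩ := F.exists_last_cone p hp B hB hne hp0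
      have h1 := ih (B.erase c) (Finset.erase_ssubset hc) ((Finset.erase_subset _ _).trans hB)
        fun c' hc' => hp0 c' (Finset.mem_of_mem_erase hc')
      rw [← Finset.insert_erase hc, Finset.insert_eq, coneOpen_union]
      refine S.acyclic_sup T ?_ h1 ?_
      · rw [coneOpen_singleton (hB hc)]
        exact (chartSeq (hB hc) S).acyclic_two_coordOpen (chartSeq (hB hc) T) (M c (hB hc)) _ _
      · refine acyclic_inf_coneOpen S M (Finset.singleton_subset_iff.mpr (hB hc)) c.1 ?_
        intro c₁ hc₁ c' hc' u hu hu'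
        rw [Finset.mem_singleton.mp hc₁] at hu
        obtain ⟨h2, h3⟩ := hlast c' (Finset.mem_of_mem_erase hc') (Finset.ne_of_mem_erase hc')
        refine hu.resolve_right fun h => ?_
        rw [h] at hu'
        exact hu'.elim h2 h3

end Vanishing

end SmoothCompleteFan

namespace SmoothCompleteFan

variable {F : SmoothCompleteFan}

/-! ## Holomorphic functions on the toric surface -/

theorem analyticAt_prod_coordVec (c : (ℤ × ℤ) × (ℤ × ℤ)) (k : F.rays → ℤ) (z : ℂ × ℂ)
    (h : ∀ u, F.coordVec c z u ≠ 0 ∨ 0 ≤ k u) :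
    AnalyticAt ℂ (fun z => ∏ u : F.rays, F.coordVec c z u ^ k u) z :=
  ContDiffAt.analyticAt (contDiffAt_prod fun u _ => ContDiffAt.comp z
    (g := fun a : ℂ => a ^ k u) (contDiffAt_zpow _ _ (h u)) (contDiff_coordVec c u).contDiffAt)

theorem coordVec_ne_zero_or {c : (ℤ × ℤ) × (ℤ × ℤ)} (hc : c ∈ F.cones) (z : ℂ × ℂ) {P : F.rays → Prop}
    (h : ∀ u : F.rays, u.1 ∈ (chartCoord hc z).zeros → P u) (u : F.rays) :
    F.coordVec c z u ≠ 0 ∨ P u :=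
  or_iff_not_imp_left.mpr fun h0 => h u ⟨u.2, not_not.mp h0⟩

/-- The transition maps between affine charts are analytic. -/
theorem analyticAt_monomials_coordVec {c c' : (ℤ × ℤ) × (ℤ × ℤ)} (hc : c ∈ F.cones)
    (hc' : c' ∈ F.cones) {z : ℂ × ℂ} (hz : chartCoord hc z ∈ F.chartDomain c') :
    AnalyticAt ℂ (fun z => F.monomials c' (F.coordVec c z)) z := by
  rw [mem_chartDomain_iff] at hz
  exact AnalyticAt.prod
    (analyticAt_prod_coordVec c _ z (coordVec_ne_zero_or hc z fun u hu =>
      (latticeDet_nonneg hc' u.1 (hz hu)).1))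
    (analyticAt_prod_coordVec c _ z (coordVec_ne_zero_or hc z fun u hu =>
      (latticeDet_nonneg hc' u.1 (hz hu)).2))

/-- A function on the toric surface is holomorphic on an open subset if it is so in all affine
charts. -/
def HoloOn {E : Type} [NormedAddCommGroup E] [NormedSpace ℂ E] (V : Opens F.ToricSurface)
    (h : F.ToricSurface → E) : Prop :=
  ∀ c (hc : c ∈ F.cones), AnalyticOnNhd ℂ (fun z => h (chartCoord hc z).toPoint)
    {z | (chartCoord hc z).toPoint ∈ V}

section HoloOn

variable {E : Type} [NormedAddCommGroup E] [NormedSpace ℂ E]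

theorem HoloOn.add {V : Opens F.ToricSurface} {h k : F.ToricSurface → E} (hh : HoloOn V h)
    (hk : HoloOn V k) : HoloOn V fun x => h x + k x := fun c hc => (hh c hc).add (hk c hc)

theorem HoloOn.mono {U V : Opens F.ToricSurface} {h : F.ToricSurface → E} (hh : HoloOn V h)
    (hUV : U ≤ V) : HoloOn U h := fun c hc => (hh c hc).mono fun _ hz => hUV hz

theorem HoloOn.comp_chartFun {c : (ℤ × ℤ) × (ℤ × ℤ)} (hc : c ∈ F.cones) {W : Opens (ℂ × ℂ)}
    {f : ℂ × ℂ → E} (hf : AnalyticOnNhd ℂ f W) {V : Opens F.ToricSurface}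
    (hV : V ≤ chartOpens hc W) : HoloOn V fun x => f (F.chartFun c x) := by
  intro c' hc' z hz
  obtain ⟨h1, h2⟩ := (toPoint_mem_chartOpens hc W _).mp (hV hz)
  exact AnalyticAt.comp (g := f) (f := fun z => F.monomials c (F.coordVec c' z)) (hf _ h2)
    (analyticAt_monomials_coordVec hc' hc h1)

/-- Along `D_p` the inverse coordinates have exponents `-latticeDet p c.2` and `-latticeDet c.1 p`.
The hypotheses make both nonnegative, which means that `-p` lies in the cone `c`. -/
theorem HoloOn.comp_chartFun_inv {c : (ℤ × ℤ) × (ℤ × ℤ)} {f : ℂ × ℂ → E}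
    (hf : AnalyticOnNhd ℂ f Set.univ) {p : ℤ × ℤ} (h₁ : latticeDet p c.2 ≤ 0)
    (h₂ : latticeDet c.1 p ≤ 0) {V : Opens F.ToricSurface}
    (hV : ∀ x : F.HomogCoord, x.toPoint ∈ V → x.zeros ⊆ {p}) :
    HoloOn V fun x => f ((F.chartFun c x).1⁻¹, (F.chartFun c x).2⁻¹) := by
  intro c' hc' z hz
  have hz' := hV _ hz
  refine AnalyticAt.comp (g := f) (f := fun z => ((F.monomials c (F.coordVec c' z)).1⁻¹,
    (F.monomials c (F.coordVec c' z)).2⁻¹)) (hf _ (Set.mem_univ _)) ?_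
  have h := AnalyticAt.prod
    (analyticAt_prod_coordVec c' (fun u => -latticeDet u.1 c.2) z (coordVec_ne_zero_or hc' z
      fun u hu => by rw [show u.1 = p from hz' hu]; omega))
    (analyticAt_prod_coordVec c' (fun u => -latticeDet c.1 u.1) z (coordVec_ne_zero_or hc' z
      fun u hu => by rw [show u.1 = p from hz' hu]; omega))
  simpa only [monomials, zpow_neg, Finset.prod_inv_distrib] using h

end HoloOn

/-- A presentation of the sections of a sheaf over open subsets of the torus by holomorphic
functions. -/
structure TorusModel (E : Type) [NormedAddCommGroup E] [NormedSpace ℂ E]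
    (A : AbSections F.ToricSurface) where
  /-- the section given by a holomorphic function -/
  ofFun : ∀ (V : Opens F.ToricSurface) (h : F.ToricSurface → E), HoloOn V h → A.sec V
  ofFun_add : ∀ V h k hh hk, ofFun V (fun x => h x + k x) (hh.add hk) = ofFun V h hh + ofFun V k hk
  res_ofFun : ∀ {U V} (hUV : U ≤ V) h hh, A.res hUV (ofFun V h hh) = ofFun U h (hh.mono hUV)
  ofFun_congr : ∀ V h k hh hk, (∀ x ∈ V, h x = k x) → ofFun V h hh = ofFun V k hk
  -- Only over the torus must every section arise from a function; elsewhere functions need only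
  -- give sections.
  exists_ofFun : ∀ V, (∀ x : F.HomogCoord, x.toPoint ∈ V → x.zeros = ∅) →
    ∀ s : A.sec V, ∃ h hh, ofFun V h hh = s

variable {E : Type} [NormedAddCommGroup E] [NormedSpace ℂ E] [CompleteSpace E]
  {A I G J Q : AbSections F.ToricSurface}

/-- The three-set cover of the decomposition reduces the claim to splitting a function on the torus
into parts that extend to the pairwise intersections. -/
theorem acyclic_top (S : FlasqueSeq A I G) (T : FlasqueSeq G J Q)
    (M : ∀ c (hc : c ∈ F.cones), HolomorphicModel E (chartSections hc A)) {E' : Type}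
    [NormedAddCommGroup E'] [NormedSpace ℂ E'] [CompleteSpace E'] (N : TorusModel E' A) :
    T.Acyclic ⊤ := by
  obtain ⟨p, hp, σ, hσ, B₁, B₂, hB₁, hB₂, hcov, hp₁, hp₂, hσ₁, hσ₂, hB, hpσ₁, hpσ₂⟩ :=
    F.exists_decomposition
  have htop : (⊤ : Opens F.ToricSurface) = F.coneOpen {σ} ⊔ (F.coneOpen B₁ ⊔ F.coneOpen B₂) := by
    rw [← coneOpen_union, ← coneOpen_union]
    refine opens_ext fun x => ?_
    rw [toPoint_mem_coneOpen]
    refine ⟨fun _ => ?_, fun _ => trivial⟩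
    obtain ⟨c, hc, hx⟩ := x.2
    refine ⟨c, ?_, (mem_chartDomain_iff c x).mp fun u h1 h2 h0 => (hx u h0).elim h1 h2⟩
    simpa using hcov c hc
  have hsub : ({σ} : Finset ((ℤ × ℤ) × (ℤ × ℤ))) ⊆ F.cones := Finset.singleton_subset_iff.mpr hσ
  have hle₁ : F.coneOpen {σ} ⊓ F.coneOpen B₁ ≤ chartOpens hσ (coordOpen true false) := by
    intro q hq
    obtain ⟨x, rfl⟩ := exists_toPoint q
    obtain ⟨_, ⟨c, hc, c', hc', rfl⟩, hx⟩ := (toPoint_mem_inf_coneOpen _ _ x).mp hq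
    rw [Finset.mem_singleton.mp hc] at hx
    exact (toPoint_mem_chartOpens_coordOpen hσ _ _ x).mpr ⟨hx.trans Set.inter_subset_left,
      fun _ h => (hx h).2.elim (hσ₁ c' hc').1 (hσ₁ c' hc').2, by simp⟩
  have hle₂ : F.coneOpen {σ} ⊓ F.coneOpen B₂ ≤ chartOpens hσ (coordOpen false true) := by
    intro q hq
    obtain ⟨x, rfl⟩ := exists_toPoint q
    obtain ⟨_, ⟨c, hc, c', hc', rfl⟩, hx⟩ := (toPoint_mem_inf_coneOpen _ _ x).mp hq
    rw [Finset.mem_singleton.mp hc] at hx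
    exact (toPoint_mem_chartOpens_coordOpen hσ _ _ x).mpr ⟨hx.trans Set.inter_subset_left,
      by simp, fun _ h => (hx h).2.elim (hσ₂ c' hc').1 (hσ₂ c' hc').2⟩
  have hle₃ : ∀ x : F.HomogCoord, x.toPoint ∈ F.coneOpen B₁ ⊓ F.coneOpen B₂ → x.zeros ⊆ {p} := by
    intro x hx u hu
    obtain ⟨_, ⟨c, hc, c', hc', rfl⟩, hx⟩ := (toPoint_mem_inf_coneOpen _ _ x).mp hx
    exact hB c hc c' hc' u (hx hu).1 (hx hu).2
  have hle : F.coneOpen {σ} ⊓ F.coneOpen B₁ ⊓ F.coneOpen B₂ ≤ chartOpens hσ (coordOpen true true) := by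
    intro q hq
    have h1 := hle₁ hq.1
    have h2 := hle₂ ⟨hq.1.1, hq.2⟩
    exact ⟨h1.1, h1.2.1, h2.2.2⟩
  have hzeros : ∀ x : F.HomogCoord, x.toPoint ∈ chartOpens hσ (coordOpen true true) →
      x.zeros = ∅ := by
    intro x hx
    obtain ⟨h1, h2, h3⟩ := (toPoint_mem_chartOpens_coordOpen hσ _ _ x).mp hx
    refine Set.eq_empty_iff_forall_notMem.mpr fun u hu => ?_
    rcases h1 hu with rfl | rfl
    exacts [h2 rfl hu, h3 rfl hu]
  rw [htop]
  refine S.acyclic_sup₃ T ?_ (acyclic_coneOpen S T M (-p) (neg_ne_zero.mpr hp) B₁ hB₁ hp₁)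
    (acyclic_coneOpen S T M p hp B₂ hB₂ hp₂) ?_ ?_ (acyclic_inf_coneOpen S M hB₁ p hB) ?_
  · rw [coneOpen_singleton hσ]
    exact (chartSeq hσ S).acyclic_two_coordOpen (chartSeq hσ T) (M σ hσ) _ _
  · refine acyclic_inf_coneOpen S M hsub σ.2 fun c hc c' hc' u hu hu' => ?_
    rw [Finset.mem_singleton.mp hc] at hu
    refine hu.resolve_left fun h => ?_
    rw [h] at hu'
    exact hu'.elim (hσ₁ c' hc').1 (hσ₁ c' hc').2
  · refine acyclic_inf_coneOpen S M hsub σ.1 fun c hc c' hc' u hu hu' => ?_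
    rw [Finset.mem_singleton.mp hc] at hu
    refine hu.resolve_right fun h => ?_
    rw [h] at hu'
    exact hu'.elim (hσ₂ c' hc').1 (hσ₂ c' hc').2
  · intro f
    obtain ⟨h, hh, rfl⟩ := N.exists_ofFun _ (fun x hx => hzeros x (hle hx)) f
    have hg : ∃ g : ℂ × ℂ → E', AnalyticOnNhd ℂ g (coordOpen true true) ∧
        ∀ x ∈ F.coneOpen {σ} ⊓ F.coneOpen B₁ ⊓ F.coneOpen B₂, h x = g (F.chartFun σ x) := by
      -- Every nonempty union of charts contains the torus. So if the triple intersection is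
      -- nonempty, it is the whole torus and `h` is a function on `coordOpen true true`; if it is
      -- empty, zero will do.
      by_cases hne : ∃ x, x ∈ F.coneOpen {σ} ⊓ F.coneOpen B₁ ⊓ F.coneOpen B₂
      · refine ⟨fun z => h (chartCoord hσ z).toPoint, (hh σ hσ).mono fun z hz => ?_, fun x hx => ?_⟩
        · have hz0 : (chartCoord hσ z).zeros = ∅ :=
            hzeros _ ((toPoint_chartCoord_mem_chartOpens hσ _ z).mpr hz)
          obtain ⟨q, hq⟩ := hne
          obtain ⟨x, rfl⟩ := exists_toPoint q
          obtain ⟨c₁, hc₁, -⟩ := (toPoint_mem_coneOpen _ x).mp hq.1.2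
          obtain ⟨c₂, hc₂, -⟩ := (toPoint_mem_coneOpen _ x).mp hq.2
          refine ⟨⟨?_, ?_⟩, ?_⟩ <;> refine (toPoint_mem_coneOpen _ _).mpr ?_ <;> rw [hz0]
          exacts [⟨σ, by simp, by simp⟩, ⟨c₁, hc₁, by simp⟩, ⟨c₂, hc₂, by simp⟩]
        · have : (chartCoord hσ (F.chartFun σ x)).toPoint = x := (affineChart hσ).left_inv (hle hx).1
          simp only [this]
      · exact ⟨0, analyticOnNhd_const, fun x hx => absurd ⟨x, hx⟩ hne⟩
    obtain ⟨g, hg, hgh⟩ := hg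
    obtain ⟨g₁, g₂, g₃, hg₁, hg₂, hg₃, hadd⟩ := exists_torus_splitting hg
    -- The part regular in the second coordinate goes to `σ ∩ B₁`, the part regular in the first to
    -- `σ ∩ B₂`, and the part in the inverse coordinates to `B₁ ∩ B₂`.
    refine ⟨N.ofFun _ _ (HoloOn.comp_chartFun hσ hg₂ hle₁), N.ofFun _ _ (HoloOn.comp_chartFun hσ hg₁ hle₂),
      N.ofFun _ _ (HoloOn.comp_chartFun_inv hg₃ hpσ₁ hpσ₂ hle₃), ?_⟩
    rw [N.res_ofFun, N.res_ofFun, N.res_ofFun, ← N.ofFun_add, ← N.ofFun_add]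
    refine N.ofFun_congr _ _ _ _ _ fun x hx => ?_
    obtain ⟨h1, h2⟩ := (hle hx).2
    rw [hgh x hx, add_comm (g₂ _)]
    exact hadd _ _ (h1 rfl) (h2 rfl)

end SmoothCompleteFan

namespace SmoothCompleteFan

variable {F : SmoothCompleteFan}

/-! ## Vector fields in the affine charts -/

/-- The cone of the preferred affine chart at a point. -/
noncomputable def coneAt (x : F.ToricSurface) : (ℤ × ℤ) × (ℤ × ℤ) :=
  (exists_mem_affineChart_source x).choose.1

theorem coneAt_mem (x : F.ToricSurface) : coneAt x ∈ F.cones :=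
  (exists_mem_affineChart_source x).choose.2

theorem mem_source_coneAt (x : F.ToricSurface) : x ∈ (affineChart (coneAt_mem x)).source :=
  (exists_mem_affineChart_source x).choose_spec

/-- The transition map between two affine charts. -/
noncomputable def transition (F : SmoothCompleteFan) (c d : (ℤ × ℤ) × (ℤ × ℤ)) (z : ℂ × ℂ) :
    ℂ × ℂ :=
  F.monomials d (F.coordVec c z)

/-! ### Transition maps and components of tangent vectors -/

section Transition

variable {c d e : (ℤ × ℤ) × (ℤ × ℤ)} (hc : c ∈ F.cones) (hd : d ∈ F.cones) (he : e ∈ F.cones)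

theorem toPoint_mem_source_iff (x : F.HomogCoord) :
    x.toPoint ∈ (affineChart hc).source ↔ x ∈ F.chartDomain c :=
  F.toPoint_mem_image_chartDomain c x

theorem toPoint_chartCoord_mem_source (z : ℂ × ℂ) :
    (chartCoord hc z).toPoint ∈ (affineChart hc).source := (affineChart hc).map_target trivial

theorem toPoint_chartCoord_chartFun {x : F.ToricSurface} (hx : x ∈ (affineChart hc).source) :
    (chartCoord hc (F.chartFun c x)).toPoint = x := (affineChart hc).left_inv hx

theorem chartFun_eq_transition {x : F.ToricSurface} (hx : x ∈ (affineChart hc).source) :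
    F.chartFun d x = F.transition c d (F.chartFun c x) := by
  conv_lhs => rw [← toPoint_chartCoord_chartFun hc hx]
  rfl

theorem transition_self (hc : c ∈ F.cones) (z : ℂ × ℂ) : F.transition c c z = z := monomials_coordVec hc z

theorem analyticAt_transition {z : ℂ × ℂ}
    (hz : (chartCoord hc z).toPoint ∈ (affineChart hd).source) :
    AnalyticAt ℂ (F.transition c d) z :=
  analyticAt_monomials_coordVec hc hd ((toPoint_mem_source_iff hd _).mp hz)

theorem continuous_toPoint_chartCoord : Continuous fun z => (chartCoord hc z).toPoint :=
  F.continuous_toPoint.comp (continuous_chartCoord hc)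

theorem eventually_mem_source {z : ℂ × ℂ}
    (hz : (chartCoord hc z).toPoint ∈ (affineChart hd).source) :
    ∀ᶠ w in 𝓝 z, (chartCoord hc w).toPoint ∈ (affineChart hd).source :=
  (continuous_toPoint_chartCoord hc).continuousAt.eventually ((affineChart hd).open_source.mem_nhds hz)

theorem transition_transition {z : ℂ × ℂ}
    (hz : (chartCoord hc z).toPoint ∈ (affineChart hd).source) :
    F.transition d e (F.transition c d z) = F.transition c e z :=
  (chartFun_eq_transition hd hz).symm

theorem fderiv_transition_comp (hc : c ∈ F.cones) (hd : d ∈ F.cones) (he : e ∈ F.cones) {z : ℂ × ℂ}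
    (hz : (chartCoord hc z).toPoint ∈ (affineChart hd).source)
    (hz' : (chartCoord hc z).toPoint ∈ (affineChart he).source) (v : ℂ × ℂ) :
    fderiv ℂ (F.transition d e) (F.transition c d z) (fderiv ℂ (F.transition c d) z v) =
      fderiv ℂ (F.transition c e) z v := by
  have h1 : (chartCoord hd (F.transition c d z)).toPoint ∈ (affineChart he).source := by
    have h := toPoint_chartCoord_chartFun hd hz
    rw [show F.chartFun d (chartCoord hc z).toPoint = F.transition c d z from rfl] at h
    rwa [h]
  have h2 : F.transition d e ∘ F.transition c d =ᶠ[𝓝 z] F.transition c e := by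
    filter_upwards [eventually_mem_source hc hd hz] with w hw
    exact transition_transition hc hd hw
  rw [← h2.fderiv_eq, fderiv_comp z (analyticAt_transition hd he h1).differentiableAt
    (analyticAt_transition hc hd hz).differentiableAt]
  rfl

/-- The component of a tangent vector in an affine chart. -/
noncomputable def chartVec (c : (ℤ × ℤ) × (ℤ × ℤ)) (x : F.ToricSurface) (v : ℂ × ℂ) : ℂ × ℂ :=
  fderiv ℂ (F.transition (coneAt x) c) (F.chartFun (coneAt x) x) v

/-- The tangent vector with given component in an affine chart. -/
noncomputable def ofChartVec (c : (ℤ × ℤ) × (ℤ × ℤ)) (x : F.ToricSurface) (v : ℂ × ℂ) : ℂ × ℂ :=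
  fderiv ℂ (F.transition c (coneAt x)) (F.chartFun c x) v

theorem fderiv_transition_self (hc : c ∈ F.cones) (z v : ℂ × ℂ) : fderiv ℂ (F.transition c c) z v = v := by
  rw [show F.transition c c = id from funext (transition_self hc), fderiv_id]
  rfl

/-- A tangent vector at `x` is stored as its component in the preferred chart at `x`; components in
other charts are related by the chain rule. -/
theorem fderiv_transition_chartVec (hc : c ∈ F.cones) (hd : d ∈ F.cones) {x : F.ToricSurface} (hx : x ∈ (affineChart hc).source)
    (hx' : x ∈ (affineChart hd).source) (v : ℂ × ℂ) :
    fderiv ℂ (F.transition c d) (F.chartFun c x) (chartVec c x v) = chartVec d x v := by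
  have h0 := toPoint_chartCoord_chartFun (coneAt_mem x) (mem_source_coneAt x)
  have h := fderiv_transition_comp (coneAt_mem x) hc hd (z := F.chartFun (coneAt x) x)
    (by rwa [h0]) (by rwa [h0]) v
  rwa [← chartFun_eq_transition (coneAt_mem x) (mem_source_coneAt x)] at h

theorem chartVec_ofChartVec (hc : c ∈ F.cones) {x : F.ToricSurface} (hx : x ∈ (affineChart hc).source) (v : ℂ × ℂ) :
    chartVec c x (ofChartVec c x v) = v := by
  have h0 := toPoint_chartCoord_chartFun hc hx
  have h := fderiv_transition_comp hc (coneAt_mem x) hc (z := F.chartFun c x)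
    (by rw [h0]; exact mem_source_coneAt x) (by rwa [h0]) v
  rwa [← chartFun_eq_transition hc hx, fderiv_transition_self hc] at h

theorem ofChartVec_chartVec (hc : c ∈ F.cones) {x : F.ToricSurface} (hx : x ∈ (affineChart hc).source) (v : ℂ × ℂ) :
    ofChartVec c x (chartVec c x v) = v := by
  refine (fderiv_transition_chartVec hc (coneAt_mem x) hx (mem_source_coneAt x) v).trans ?_
  exact fderiv_transition_self (coneAt_mem x) _ _

/-- Components change by the Jacobian of the transition map, which is analytic, so analyticity may
be tested in any one chart. -/
theorem analyticAt_chartVec (W : F.ToricSurface → ℂ × ℂ) {x : F.ToricSurface}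
    (hx : x ∈ (affineChart hc).source) (hx' : x ∈ (affineChart hd).source)
    (h : AnalyticAt ℂ (fun z => chartVec c (chartCoord hc z).toPoint (W (chartCoord hc z).toPoint))
      (F.chartFun c x)) :
    AnalyticAt ℂ (fun z => chartVec d (chartCoord hd z).toPoint (W (chartCoord hd z).toPoint))
      (F.chartFun d x) := by
  have hc0 := toPoint_chartCoord_chartFun hc hx
  have hd0 := toPoint_chartCoord_chartFun hd hx'
  have h1 : AnalyticAt ℂ (F.transition d c) (F.chartFun d x) :=
    analyticAt_transition hd hc (by rwa [hd0])
  have h2 : AnalyticAt ℂ (fderiv ℂ (F.transition c d)) (F.chartFun c x) :=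
    (analyticAt_transition hc hd (by rwa [hc0])).fderiv
  rw [chartFun_eq_transition hd hx'] at h h2
  have h3 := ((h2.comp h1).contDiffAt.clm_apply (h.comp h1).contDiffAt (n := ω)).analyticAt
  refine h3.congr ?_
  filter_upwards [eventually_mem_source hd hc (z := F.chartFun d x) (by rwa [hd0])] with w hw
  have h4 : (chartCoord hc (F.transition d c w)).toPoint = (chartCoord hd w).toPoint :=
    toPoint_chartCoord_chartFun hc hw
  change fderiv ℂ (F.transition c d) (F.transition d c w)
    (chartVec c (chartCoord hc (F.transition d c w)).toPoint
      (W (chartCoord hc (F.transition d c w)).toPoint)) = _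
  rw [h4]
  exact fderiv_transition_chartVec hc hd hw (toPoint_chartCoord_mem_source hd w) _

/-- Holomorphic functions near a point, read in the preferred chart. -/
theorem contMDiffAt_iff_analyticAt {E : Type} [NormedAddCommGroup E] [NormedSpace ℂ E]
    [CompleteSpace E] (f : F.ToricSurface → E) {x : F.ToricSurface} (hx : x ∈ (affineChart hc).source) :
    ContMDiffAt 𝓘(ℂ, ℂ × ℂ) 𝓘(ℂ, E) ω f x ↔
      AnalyticAt ℂ (fun z => f (chartCoord hc z).toPoint) (F.chartFun c x) := by
  have h := contMDiffWithinAt_iff_source_of_mem_maximalAtlas (I := 𝓘(ℂ, ℂ × ℂ)) (I' := 𝓘(ℂ, E))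
    (n := ω) (f := f) (s := Set.univ) (x := x) (e := affineChart hc)
    (IsManifold.subset_maximalAtlas ⟨⟨c, hc⟩, rfl⟩) hx
  rw [contMDiffWithinAt_univ] at h
  rw [h, contMDiffWithinAt_iff_contDiffWithinAt]
  simp only [OpenPartialHomeomorph.extend_coe, OpenPartialHomeomorph.extend_coe_symm,
    modelWithCornersSelf_coe, modelWithCornersSelf_coe_symm, Set.preimage_univ, Set.range_id,
    Set.inter_univ, contDiffWithinAt_univ]
  exact ⟨fun h => h.analyticAt, fun h => h.contDiffAt⟩

end Transition

/-- A vector field is holomorphic if and only if its components in the affine charts are. -/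
theorem isHolomorphicVectorField_iff_chartVec {U : Opens F.ToricSurface}
    (W : F.ToricSurface → ℂ × ℂ) :
    IsHolomorphicVectorField (E := ℂ × ℂ) (M := F.ToricSurface) (U := U) (fun x => W x) ↔
      ∀ x ∈ U, ∃ c, ∃ hc : c ∈ F.cones, x ∈ (affineChart hc).source ∧
        AnalyticAt ℂ (fun z => chartVec c (chartCoord hc z).toPoint (W (chartCoord hc z).toPoint))
          (F.chartFun c x) := by
  refine (isHolomorphicVectorField_iff _).trans (Subtype.forall.trans ?_)
  refine forall₂_congr fun x hx => ?_
  -- The trivialization of the tangent bundle at `x` reads vectors in the preferred chart at `x`.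
  have h : ∀ y : F.ToricSurface, (trivializationAt (ℂ × ℂ) (TangentSpace 𝓘(ℂ, ℂ × ℂ)) x
      (⟨y, W y⟩ : TangentBundle 𝓘(ℂ, ℂ × ℂ) F.ToricSurface)).2 = chartVec (coneAt x) y (W y) := by
    intro y
    rw [TangentBundle.trivializationAt_apply]
    simp only [modelWithCornersSelf_coe, Set.range_id, fderivWithin_univ]
    rfl
  simp only [h]
  rw [contMDiffAt_subtype_iff (f := fun y => chartVec (coneAt x) y (W y)) (x := ⟨x, hx⟩),
    contMDiffAt_iff_analyticAt (coneAt_mem x) _ (mem_source_coneAt x)]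
  refine ⟨fun h => ⟨_, _, mem_source_coneAt x, h⟩, ?_⟩
  rintro ⟨c, hc, h1, h2⟩
  exact analyticAt_chartVec hc (coneAt_mem x) W h1 (mem_source_coneAt x) h2

/-- The extension of a section by zero. -/
noncomputable def extendZero {U : Opens F.ToricSurface}
    (V : (x : U) → TangentSpace 𝓘(ℂ, ℂ × ℂ) (x : F.ToricSurface)) (x : F.ToricSurface) : ℂ × ℂ :=
  open Classical in if h : x ∈ U then V ⟨x, h⟩ else 0

theorem extendZero_apply {U : Opens F.ToricSurface}
    (V : (x : U) → TangentSpace 𝓘(ℂ, ℂ × ℂ) (x : F.ToricSurface)) (x : U) :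
    extendZero V x = V x := dif_pos x.2

theorem analyticAt_chartVec_extendZero {U : Opens F.ToricSurface}
    {V : (x : U) → TangentSpace 𝓘(ℂ, ℂ × ℂ) (x : F.ToricSurface)}
    (hV : IsHolomorphicVectorField V) {c : (ℤ × ℤ) × (ℤ × ℤ)} (hc : c ∈ F.cones)
    {z : ℂ × ℂ} (hz : (chartCoord hc z).toPoint ∈ U) :
    AnalyticAt ℂ (fun z => chartVec c (chartCoord hc z).toPoint
      (extendZero V (chartCoord hc z).toPoint)) z := by
  have hV : IsHolomorphicVectorField (E := ℂ × ℂ) (M := F.ToricSurface) (U := U) (fun x => extendZero V x) := by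
    rwa [funext (extendZero_apply V)]
  obtain ⟨d, hd, h1, h2⟩ := (isHolomorphicVectorField_iff_chartVec _).mp hV _ hz
  have h := analyticAt_chartVec hd hc _ h1 (toPoint_chartCoord_mem_source hc z) h2
  rwa [chartFun_chartCoord] at h

end SmoothCompleteFan

namespace SmoothCompleteFan

variable {F : SmoothCompleteFan}

/-! ## Logarithmic vector fields -/

/-- The components, in the affine chart of a cone, of the vector field which is given by an element
of `N ⊗ ℂ`. -/
noncomputable def logVec (c : (ℤ × ℤ) × (ℤ × ℤ)) (n z : ℂ × ℂ) : ℂ × ℂ :=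
  ((n.1 * c.2.2 - n.2 * c.2.1) * z.1, (c.1.1 * n.2 - c.1.2 * n.1) * z.2)

/-- The flow, in the affine chart of a cone, of the vector field which is given by an element
of `N ⊗ ℂ`. -/
noncomputable def logFlow (c : (ℤ × ℤ) × (ℤ × ℤ)) (n z : ℂ × ℂ) (t : ℂ) : ℂ × ℂ :=
  (Complex.exp ((n.1 * c.2.2 - n.2 * c.2.1) * t) * z.1,
    Complex.exp ((c.1.1 * n.2 - c.1.2 * n.1) * t) * z.2)

theorem logFlow_zero (c : (ℤ × ℤ) × (ℤ × ℤ)) (n z : ℂ × ℂ) : logFlow c n z 0 = z := by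
  simp [logFlow]

theorem hasDerivAt_logFlow (c : (ℤ × ℤ) × (ℤ × ℤ)) (n z : ℂ × ℂ) :
    HasDerivAt (logFlow c n z) (logVec c n z) 0 := by
  have h : ∀ a b : ℂ, HasDerivAt (fun t => Complex.exp (a * t) * b) (a * b) 0 := by
    intro a b
    have h := (((hasDerivAt_id (0 : ℂ)).const_mul a).cexp).mul_const b
    simpa using h
  exact (h _ _).prodMk (h _ _)

theorem coordVec_mul (c : (ℤ × ℤ) × (ℤ × ℤ)) (z w : ℂ × ℂ) (u : F.rays) :
    F.coordVec c (z * w) u = F.coordVec c z u * F.coordVec c w u := by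
  simp only [coordVec, Prod.fst_mul, Prod.snd_mul]
  split_ifs <;> simp

theorem transition_mul (c d : (ℤ × ℤ) × (ℤ × ℤ)) (z w : ℂ × ℂ) :
    F.transition c d (z * w) = F.transition c d z * F.transition c d w := by
  simp only [transition, monomials, coordVec_mul, mul_zpow, Finset.prod_mul_distrib, Prod.mk_mul_mk]

theorem prod_coordVec_zpow {c : (ℤ × ℤ) × (ℤ × ℤ)} (hc : c ∈ F.cones) (z : ℂ × ℂ)
    (k : (ℤ × ℤ) → ℤ) :
    ∏ u : F.rays, F.coordVec c z u ^ k u.1 = z.1 ^ k c.1 * z.2 ^ k c.2 := by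
  rw [Finset.prod_eq_mul (⟨c.1, F.mem_rays_left hc⟩ : F.rays) ⟨c.2, F.mem_rays_right hc⟩
    (fun h => fst_ne_snd hc (Subtype.ext_iff.mp h).symm) ?_ (fun h => absurd (Finset.mem_univ _) h)
    (fun h => absurd (Finset.mem_univ _) h), coordVec_fst hc, coordVec_snd hc]
  rintro u - ⟨h1, h2⟩
  rw [coordVec_other _ (fun h => h1 (Subtype.ext h)) (fun h => h2 (Subtype.ext h)), one_zpow]

/-- The flow is multiplication by a one-parameter subgroup of the torus, and monomial maps are
multiplicative. The exponents match by Cramer's rule, since the generators of `c` have determinant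
`1`. -/
theorem transition_logFlow {c : (ℤ × ℤ) × (ℤ × ℤ)} (hc : c ∈ F.cones) (d : (ℤ × ℤ) × (ℤ × ℤ))
    (n z : ℂ × ℂ) (t : ℂ) :
    F.transition c d (logFlow c n z t) = logFlow d n (F.transition c d z) t := by
  have h : ∀ n z, logFlow c n z t = logFlow c n 1 t * z := fun n z => by
    simp [logFlow, Prod.ext_iff]
  have hdet : (c.1.1 * c.2.2 - c.1.2 * c.2.1 : ℂ) = 1 := by
    exact_mod_cast congrArg (Int.cast : ℤ → ℂ) (F.det_eq_one c hc)
  rw [h, transition_mul]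
  refine Prod.ext ?_ ?_
  · refine congrArg₂ (· * ·) ((prod_coordVec_zpow hc _ fun u => latticeDet u d.2).trans ?_) rfl
    simp only [logFlow, Prod.fst_one, Prod.snd_one, mul_one, ← Complex.exp_int_mul,
      ← Complex.exp_add, latticeDet]
    congr 1
    push_cast
    linear_combination (n.1 * d.2.2 - n.2 * d.2.1) * t * hdet
  · refine congrArg₂ (· * ·) ((prod_coordVec_zpow hc _ fun u => latticeDet d.1 u).trans ?_) rfl
    simp only [logFlow, Prod.fst_one, Prod.snd_one, mul_one, ← Complex.exp_int_mul,
      ← Complex.exp_add, latticeDet]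
    congr 1
    push_cast
    linear_combination (d.1.1 * n.2 - d.1.2 * n.1) * t * hdet

/-- Differentiating the equivariance of the flow at time zero shows that the local fields of an
element of `N ⊗ ℂ` patch together. -/
theorem fderiv_transition_logVec {c d : (ℤ × ℤ) × (ℤ × ℤ)} (hc : c ∈ F.cones) (hd : d ∈ F.cones)
    {z : ℂ × ℂ} (hz : (chartCoord hc z).toPoint ∈ (affineChart hd).source) (n : ℂ × ℂ) :
    fderiv ℂ (F.transition c d) z (logVec c n z) = logVec d n (F.transition c d z) := by
  have h1 := (analyticAt_transition hc hd hz).differentiableAt.hasFDerivAt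
  have h2 := hasDerivAt_logFlow c n z
  rw [← logFlow_zero c n z] at h1
  have h3 := h1.comp_hasDerivAt 0 h2
  rw [logFlow_zero] at h3
  rw [funext (f := F.transition c d ∘ logFlow c n z) (transition_logFlow hc d n z)] at h3
  exact h3.unique (hasDerivAt_logFlow d n _)

/-- The vector field given by a function with values in `N ⊗ ℂ`. -/
noncomputable def logField (h : F.ToricSurface → ℂ × ℂ) (x : F.ToricSurface) : ℂ × ℂ :=
  logVec (coneAt x) (h x) (F.chartFun (coneAt x) x)

theorem chartVec_logField (h : F.ToricSurface → ℂ × ℂ) {c : (ℤ × ℤ) × (ℤ × ℤ)} (hc : c ∈ F.cones)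
    {x : F.ToricSurface} (hx : x ∈ (affineChart hc).source) :
    chartVec c x (logField h x) = logVec c (h x) (F.chartFun c x) := by
  rw [chartFun_eq_transition (coneAt_mem x) (mem_source_coneAt x)]
  refine fderiv_transition_logVec (coneAt_mem x) hc ?_ _
  rwa [toPoint_chartCoord_chartFun _ (mem_source_coneAt x)]

theorem HoloOn.isHolomorphicVectorField_logField {V : Opens F.ToricSurface}
    {h : F.ToricSurface → ℂ × ℂ} (hh : HoloOn V h) :
    IsHolomorphicVectorField (E := ℂ × ℂ) (M := F.ToricSurface) (U := V) (fun x => logField h x) := by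
  refine (isHolomorphicVectorField_iff_chartVec _).mpr fun x hx =>
    ⟨coneAt x, coneAt_mem x, mem_source_coneAt x, ?_⟩
  have h0 := toPoint_chartCoord_chartFun (coneAt_mem x) (mem_source_coneAt x)
  have h1 := hh _ (coneAt_mem x) (F.chartFun (coneAt x) x) (by rwa [Set.mem_ofPred_eq, h0])
  simp only [chartVec_logField h (coneAt_mem x) (toPoint_chartCoord_mem_source (coneAt_mem x) _),
    chartFun_chartCoord, logVec]
  have h2 := analyticAt_fst.comp h1
  have h3 := analyticAt_snd.comp h1
  exact (((h2.mul analyticAt_const).sub (h3.mul analyticAt_const)).mul analyticAt_fst).prod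
    (((analyticAt_const.mul h3).sub (analyticAt_const.mul h2)).mul analyticAt_snd)

theorem toPoint_mem_toricBoundary (x : F.HomogCoord) :
    x.toPoint ∈ F.toricBoundary ↔ x.zeros.Nonempty := by
  simp only [toricBoundary, rayDivisor, Set.mem_iUnion, Set.mem_ofPred_eq]
  constructor
  · rintro ⟨u, y, hy, h0⟩
    obtain ⟨t, rfl⟩ := (F.toPoint_eq_iff y x).mp hy
    rw [smul_val] at h0
    exact ⟨u.1, u.2, (mul_eq_zero.mp h0).resolve_left (Units.ne_zero _)⟩
  · rintro ⟨u, hu, h0⟩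
    exact ⟨⟨u, hu⟩, x, rfl, h0⟩

theorem toPoint_chartCoord_mem_toricBoundary {c : (ℤ × ℤ) × (ℤ × ℤ)} (hc : c ∈ F.cones)
    (z : ℂ × ℂ) : (chartCoord hc z).toPoint ∈ F.toricBoundary ↔ z.1 * z.2 = 0 := by
  have h := monomials_ne_zero hc (chartCoord_mem_chartDomain hc z)
  have h' := (mem_chartDomain_iff c _).mp (chartCoord_mem_chartDomain hc z)
  rw [show F.monomials c (chartCoord hc z).1 = z from monomials_coordVec hc z] at h
  rw [toPoint_mem_toricBoundary, mul_eq_zero, ← not_iff_not, not_or, ← ne_eq, ← ne_eq, h.1, h.2,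
    Set.not_nonempty_iff_eq_empty]
  refine ⟨fun h => by simp [h], fun ⟨h1, h2⟩ => Set.eq_empty_iff_forall_notMem.mpr fun u hu => ?_⟩
  rcases h' hu with rfl | rfl
  exacts [h1 hu, h2 hu]

theorem mfderiv_apply {c : (ℤ × ℤ) × (ℤ × ℤ)} (hc : c ∈ F.cones) {x : F.ToricSurface}
    (hx : x ∈ (affineChart hc).source) {f : F.ToricSurface → ℂ}
    (hf : ContMDiffAt 𝓘(ℂ, ℂ × ℂ) 𝓘(ℂ, ℂ) ω f x) (v : ℂ × ℂ) :
    mfderiv 𝓘(ℂ, ℂ × ℂ) 𝓘(ℂ, ℂ) f x v =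
      fderiv ℂ (fun z => f (chartCoord hc z).toPoint) (F.chartFun c x) (chartVec c x v) := by
  have hd := mem_source_coneAt x
  have h0 := toPoint_chartCoord_chartFun (coneAt_mem x) hd
  have h1 : mfderiv 𝓘(ℂ, ℂ × ℂ) 𝓘(ℂ, ℂ) f x v = fderiv ℂ
      (fun z => f (chartCoord (coneAt_mem x) z).toPoint) (F.chartFun (coneAt x) x) v := by
    have h := (hf.mdifferentiableAt (by simp)).mfderiv
    simp only [modelWithCornersSelf_coe, Set.range_id, fderivWithin_univ] at h
    exact DFunLike.congr_fun h v
  have h2 := ((contMDiffAt_iff_analyticAt hc f hx).mp hf).differentiableAt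
  have h3 : AnalyticAt ℂ (F.transition (coneAt x) c) (F.chartFun (coneAt x) x) :=
    analyticAt_transition (coneAt_mem x) hc (by rwa [h0])
  refine h1.trans ?_
  rw [chartFun_eq_transition (d := c) (coneAt_mem x) hd] at h2 ⊢
  have h4 := fderiv_comp _ h2 h3.differentiableAt
  have h5 : (fun z => f (chartCoord hc z).toPoint) ∘ F.transition (coneAt x) c =ᶠ[𝓝 (F.chartFun (coneAt x) x)]
      fun z => f (chartCoord (coneAt_mem x) z).toPoint := by
    filter_upwards [eventually_mem_source (coneAt_mem x) hc (z := F.chartFun (coneAt x) x)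
      (by rwa [h0])] with w hw
    exact congrArg f (toPoint_chartCoord_chartFun hc hw)
  rw [← h5.fderiv_eq, h4]
  rfl

/-- The flow preserves the toric boundary. A function vanishing on the boundary is therefore zero
along the flow line through a boundary point, and so is its derivative. -/
theorem preservesIdeal_logField (h : F.ToricSurface → ℂ × ℂ) (V : Opens F.ToricSurface) :
    PreservesIdeal (E := ℂ × ℂ) (M := F.ToricSurface) (U := V) F.toricBoundary
      (fun x => logField h x) := by
  rintro W - f hf hf0 ⟨x, hxV⟩ hxW hxD
  change x ∈ W at hxW
  obtain ⟨c, hc, hx⟩ : ∃ c, ∃ hc : c ∈ F.cones, x ∈ (affineChart hc).source :=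
    ⟨_, _, mem_source_coneAt x⟩
  have hfx : ContMDiffAt 𝓘(ℂ, ℂ × ℂ) 𝓘(ℂ, ℂ) ω f x := (hf x hxW).contMDiffAt (W.2.mem_nhds hxW)
  have hx0 := toPoint_chartCoord_chartFun hc hx
  refine (mfderiv_apply hc hx hfx _).trans ?_
  rw [chartVec_logField h hc hx]
  set z := F.chartFun c x
  have h1 := ((contMDiffAt_iff_analyticAt hc f hx).mp hfx).differentiableAt.hasFDerivAt
  have h2 := hasDerivAt_logFlow c (h x) z
  have h3 : Filter.Tendsto (logFlow c (h x) z) (𝓝 0) (𝓝 z) := by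
    have := h2.continuousAt.tendsto
    rwa [logFlow_zero] at this
  have h4 := HasFDerivAt.comp_hasDerivAt (0 : ℂ) (l' := fderiv ℂ (fun z => f (chartCoord hc z).toPoint) z)
    (by rw [logFlow_zero]; exact h1) h2
  have h5 : (fun z => f (chartCoord hc z).toPoint) ∘ logFlow c (h x) z =ᶠ[𝓝 0] fun _ => 0 := by
    have hW : ∀ᶠ w in 𝓝 z, (chartCoord hc w).toPoint ∈ W :=
      (continuous_toPoint_chartCoord hc).continuousAt.eventually (W.2.mem_nhds (show (chartCoord hc z).toPoint ∈ W by rwa [hx0]))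
    filter_upwards [h3.eventually hW] with t ht
    refine hf0 _ ht ((toPoint_chartCoord_mem_toricBoundary hc _).mpr ?_)
    have hz : z.1 * z.2 = 0 :=
      (toPoint_chartCoord_mem_toricBoundary hc z).mp (hx0.symm ▸ hxD)
    rw [logFlow, mul_mul_mul_comm, hz, mul_zero]
  exact h4.unique (h5.hasDerivAt_iff.mpr (hasDerivAt_const _ _))

end SmoothCompleteFan

/-! ## Division by a coordinate -/

open Metric in
/-- A holomorphic function which vanishes where the first coordinate vanishes is divisible by it. -/
theorem AnalyticOnNhd.exists_eq_fst_mul {W : Set (ℂ × ℂ)} (hW : IsOpen W) {f : ℂ × ℂ → ℂ}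
    (hf : AnalyticOnNhd ℂ f W) (h0 : ∀ w, (0, w) ∈ W → f (0, w) = 0) :
    ∃ a, AnalyticOnNhd ℂ a W ∧ ∀ z ∈ W, f z = z.1 * a z := by
  refine ⟨fun z => if z.1 = 0 then deriv (fun ζ => f (ζ, z.2)) 0 else z.1⁻¹ * f z, ?_, ?_⟩
  · rintro ⟨z₀, w₀⟩ hz
    by_cases hz₀ : z₀ = 0
    · subst hz₀
      obtain ⟨ρ, hρ, hρW⟩ : ∃ r > 0, closedBall (0 : ℂ) r ×ˢ closedBall w₀ r ⊆ W := by
        obtain ⟨r, hr, h⟩ := Metric.nhds_basis_closedBall.mem_iff.mp (hW.mem_nhds hz)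
        exact ⟨r, hr, by rwa [closedBall_prod_same]⟩
      -- Near the axis the quotient is the Cauchy integral of `f ζ / ζ` over a small circle: by the
      -- removable singularity theorem in each slice, the slope of `f` at `0` satisfies Cauchy's
      -- formula.
      have h1 : AnalyticOnNhd ℂ (fun p : ℂ × ℂ => p.1⁻¹ * f p) (sphere 0 ρ ×ˢ ball w₀ ρ) :=
        fun p hp => (analyticAt_fst.inv (ne_of_mem_sphere hp.1 hρ.ne')).mul
          (hf p (hρW ⟨sphere_subset_closedBall hp.1, ball_subset_closedBall hp.2⟩))
      have h2 := analyticOnNhd_cauchyFst hρ h1 subset_rfl isOpen_ball (Ω := ball 0 ρ) isOpen_ball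
        fun z hz => (mem_ball_zero_iff.mp hz).ne
      refine (h2 (0, w₀) ⟨mem_ball_self hρ, mem_ball_self hρ⟩).congr ?_
      filter_upwards [(isOpen_ball.prod isOpen_ball).mem_nhds
        (⟨mem_ball_self hρ, mem_ball_self hρ⟩ : ((0 : ℂ), w₀) ∈ ball 0 ρ ×ˢ ball w₀ ρ)]
      rintro ⟨z, w⟩ ⟨hz, hw⟩
      have hf0 : f (0, w) = 0 := h0 w (hρW ⟨mem_closedBall_self hρ.le, ball_subset_closedBall hw⟩)
      have hval : ∀ ζ, dslope (fun ζ => f (ζ, w)) 0 ζ =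
          if ζ = 0 then deriv (fun ζ => f (ζ, w)) 0 else ζ⁻¹ * f (ζ, w) := by
        intro ζ
        split_ifs with hζ
        · rw [hζ, dslope_same]
        · rw [dslope_of_ne _ hζ, slope_def_field, hf0, sub_zero, sub_zero, div_eq_inv_mul]
      have hd : DifferentiableOn ℂ (dslope (fun ζ => f (ζ, w)) 0) (closedBall 0 ρ) :=
        (Complex.differentiableOn_dslope (closedBall_mem_nhds _ hρ)).mpr fun ζ hζ =>
          ((hf (ζ, w) (hρW ⟨hζ, ball_subset_closedBall hw⟩)).differentiableAt.comp ζ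
            (by fun_prop : DifferentiableAt ℂ (fun t => (t, w)) ζ)).differentiableWithinAt
      have hint := (hd.mono closure_ball_subset_closedBall).diffContOnCl.two_pi_i_inv_smul_circleIntegral_sub_inv_smul hz
      rw [hval] at hint
      refine Eq.trans ?_ hint
      rw [cauchyFst]
      congr 1
      refine circleIntegral.integral_congr hρ.le fun ζ hζ => ?_
      change _ = (ζ - z)⁻¹ • dslope _ 0 ζ
      rw [hval, if_neg (ne_of_mem_sphere hζ hρ.ne')]
    · refine ((analyticAt_fst.inv hz₀).mul (hf _ hz)).congr ?_
      filter_upwards [(isOpen_ne.preimage continuous_fst).mem_nhds hz₀] with p hp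
      exact (if_neg hp).symm
  · rintro ⟨z, w⟩ hz
    dsimp only
    split_ifs with h
    · rw [h, h0 w (h ▸ hz), zero_mul]
    · rw [mul_inv_cancel_left₀ h]

/-- A holomorphic function which vanishes where the second coordinate vanishes is divisible by
it. -/
theorem AnalyticOnNhd.exists_eq_snd_mul {W : Set (ℂ × ℂ)} (hW : IsOpen W) {f : ℂ × ℂ → ℂ}
    (hf : AnalyticOnNhd ℂ f W) (h0 : ∀ z, (z, 0) ∈ W → f (z, 0) = 0) :
    ∃ a, AnalyticOnNhd ℂ a W ∧ ∀ z ∈ W, f z = z.2 * a z := by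
  have hs : ∀ z : ℂ × ℂ, AnalyticAt ℂ Prod.swap z := fun z => analyticAt_snd.prod analyticAt_fst
  obtain ⟨a, ha, h⟩ := AnalyticOnNhd.exists_eq_fst_mul (hW.preimage continuous_swap)
    (f := fun z => f z.swap) (fun z hz => (hf _ hz).comp (hs z)) h0
  refine ⟨fun z => a z.swap, fun z hz => ?_, fun z hz => h z.swap hz⟩
  exact AnalyticAt.comp (g := a) (f := Prod.swap) (ha _ hz) (hs z)

/-- A holomorphic vector field whose derivative of the product of the coordinates vanishes on the
coordinate axes is a combination of the logarithmic coordinate vector fields. -/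
theorem exists_eq_logarithmic {W : Set (ℂ × ℂ)} (hW : IsOpen W) {f : ℂ × ℂ → ℂ × ℂ}
    (hf : AnalyticOnNhd ℂ f W) (h0 : ∀ z ∈ W, z.1 * z.2 = 0 → z.1 * (f z).2 + z.2 * (f z).1 = 0) :
    ∃ a : ℂ × ℂ → ℂ × ℂ, AnalyticOnNhd ℂ a W ∧ ∀ z ∈ W, f z = (z.1 * (a z).1, z.2 * (a z).2) := by
  -- On an axis the hypothesis only gives a coordinate times a component equal to zero; continuity
  -- gives the vanishing of the component at the origin as well.
  have key : ∀ {O : Set ℂ} {g : ℂ → ℂ}, IsOpen O → ContinuousOn g O →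
      (∀ w ∈ O, w ≠ 0 → g w = 0) → ∀ w ∈ O, g w = 0 := by
    intro O g hO hg h w hw
    by_contra hne
    have hw0 : w = 0 := by
      by_contra h'
      exact hne (h w hw h')
    subst hw0
    have h1 : ∀ᶠ v in 𝓝 (0 : ℂ), g v ≠ 0 ∧ v ∈ O :=
      (((hg 0 hw).continuousAt (hO.mem_nhds hw)).eventually_ne hne).and (hO.mem_nhds hw)
    obtain ⟨v, hv, hv0⟩ := ((h1.filter_mono nhdsWithin_le_nhds).and
      (self_mem_nhdsWithin : {(0 : ℂ)}ᶜ ∈ 𝓝[≠] (0 : ℂ))).exists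
    exact hv.1 (h v hv.2 hv0)
  obtain ⟨a, ha, ha'⟩ := AnalyticOnNhd.exists_eq_fst_mul hW (f := fun z => (f z).1)
    (fun z hz => analyticAt_fst.comp (hf z hz))
    (key (O := {w | (0, w) ∈ W}) (g := fun w => (f (0, w)).1)
      (hW.preimage (by fun_prop : Continuous fun w : ℂ => ((0 : ℂ), w)))
      (continuous_fst.comp_continuousOn (hf.continuousOn.comp (by fun_prop) fun w hw => hw))
      fun w hw hw0 => by simpa [hw0] using h0 (0, w) hw (by simp))
  obtain ⟨b, hb, hb'⟩ := AnalyticOnNhd.exists_eq_snd_mul hW (f := fun z => (f z).2)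
    (fun z hz => analyticAt_snd.comp (hf z hz))
    (key (O := {w | (w, 0) ∈ W}) (g := fun w => (f (w, 0)).2)
      (hW.preimage (by fun_prop : Continuous fun w : ℂ => (w, (0 : ℂ))))
      (continuous_snd.comp_continuousOn (hf.continuousOn.comp (by fun_prop) fun w hw => hw))
      fun w hw hw0 => by simpa [hw0] using h0 (w, 0) hw (by simp))
  exact ⟨fun z => (a z, b z), fun z hz => (ha z hz).prod (hb z hz),
    fun z hz => Prod.ext (ha' z hz) (hb' z hz)⟩

namespace SmoothCompleteFan

variable {F : SmoothCompleteFan}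

/-! ## Presentations of vector fields by functions -/

theorem ofChartVec_add (c : (ℤ × ℤ) × (ℤ × ℤ)) (x : F.ToricSurface) (v w : ℂ × ℂ) :
    ofChartVec c x (v + w) = ofChartVec c x v + ofChartVec c x w := map_add _ _ _

theorem logField_add (h k : F.ToricSurface → ℂ × ℂ) (x : F.ToricSurface) :
    logField (fun x => h x + k x) x = logField h x + logField k x := by
  simp only [logField, logVec, Prod.fst_add, Prod.snd_add, Prod.mk_add_mk]
  exact Prod.ext (by ring) (by ring)

theorem logField_congr {h k : F.ToricSurface → ℂ × ℂ} {x : F.ToricSurface} (hx : h x = k x) :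
    logField h x = logField k x := by rw [logField, hx, logField]

/-- In an affine chart, a holomorphic vector field that preserves the ideal of the toric boundary
is given by a holomorphic function with values in `N ⊗ ℂ`. -/
theorem exists_eq_logField {c : (ℤ × ℤ) × (ℤ × ℤ)} (hc : c ∈ F.cones) {U : Opens F.ToricSurface}
    (hU : U ≤ chartOpens hc ⊤) {V : (x : U) → TangentSpace 𝓘(ℂ, ℂ × ℂ) (x : F.ToricSurface)}
    (hV : IsHolomorphicVectorField V) (hV' : PreservesIdeal F.toricBoundary V) :
    ∃ h : F.ToricSurface → ℂ × ℂ, HoloOn U h ∧ ∀ x : U, logField h x = V x := by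
  let W : Opens (ℂ × ℂ) := ⟨{z | (chartCoord hc z).toPoint ∈ U},
    U.2.preimage (continuous_toPoint_chartCoord hc)⟩
  let f : ℂ × ℂ → ℂ × ℂ := fun z => chartVec c (chartCoord hc z).toPoint
    (extendZero V (chartCoord hc z).toPoint)
  have hf : AnalyticOnNhd ℂ f W := fun z hz => analyticAt_chartVec_extendZero hV hc hz
  -- Test the condition on the product of the two coordinates, the equation of the boundary in this
  -- chart.
  obtain ⟨a, ha, hfa⟩ := exists_eq_logarithmic W.2 hf fun z hz hz0 => by
    have hfun : (fun z => (F.chartFun c (chartCoord hc z).toPoint).1 *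
        (F.chartFun c (chartCoord hc z).toPoint).2) = fun z : ℂ × ℂ => z.1 * z.2 := by
      simp only [chartFun_chartCoord]
    have hsm : ∀ x ∈ U, ContMDiffAt 𝓘(ℂ, ℂ × ℂ) 𝓘(ℂ, ℂ) ω
        (fun x => (F.chartFun c x).1 * (F.chartFun c x).2) x := by
      intro x hx
      rw [contMDiffAt_iff_analyticAt hc _ (hU hx).1, hfun]
      exact analyticAt_fst.mul analyticAt_snd
    have h1 := hV' U le_rfl _ (fun x hx => (hsm x hx).contMDiffWithinAt) (fun x hx hxD => by
      rw [← toPoint_chartCoord_chartFun hc (hU hx).1, toPoint_chartCoord_mem_toricBoundary] at hxD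
      exact hxD) ⟨_, hz⟩ hz ((toPoint_chartCoord_mem_toricBoundary hc z).mpr hz0)
    have h2 := (mfderiv_apply hc (toPoint_chartCoord_mem_source hc z) (hsm _ hz) _).symm.trans h1
    rw [hfun, chartFun_chartCoord, ← extendZero_apply V] at h2
    have h3 : HasFDerivAt (fun z : ℂ × ℂ => z.1 * z.2) _ z :=
      (hasFDerivAt_fst (𝕜 := ℂ) (p := z)).mul (hasFDerivAt_snd (𝕜 := ℂ) (p := z))
    exact (DFunLike.congr_fun h3.fderiv (f z)).symm.trans h2
  -- The logarithmic components are coordinates with respect to the generators of the cone; `n` is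
  -- the corresponding element of `N ⊗ ℂ`.
  let n : ℂ × ℂ → ℂ × ℂ := fun z => ((a z).1 * c.1.1 + (a z).2 * c.2.1,
    (a z).1 * c.1.2 + (a z).2 * c.2.2)
  refine ⟨fun x => n (F.chartFun c x), HoloOn.comp_chartFun hc (W := W) ?_ ?_, ?_⟩
  · intro z hz
    have h1 := analyticAt_fst.comp (ha z hz)
    have h2 := analyticAt_snd.comp (ha z hz)
    exact ((h1.mul analyticAt_const).add (h2.mul analyticAt_const)).prod
      ((h1.mul analyticAt_const).add (h2.mul analyticAt_const))
  · intro x hx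
    exact ⟨(hU hx).1, show (chartCoord hc (F.chartFun c x)).toPoint ∈ U by
      rwa [toPoint_chartCoord_chartFun hc (hU hx).1]⟩
  · rintro ⟨x, hx⟩
    have hx' := (hU hx).1
    have h0 := toPoint_chartCoord_chartFun hc hx'
    have hdet : (c.1.1 * c.2.2 - c.1.2 * c.2.1 : ℂ) = 1 := by
      exact_mod_cast congrArg (Int.cast : ℤ → ℂ) (F.det_eq_one c hc)
    have h1 := hfa (F.chartFun c x) (show _ ∈ U by rwa [h0])
    simp only [f, h0] at h1
    rw [← extendZero_apply V, ← ofChartVec_chartVec hc hx' (extendZero V x),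
      ← ofChartVec_chartVec hc hx' (logField _ x), chartVec_logField _ hc hx', h1]
    refine congrArg _ (Prod.ext ?_ ?_) <;> simp only [logVec, n]
    · linear_combination (F.chartFun c x).1 * (a (F.chartFun c x)).1 * hdet
    · linear_combination (F.chartFun c x).2 * (a (F.chartFun c x)).2 * hdet

variable (F) in
theorem exists_cone : ∃ c, c ∈ F.cones := by
  obtain ⟨c, hc, -⟩ := F.complete 0
  exact ⟨c, hc⟩

/-- On the torus, a holomorphic vector field is given by a holomorphic function with values in
`N ⊗ ℂ`. -/
theorem exists_eq_logField_of_zeros {U : Opens F.ToricSurface}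
    (hU : ∀ x : F.HomogCoord, x.toPoint ∈ U → x.zeros = ∅)
    {V : (x : U) → TangentSpace 𝓘(ℂ, ℂ × ℂ) (x : F.ToricSurface)}
    (hV : IsHolomorphicVectorField V) :
    ∃ h : F.ToricSurface → ℂ × ℂ, HoloOn U h ∧ ∀ x : U, logField h x = V x := by
  obtain ⟨c, hc⟩ := F.exists_cone
  refine exists_eq_logField hc (fun p hp => ?_) hV ?_
  · obtain ⟨x, rfl⟩ := exists_toPoint p
    rw [toPoint_mem_chartOpens, mem_chartDomain_iff, hU x hp]
    exact ⟨Set.empty_subset _, trivial⟩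
  -- On the torus the condition along the boundary is vacuous.
  · rintro W hW f hf hf0 ⟨p, hp⟩ hpW hpD
    obtain ⟨x, rfl⟩ := exists_toPoint p
    have h := (toPoint_mem_toricBoundary x).mp hpD
    rw [hU x hp] at h
    exact absurd h Set.not_nonempty_empty

theorem isHolomorphicVectorField_ofChartVec {c : (ℤ × ℤ) × (ℤ × ℤ)} (hc : c ∈ F.cones)
    {V : Opens (ℂ × ℂ)} {f : ℂ × ℂ → ℂ × ℂ} (hf : AnalyticOnNhd ℂ f V) :
    IsHolomorphicVectorField (E := ℂ × ℂ) (M := F.ToricSurface) (U := chartOpens hc V)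
      (fun x => ofChartVec c x.1 (f (F.chartFun c x.1))) := by
  refine (isHolomorphicVectorField_iff_chartVec
    (fun x => ofChartVec c x (f (F.chartFun c x)))).mpr fun x hx => ⟨c, hc, hx.1, ?_⟩
  simp only [chartVec_ofChartVec hc (toPoint_chartCoord_mem_source hc _), chartFun_chartCoord]
  exact hf _ hx.2

variable (F) in
/-- The sections of the sheaf of holomorphic vector fields. -/
noncomputable abbrev vectorFieldSections : AbSections F.ToricSurface :=
  TopCat.Presheaf.sections (vectorFieldSheaf (ℂ × ℂ) F.ToricSurface).obj

variable (F) in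
/-- The sections of the sheaf of holomorphic vector fields with logarithmic zeros along the toric
boundary. -/
noncomputable abbrev logVectorFieldSections : AbSections F.ToricSurface :=
  TopCat.Presheaf.sections (logVectorFieldSheaf (ℂ × ℂ) F.ToricSurface F.toricBoundary).obj

/-- On an affine chart, vector fields are given by their components. -/
noncomputable def vectorFieldModel {c : (ℤ × ℤ) × (ℤ × ℤ)} (hc : c ∈ F.cones) :
    HolomorphicModel (ℂ × ℂ) (chartSections hc F.vectorFieldSections) where
  ofFun V f hf := ⟨fun x => ofChartVec c x.1 (f (F.chartFun c x.1)),
    isHolomorphicVectorField_ofChartVec hc hf⟩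
  exists_ofFun V := by
    rintro ⟨s, hs⟩
    refine ⟨fun z => chartVec c (chartCoord hc z).toPoint (extendZero s (chartCoord hc z).toPoint),
      fun z hz => analyticAt_chartVec_extendZero hs hc
        ((toPoint_chartCoord_mem_chartOpens hc V z).mpr hz), Subtype.ext (funext fun x => ?_)⟩
    have hx : x.1 ∈ (affineChart hc).source := x.2.1
    dsimp only
    rw [toPoint_chartCoord_chartFun hc hx]
    exact (ofChartVec_chartVec hc hx _).trans (extendZero_apply s x)
  ofFun_add V f g hf hg := Subtype.ext (funext fun x => ofChartVec_add _ _ _ _)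
  res_ofFun h f hf := rfl
  ofFun_congr V f g hf hg h := Subtype.ext (funext fun x => congrArg _ (h _ x.2.2))

/-- On the torus, vector fields are given by functions with values in `N ⊗ ℂ`. -/
noncomputable def vectorFieldTorusModel : TorusModel (ℂ × ℂ) F.vectorFieldSections where
  ofFun V h hh := ⟨fun x => logField h x, hh.isHolomorphicVectorField_logField⟩
  ofFun_add V h k hh hk := Subtype.ext (funext fun x => logField_add h k x)
  res_ofFun hUV h hh := rfl
  ofFun_congr V h k hh hk e := Subtype.ext (funext fun x => logField_congr (e x x.2))
  exists_ofFun V hV := by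
    rintro ⟨s, hs⟩
    obtain ⟨h, hh, e⟩ := exists_eq_logField_of_zeros hV hs
    exact ⟨h, hh, Subtype.ext (funext e)⟩

/-- On an affine chart, logarithmic vector fields are given by functions with values
in `N ⊗ ℂ`. -/
noncomputable def logVectorFieldModel {c : (ℤ × ℤ) × (ℤ × ℤ)} (hc : c ∈ F.cones) :
    HolomorphicModel (ℂ × ℂ) (chartSections hc F.logVectorFieldSections) where
  ofFun V f hf := ⟨fun x => logField (fun x => f (F.chartFun c x)) x,
    (HoloOn.comp_chartFun hc hf le_rfl).isHolomorphicVectorField_logField,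
    preservesIdeal_logField _ _⟩
  exists_ofFun V := by
    rintro ⟨s, hs⟩
    obtain ⟨h, hh, e⟩ := exists_eq_logField hc (chartOpens_mono hc V ⊤ le_top) hs.1 hs.2
    refine ⟨fun z => h (chartCoord hc z).toPoint,
      fun z hz => hh c hc z ((toPoint_chartCoord_mem_chartOpens hc V z).mpr hz),
      Subtype.ext (funext fun x => ?_)⟩
    exact (logField_congr (h := fun x => h (chartCoord hc (F.chartFun c x)).toPoint) (k := h)
      (congrArg h (toPoint_chartCoord_chartFun hc x.2.1))).trans (e x)
  ofFun_add V f g hf hg := Subtype.ext (funext fun x =>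
    logField_add (fun x => f (F.chartFun c x)) (fun x => g (F.chartFun c x)) x.1)
  res_ofFun h f hf := rfl
  ofFun_congr V f g hf hg h := Subtype.ext (funext fun x => logField_congr
    (h := fun x => f (F.chartFun c x)) (k := fun x => g (F.chartFun c x)) (h _ x.2.2))

/-- On the torus, logarithmic vector fields are given by functions with values in `N ⊗ ℂ`. -/
noncomputable def logVectorFieldTorusModel : TorusModel (ℂ × ℂ) F.logVectorFieldSections where
  ofFun V h hh := ⟨fun x => logField h x, hh.isHolomorphicVectorField_logField,
    preservesIdeal_logField h V⟩
  ofFun_add V h k hh hk := Subtype.ext (funext fun x => logField_add h k x)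
  res_ofFun hUV h hh := rfl
  ofFun_congr V h k hh hk e := Subtype.ext (funext fun x => logField_congr (e x x.2))
  exists_ofFun V hV := by
    rintro ⟨s, hs⟩
    obtain ⟨h, hh, e⟩ := exists_eq_logField_of_zeros hV hs.1
    exact ⟨h, hh, Subtype.ext (funext e)⟩

end SmoothCompleteFan

/-- The two sheaves differ only in their frames on the affine charts, logarithmic or coordinate; on
the torus both use the frame of `N ⊗ ℂ`. -/
theorem mainTheorem7 (F : SmoothCompleteFan) :
    Subsingleton (Sheaf.H (logVectorFieldSheaf (ℂ × ℂ) F.ToricSurface F.toricBoundary) 2) ∧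
      Subsingleton (Sheaf.H (vectorFieldSheaf (ℂ × ℂ) F.ToricSurface) 2) :=
  ⟨subsingleton_H_two _ fun _ _ _ _ S T => SmoothCompleteFan.acyclic_top S T
      (fun _ hc => SmoothCompleteFan.logVectorFieldModel hc)
      SmoothCompleteFan.logVectorFieldTorusModel,
    subsingleton_H_two _ fun _ _ _ _ S T => SmoothCompleteFan.acyclic_top S T
      (fun _ hc => SmoothCompleteFan.vectorFieldModel hc)
      SmoothCompleteFan.vectorFieldTorusModel⟩
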